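/- Let $h,k\ge 0$ be integers and let $M$ be a smooth manifold (Hausdorff, second countable, without boundary) of dimension $2h+2k+2$. All objects are smooth. Let $(\alpha_1,\alpha_2)$ be a contact pair of type $(h,k)$ on $M$, i.e. a pair of $1$-forms such that $\alpha_1\wedge(d\alpha_1)^h\wedge\alpha_2\wedge(d\alpha_2)^k$ is a volume form, $(d\alpha_1)^{h+1}=0$ and $(d\alpha_2)^{k+1}=0$. Let $Z_1,Z_2$ be its Reeb vector fields, determined by $\alpha_i(Z_j)=\delta_{ij}$ and $i_{Z_j}d\alpha_i=0$ for $i,j\in\{1,2\}$, and let $\mathcal F_i$ be the characteristic foliation of $\alpha_i$, with tangent distribution $T\mathcal F_i=\ker\alpha_i\cap\ker d\alpha_i$, where $\ker d\alpha_i=\{v : i_v d\alpha_i=0\}$. Let $\phi$ be a $(1,1)$-tensor field with $$\phi^2=-\mathrm{Id}+\alpha_1\otimes Z_1+\alpha_2\otimes Z_2,\qquad \phi(Z_1)=\phi(Z_2)=0,$$ so that $(\alpha_1,\alpha_2,\phi)$ is a contact pair structure, and suppose that $\phi$ is decomposable, i.e. $\phi(T\mathcal F_i)\subset T\mathcal F_i$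 for $i=1,2$. Put $$J=\phi-\alpha_2\otimes Z_1+\alpha_1\otimes Z_2,\qquad T=\phi+\alpha_2\otimes Z_1-\alpha_1\otimes Z_2 .$$ For a $(1,1)$-tensor field $A$ write $[A,A](X,Y)=A^2[X,Y]+[AX,AY]-A[AX,Y]-A[X,AY]$. An almost complex structure $A$ is called integrable if $[A,A]=0$. An almost contact structure $(\alpha,Z,\psi)$ on a manifold $L$ is called normal if the almost complex structure $X+f\frac{d}{dt}\mapsto \psi X-fZ+\alpha(X)\frac{d}{dt}$ on $L\times\mathbb R$ is integrable. Suppose that $L_{Z_1}\phi=0$ (resp. $L_{Z_2}\phi=0$). Then the following conditions are equivalent: (i) $J$ is integrable; (ii) $T$ is integrable; (iii) the almost contact structures induced by $(\alpha_1,Z_1,\phi)$ on the leaves of $\mathcal F_2$ and by $(\alpha_2,Z_2,\phi)$ on the leaves of $\mathcal F_1$ are normal, and $[\phi,\phi](X,Y)=0$ for all sections $X$ of $T\mathcal F_1$ and $Y$ of $T\mathcal F_2$. Moreover, these equivalent conditions imply $L_{Z_2}\phi=0$ (resp. $L_{Z_1}\phi=0$). -/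

import Mathlib

open scoped Manifold ContDiff

universe u

namespace ContactPairs

noncomputable section

/-! ### Exterior algebra of a real vector space -/

section Wedge

variable {V : Type*} [AddCommGroup V] [Module ℝ V]

/-- The wedge product `a ∧ b` of alternating forms of degrees `m` and `n`
(sum over the `(m, n)`-shuffles). -/
def wedge {m n : ℕ} (a : V [⋀^Fin m]→ₗ[ℝ] ℝ) (b : V [⋀^Fin n]→ₗ[ℝ] ℝ) :
    V [⋀^Fin (m + n)]→ₗ[ℝ] ℝ :=
  ((LinearMap.mul' ℝ ℝ).compAlternatingMap (a.domCoprod b)).domDomCongr finSumFinEquiv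

/-- The `n`-th exterior power `η ∧ ⋯ ∧ η` of a `2`-form `η`, with `η ^ 0 = 1`. -/
def wedgePow (η : V [⋀^Fin 2]→ₗ[ℝ] ℝ) : (n : ℕ) → V [⋀^Fin (2 * n)]→ₗ[ℝ] ℝ
  | 0 => AlternatingMap.constOfIsEmpty ℝ V (Fin 0) (1 : ℝ)
  | n + 1 => wedge (wedgePow η n) η

/-- A linear form as an alternating form of degree one. -/
def oneForm (a : V →ₗ[ℝ] ℝ) : V [⋀^Fin 1]→ₗ[ℝ] ℝ :=
  AlternatingMap.ofSubsingleton ℝ V ℝ (0 : Fin 1) a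

end Wedge

/-! ### Tensor fields on a manifold -/

section Manifold

variable {E : Type*} [NormedAddCommGroup E] [NormedSpace ℝ E]
  {H : Type*} [TopologicalSpace H] (I : ModelWithCorners ℝ E H)
  {M : Type*} [TopologicalSpace M] [ChartedSpace H M]

/-- `X` is a smooth vector field on `M`. -/
def IsSmoothVectorField [IsManifold I ∞ M] (X : Π x : M, TangentSpace I x) : Prop :=
  ContMDiff I I.tangent ∞ (fun x => (⟨x, X x⟩ : TangentBundle I M))

/-- `α` is a smooth `1`-form on `M`: a smooth section of the cotangent bundle. -/
def IsSmoothOneForm [IsManifold I ∞ M] (α : Π x : M, TangentSpace I x →L[ℝ] ℝ) : Prop :=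
  ContMDiff I (I.prod 𝓘(ℝ, E →L[ℝ] ℝ)) ∞ (fun x => Bundle.TotalSpace.mk' (E →L[ℝ] ℝ)
    (E := fun x : M => TangentSpace I x →L[ℝ] Bundle.Trivial M ℝ x) x (α x))

/-- `φ` is a smooth tensor field of type `(1,1)` on `M`: a smooth section of the bundle of
endomorphisms of the tangent bundle. -/
def IsSmoothEndomorphism [IsManifold I ∞ M]
    (φ : Π x : M, TangentSpace I x →L[ℝ] TangentSpace I x) : Prop :=
  ContMDiff I (I.prod 𝓘(ℝ, E →L[ℝ] E)) ∞ (fun x => Bundle.TotalSpace.mk' (E →L[ℝ] E)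
    (E := fun x : M => TangentSpace I x →L[ℝ] TangentSpace I x) x (φ x))

/-- The expression of the `1`-form `α` in the preferred chart at `x₀`: its pullback by the inverse
of the chart, a differential form of degree one on the model vector space. -/
def chartForm (α : Π x : M, TangentSpace I x →L[ℝ] ℝ) (x₀ : M) (y : E) : E [⋀^Fin 1]→L[ℝ] ℝ :=
  ContinuousAlternatingMap.ofSubsingleton ℝ E ℝ (0 : Fin 1)
    ((α ((extChartAt I x₀).symm y)).comp
      (mfderivWithin 𝓘(ℝ, E) I (extChartAt I x₀).symm (Set.range I) y))

/-- The exterior derivative `dα` at `x` of a `1`-form `α`: the exterior derivative of the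
expression of `α` in the preferred chart at `x`, pulled back by the derivative of that chart. -/
def extDer (α : Π x : M, TangentSpace I x →L[ℝ] ℝ) (x : M) :
    TangentSpace I x [⋀^Fin 2]→ₗ[ℝ] ℝ :=
  (extDerivWithin (chartForm I α x) (Set.range I) (extChartAt I x x)).toAlternatingMap.compLinearMap
    (mfderiv I 𝓘(ℝ, E) (extChartAt I x) x).toLinearMap

/-- The distribution `ker α ∩ ker dα`, where
`ker dα = {v | dα (v, w) = 0 for all w}`. -/
def charDistribution (α : Π x : M, TangentSpace I x →L[ℝ] ℝ) (x : M) :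
    Submodule ℝ (TangentSpace I x) :=
  LinearMap.ker (α x).toLinearMap ⊓ LinearMap.ker (extDer I α x).curryLeft

/-- The Nijenhuis torsion
`[φ, φ] (X, Y) = φ² [X, Y] + [φ X, φ Y] - φ [φ X, Y] - φ [X, φ Y]`. -/
def nijenhuis (φ : Π x : M, TangentSpace I x →L[ℝ] TangentSpace I x)
    (X Y : Π x : M, TangentSpace I x) (x : M) : TangentSpace I x :=
  φ x (φ x (VectorField.mlieBracket I X Y x))
    + VectorField.mlieBracket I (fun y => φ y (X y)) (fun y => φ y (Y y)) x
    - φ x (VectorField.mlieBracket I (fun y => φ y (X y)) Y x)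
    - φ x (VectorField.mlieBracket I X (fun y => φ y (Y y)) x)

/-- An almost complex structure `J` is integrable if its Nijenhuis tensor vanishes identically. -/
def IsIntegrable [IsManifold I ∞ M] (J : Π x : M, TangentSpace I x →L[ℝ] TangentSpace I x) : Prop :=
  ∀ X Y : Π x : M, TangentSpace I x, IsSmoothVectorField I X → IsSmoothVectorField I Y →
    ∀ x, nijenhuis I J X Y x = 0

/-- The Lie derivative of a `(1,1)`-tensor field along `Z`:
`(L_Z φ) (X) = [Z, φ X] - φ [Z, X]`. -/
def lieDerivative (Z : Π x : M, TangentSpace I x)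
    (φ : Π x : M, TangentSpace I x →L[ℝ] TangentSpace I x)
    (X : Π x : M, TangentSpace I x) (x : M) : TangentSpace I x :=
  VectorField.mlieBracket I Z (fun y => φ y (X y)) x - φ x (VectorField.mlieBracket I Z X x)

/-- `L_Z φ = 0`. -/
def LieDerivativeVanishes [IsManifold I ∞ M] (Z : Π x : M, TangentSpace I x)
    (φ : Π x : M, TangentSpace I x →L[ℝ] TangentSpace I x) : Prop :=
  ∀ X : Π x : M, TangentSpace I x, IsSmoothVectorField I X → ∀ x, lieDerivative I Z φ X x = 0

/-! ### Normal almost contact structures -/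

/-- The almost complex structure on `M × ℝ` associated to an almost contact structure `(α, Z, φ)`
on `M`: it maps `X + f d/dt` to `φ X - f Z + α (X) d/dt`. The tangent space of `M × ℝ` at `(x, t)`
is the product of the tangent space of `M` at `x` and of `ℝ`. -/
def coneStructure (α : Π x : M, TangentSpace I x →L[ℝ] ℝ) (Z : Π x : M, TangentSpace I x)
    (φ : Π x : M, TangentSpace I x →L[ℝ] TangentSpace I x) (q : M × ℝ) :
    TangentSpace (I.prod 𝓘(ℝ, ℝ)) q →L[ℝ] TangentSpace (I.prod 𝓘(ℝ, ℝ)) q :=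
  let pr₁ : TangentSpace I q.1 × ℝ →L[ℝ] TangentSpace I q.1 := ContinuousLinearMap.fst ℝ _ _
  let pr₂ : TangentSpace I q.1 × ℝ →L[ℝ] ℝ := ContinuousLinearMap.snd ℝ _ _
  ((φ q.1).comp pr₁ - pr₂.smulRight (Z q.1)).prod ((α q.1).comp pr₁)

/-- An almost contact structure `(α, Z, φ)` on `M` is normal if the associated almost complex
structure on `M × ℝ` is integrable. -/
def IsNormalAlmostContact [IsManifold I ∞ M] (α : Π x : M, TangentSpace I x →L[ℝ] ℝ)
    (Z : Π x : M, TangentSpace I x)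
    (φ : Π x : M, TangentSpace I x →L[ℝ] TangentSpace I x) : Prop :=
  IsIntegrable (I.prod 𝓘(ℝ, ℝ)) (coneStructure I α Z φ)

/-! ### Integral manifolds and induced structures -/

variable {E' : Type*} [NormedAddCommGroup E'] [NormedSpace ℝ E']
  {H' : Type*} [TopologicalSpace H'] (I' : ModelWithCorners ℝ E' H')
  {L : Type*} [TopologicalSpace L] [ChartedSpace H' L]

/-- `ι : L → M` is an injectively immersed integral manifold of the distribution `F`: an injective
smooth map whose derivative at each point `p` is an isomorphism onto `F (ι p)`. -/
structure IsIntegralManifold (F : Π x : M, Submodule ℝ (TangentSpace I x)) (ι : L → M) : Prop where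
  smooth : ContMDiff I' I ∞ ι
  injective : Function.Injective ι
  immersion : ∀ p, (mfderiv I' I ι p).HasLeftInverse
  tangent : ∀ p, LinearMap.range (mfderiv I' I ι p).toLinearMap = F (ι p)

variable {I I'}

/-- The restriction `ι^* α` of a `1`-form. -/
def restrictForm (ι : L → M) (α : Π x : M, TangentSpace I x →L[ℝ] ℝ) (p : L) :
    TangentSpace I' p →L[ℝ] ℝ :=
  (α (ι p)).comp (mfderiv I' I ι p)

/-- The restriction to an integral manifold of a vector field `Z` tangent to the distribution:
the only vector field on `L` that is mapped to `Z` by the derivative of `ι`. -/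
def restrictField {F : Π x : M, Submodule ℝ (TangentSpace I x)} {ι : L → M}
    (hι : IsIntegralManifold I I' F ι) (Z : Π x : M, TangentSpace I x) (p : L) :
    TangentSpace I' p :=
  (hι.immersion p).leftInverse (Z (ι p))

/-- The restriction to an integral manifold of an endomorphism field `φ` preserving the
distribution: the only endomorphism field on `L` intertwined with `φ` by the derivative of `ι`. -/
def restrictEndomorphism {F : Π x : M, Submodule ℝ (TangentSpace I x)} {ι : L → M}
    (hι : IsIntegralManifold I I' F ι)
    (φ : Π x : M, TangentSpace I x →L[ℝ] TangentSpace I x) (p : L) :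
    TangentSpace I' p →L[ℝ] TangentSpace I' p :=
  (hι.immersion p).leftInverse.comp ((φ (ι p)).comp (mfderiv I' I ι p))

/-- The defining property of `restrictField`. -/
theorem mfderiv_restrictField {F : Π x : M, Submodule ℝ (TangentSpace I x)} {ι : L → M}
    (hι : IsIntegralManifold I I' F ι) (Z : Π x : M, TangentSpace I x) (p : L)
    (hZ : Z (ι p) ∈ F (ι p)) :
    mfderiv I' I ι p (restrictField hι Z p) = Z (ι p) := by
  rw [← hι.tangent p] at hZ
  obtain ⟨v, hv⟩ := hZ
  have hv' : mfderiv I' I ι p v = Z (ι p) := hv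
  unfold restrictField
  rw [← hv', (hι.immersion p).leftInverse_leftInverse v]

/-- The defining property of `restrictEndomorphism`. -/
theorem mfderiv_restrictEndomorphism {F : Π x : M, Submodule ℝ (TangentSpace I x)} {ι : L → M}
    (hι : IsIntegralManifold I I' F ι)
    (φ : Π x : M, TangentSpace I x →L[ℝ] TangentSpace I x) (p : L)
    (hφ : ∀ v ∈ F (ι p), φ (ι p) v ∈ F (ι p)) (w : TangentSpace I' p) :
    mfderiv I' I ι p (restrictEndomorphism hι φ p w) = φ (ι p) (mfderiv I' I ι p w) := by
  have h1 : mfderiv I' I ι p w ∈ F (ι p) := by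
    rw [← hι.tangent p]
    exact ⟨w, rfl⟩
  have h2 := hφ _ h1
  rw [← hι.tangent p] at h2
  obtain ⟨v, hv⟩ := h2
  have hv' : mfderiv I' I ι p v = φ (ι p) (mfderiv I' I ι p w) := hv
  have h3 : restrictEndomorphism hι φ p w
      = (hι.immersion p).leftInverse (φ (ι p) (mfderiv I' I ι p w)) := rfl
  rw [h3, ← hv', (hι.immersion p).leftInverse_leftInverse v]

end Manifold

/-! ### Contact pairs -/

section ContactPair

variable {n : ℕ} {M : Type u} [TopologicalSpace M]
  [ChartedSpace (EuclideanSpace ℝ (Fin n)) M] [IsManifold (𝓡 n) ∞ M]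

/-- For a foliation with tangent distribution `F` preserved by `φ` and containing `Z`, the
structure `(α, Z, φ)` induced on the leaves is normal. A leaf is a maximal connected integral
manifold and each connected integral manifold is an open piece of a leaf; normality being local,
the condition is imposed on all of them. -/
def InducedStructuresNormal (F : Π x : M, Submodule ℝ (TangentSpace (𝓡 n) x))
    (α : Π x : M, TangentSpace (𝓡 n) x →L[ℝ] ℝ) (Z : Π x : M, TangentSpace (𝓡 n) x)
    (φ : Π x : M, TangentSpace (𝓡 n) x →L[ℝ] TangentSpace (𝓡 n) x) : Prop :=
  ∀ (d : ℕ) (L : Type u) [TopologicalSpace L] [T2Space L] [SecondCountableTopology L]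
    [ConnectedSpace L] [ChartedSpace (EuclideanSpace ℝ (Fin d)) L] [IsManifold (𝓡 d) ∞ L]
    (ι : L → M) (hι : IsIntegralManifold (𝓡 n) (𝓡 d) F ι),
    IsNormalAlmostContact (𝓡 d) (restrictForm ι α) (restrictField hι Z)
      (restrictEndomorphism hι φ)

/-- `(α₁, α₂)` is a contact pair of type `(h, k)` on `M`, where `dim M = 2h + 2k + 2`:
`α₁ ∧ (dα₁)^h ∧ α₂ ∧ (dα₂)^k` is a volume form, `(dα₁)^(h+1) = 0` and `(dα₂)^(k+1) = 0`. -/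
structure IsContactPair (h k : ℕ) {M : Type u} [TopologicalSpace M]
    [ChartedSpace (EuclideanSpace ℝ (Fin (2 * h + 2 * k + 2))) M]
    [IsManifold (𝓡 (2 * h + 2 * k + 2)) ∞ M]
    (α₁ α₂ : Π x : M, TangentSpace (𝓡 (2 * h + 2 * k + 2)) x →L[ℝ] ℝ) : Prop where
  smooth₁ : IsSmoothOneForm (𝓡 (2 * h + 2 * k + 2)) α₁
  smooth₂ : IsSmoothOneForm (𝓡 (2 * h + 2 * k + 2)) α₂
  volume : ∀ x,
    wedge (oneForm (α₁ x).toLinearMap)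
      (wedge (wedgePow (extDer (𝓡 (2 * h + 2 * k + 2)) α₁ x) h)
        (wedge (oneForm (α₂ x).toLinearMap)
          (wedgePow (extDer (𝓡 (2 * h + 2 * k + 2)) α₂ x) k))) ≠ 0
  pow₁ : ∀ x, wedgePow (extDer (𝓡 (2 * h + 2 * k + 2)) α₁ x) (h + 1) = 0
  pow₂ : ∀ x, wedgePow (extDer (𝓡 (2 * h + 2 * k + 2)) α₂ x) (k + 1) = 0

/-- `Z₁, Z₂` are the Reeb vector fields of `(α₁, α₂)`. -/
structure IsReebPair (α₁ α₂ : Π x : M, TangentSpace (𝓡 n) x →L[ℝ] ℝ)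
    (Z₁ Z₂ : Π x : M, TangentSpace (𝓡 n) x) : Prop where
  smooth₁ : IsSmoothVectorField (𝓡 n) Z₁
  smooth₂ : IsSmoothVectorField (𝓡 n) Z₂
  form₁₁ : ∀ x, α₁ x (Z₁ x) = 1
  form₂₂ : ∀ x, α₂ x (Z₂ x) = 1
  form₁₂ : ∀ x, α₁ x (Z₂ x) = 0
  form₂₁ : ∀ x, α₂ x (Z₁ x) = 0
  contract₁₁ : ∀ x, (extDer (𝓡 n) α₁ x).curryLeft (Z₁ x) = 0
  contract₂₁ : ∀ x, (extDer (𝓡 n) α₂ x).curryLeft (Z₁ x) = 0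
  contract₁₂ : ∀ x, (extDer (𝓡 n) α₁ x).curryLeft (Z₂ x) = 0
  contract₂₂ : ∀ x, (extDer (𝓡 n) α₂ x).curryLeft (Z₂ x) = 0

/-- A contact pair structure `(α₁, α₂, φ)` of type `(h, k)` on `M`. The Reeb vector fields
`Z₁, Z₂` are recorded with it; they are determined by `(α₁, α₂)`. -/
structure ContactPairStructure (h k : ℕ) (M : Type u) [TopologicalSpace M]
    [ChartedSpace (EuclideanSpace ℝ (Fin (2 * h + 2 * k + 2))) M]
    [IsManifold (𝓡 (2 * h + 2 * k + 2)) ∞ M] where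
  α₁ : Π x : M, TangentSpace (𝓡 (2 * h + 2 * k + 2)) x →L[ℝ] ℝ
  α₂ : Π x : M, TangentSpace (𝓡 (2 * h + 2 * k + 2)) x →L[ℝ] ℝ
  φ : Π x : M, TangentSpace (𝓡 (2 * h + 2 * k + 2)) x →L[ℝ]
    TangentSpace (𝓡 (2 * h + 2 * k + 2)) x
  Z₁ : Π x : M, TangentSpace (𝓡 (2 * h + 2 * k + 2)) x
  Z₂ : Π x : M, TangentSpace (𝓡 (2 * h + 2 * k + 2)) x
  contactPair : IsContactPair h k α₁ α₂
  reeb : IsReebPair α₁ α₂ Z₁ Z₂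
  smooth_φ : IsSmoothEndomorphism (𝓡 (2 * h + 2 * k + 2)) φ
  φ_sq : ∀ x v, φ x (φ x v) = -v + α₁ x v • Z₁ x + α₂ x v • Z₂ x
  φ_Z₁ : ∀ x, φ x (Z₁ x) = 0
  φ_Z₂ : ∀ x, φ x (Z₂ x) = 0

namespace ContactPairStructure

variable {h k : ℕ} {M : Type u} [TopologicalSpace M]
  [ChartedSpace (EuclideanSpace ℝ (Fin (2 * h + 2 * k + 2))) M]
  [IsManifold (𝓡 (2 * h + 2 * k + 2)) ∞ M] (S : ContactPairStructure h k M)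

/-- The tangent distribution `ker α₁ ∩ ker dα₁` of the characteristic foliation of `α₁`. -/
def TF₁ (x : M) : Submodule ℝ (TangentSpace (𝓡 (2 * h + 2 * k + 2)) x) :=
  charDistribution (𝓡 (2 * h + 2 * k + 2)) S.α₁ x

/-- The tangent distribution `ker α₂ ∩ ker dα₂` of the characteristic foliation of `α₂`. -/
def TF₂ (x : M) : Submodule ℝ (TangentSpace (𝓡 (2 * h + 2 * k + 2)) x) :=
  charDistribution (𝓡 (2 * h + 2 * k + 2)) S.α₂ x

/-- `φ` is decomposable: it preserves the tangent distributions of both foliations. -/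
def IsDecomposable : Prop :=
  ∀ x, (∀ v ∈ S.TF₁ x, S.φ x v ∈ S.TF₁ x) ∧ (∀ v ∈ S.TF₂ x, S.φ x v ∈ S.TF₂ x)

/-- The almost complex structure `J = φ - α₂ ⊗ Z₁ + α₁ ⊗ Z₂`. -/
def J (x : M) : TangentSpace (𝓡 (2 * h + 2 * k + 2)) x →L[ℝ]
    TangentSpace (𝓡 (2 * h + 2 * k + 2)) x :=
  S.φ x - (S.α₂ x).smulRight (S.Z₁ x) + (S.α₁ x).smulRight (S.Z₂ x)

/-- The almost complex structure `T = φ + α₂ ⊗ Z₁ - α₁ ⊗ Z₂`. -/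
def T (x : M) : TangentSpace (𝓡 (2 * h + 2 * k + 2)) x →L[ℝ]
    TangentSpace (𝓡 (2 * h + 2 * k + 2)) x :=
  S.φ x + (S.α₂ x).smulRight (S.Z₁ x) - (S.α₁ x).smulRight (S.Z₂ x)

/-- `J` is integrable. -/
def JIntegrable : Prop := IsIntegrable (𝓡 (2 * h + 2 * k + 2)) S.J

/-- `T` is integrable. -/
def TIntegrable : Prop := IsIntegrable (𝓡 (2 * h + 2 * k + 2)) S.T

/-- The structures induced on the leaves are normal: `(α₁, Z₁, φ)` on the leaves of the
characteristic foliation of `α₂`, and `(α₂, Z₂, φ)` on those of the characteristic foliation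
of `α₁`. -/
def LeavesNormal : Prop :=
  InducedStructuresNormal S.TF₂ S.α₁ S.Z₁ S.φ ∧ InducedStructuresNormal S.TF₁ S.α₂ S.Z₂ S.φ

/-- `[φ, φ] (X, Y) = 0` for all smooth sections `X` of `TF₁` and `Y` of `TF₂`. -/
def MixedTorsionVanishes : Prop :=
  ∀ X Y : Π x : M, TangentSpace (𝓡 (2 * h + 2 * k + 2)) x,
    IsSmoothVectorField (𝓡 (2 * h + 2 * k + 2)) X →
    IsSmoothVectorField (𝓡 (2 * h + 2 * k + 2)) Y →
    (∀ x, X x ∈ S.TF₁ x) → (∀ x, Y x ∈ S.TF₂ x) →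
    ∀ x, nijenhuis (𝓡 (2 * h + 2 * k + 2)) S.φ X Y x = 0

end ContactPairStructure

end ContactPair

end

end ContactPairs

/-! All three conditions are compared with one tensor, N = [φ,φ] + dα₁ ⊗ Z₁ + dα₂ ⊗ Z₂
(`IsNormalAt`, `IsNormalPair`): each amounts to N = 0, where (i) and (ii) use the Lie derivative
hypothesis and (iii) does not. Since N is symmetric in the two indices and T is the J of the pair
with indices exchanged, (ii) reduces to (i).

For J, split vectors into Reeb vectors and horizontal ones, those killed by α₁ and α₂. For
horizontal v, [J,J](Z₁,v) = L_{Z₂}φ v - φ L_{Z₁}φ v and [J,J](Z₂,v) = -L_{Z₁}φ v - φ L_{Z₂}φ v,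
while [J,J](Z₁,Z₂) = 0. So if J is integrable and φ is invariant under one Reeb field, it is
invariant under the other, which is the last assertion. On horizontal vectors [J,J] is N plus Reeb
components dαᵢ(φu,v) + dαᵢ(u,φv); decomposability isolates these components, and integrability makes
them vanish (`isNormalAt_of_nij_localJ`). Conversely N = 0 forces both Lie derivatives and these
components to vanish (`nij_localJ_eq_zero_of_isNormalAt`).

For (iii), the tangent space is TF₁ ⊕ TF₂. On TF₂ the form dα₂ drops out of N, and what remains is
the horizontal part of the torsion of the almost complex structure on leaf × ℝ (`nij_localCone`);
likewise on TF₁. On TF₁ × TF₂ both forms drop out and N is [φ,φ]. To pass from leaves to points, an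
integral manifold is needed through every point. The volume condition gives complementary
distributions of ranks 2k + 1 and 2h + 1 (`isCompl_of_wedge_ne_zero`), closedness of dαᵢ gives
involutivity (`bracket_mem_localChar`), and Frobenius' theorem is proved by integrating commuting
fields (`exists_map_hasFDerivAt_of_commute`).

The passage from manifolds to vector spaces evaluates every tensor at the centre of the preferred
chart, where the derivative of the chart is the identity. -/

namespace ContactPairs

/-! ### Integration of commuting vector fields. -/

section Frobenius
open Metric Set

/-- Solution in time `[0, 1]` of an autonomous equation, staying in a closed ball. -/
theorem exists_solution_unit_time {E : Type*} [NormedAddCommGroup E] [NormedSpace ℝ E]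
    [CompleteSpace E] {f : E → E} {x₀ : E} {R L K : NNReal}
    (hL : ∀ x ∈ closedBall x₀ R, ‖f x‖ ≤ L) (hK : LipschitzOnWith K f (closedBall x₀ R))
    (hLR : L ≤ R) :
    ∃ y : ℝ → E, y 0 = x₀ ∧ (∀ t ∈ Icc (0 : ℝ) 1, y t ∈ closedBall x₀ R) ∧
      ∀ t ∈ Icc (0 : ℝ) 1, HasDerivWithinAt y (f (y t)) (Icc 0 1) t := by
  have h0 : (0 : ℝ) ∈ Icc (0 : ℝ) 1 := ⟨le_rfl, zero_le_one⟩
  have hmax : (L : ℝ) * max ((1 : ℝ) - ((⟨0, h0⟩ : Icc (0 : ℝ) 1) : ℝ))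
      (((⟨0, h0⟩ : Icc (0 : ℝ) 1) : ℝ) - 0) ≤ R - (0 : NNReal) := by
    simpa using hLR
  have hP : IsPicardLindelof (fun _ => f) (⟨0, h0⟩ : Icc (0 : ℝ) 1) x₀ R 0 L K :=
    IsPicardLindelof.of_time_independent hL hK hmax
  have hx : x₀ ∈ closedBall x₀ ((0 : NNReal) : ℝ) := by simp
  -- The Picard fixed point itself is kept because elements of its function space stay in the closed
  -- ball by construction.
  obtain ⟨α, hα⟩ := ODE.FunSpace.exists_isFixedPt_next hP hx
  have hmem : ∀ t, α.compProj t ∈ closedBall x₀ R :=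
    fun t => α.compProj_mem_closedBall hP.mul_max_le
  refine ⟨α.compProj, ?_, fun t _ => hmem t, fun t ht => ?_⟩
  · have := ODE.FunSpace.compProj_val (α := α) (t := ⟨0, h0⟩)
    rw [show α.compProj 0 = α ⟨0, h0⟩ from this, ← hα, ODE.FunSpace.next_apply₀]
  · apply ODE.hasDerivWithinAt_picard_Icc h0 hP.continuousOn_uncurry
      α.continuous_compProj.continuousOn (fun _ _ => hmem _) x₀ ht |>.congr_of_mem _ ht
    intro t' ht'
    rw [ODE.FunSpace.compProj_of_mem ht', ← hα, ODE.FunSpace.next_apply, hα]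

/-- First order Taylor estimate on a convex set. -/
theorem norm_sub_fderiv_le {E F : Type*} [NormedAddCommGroup E] [NormedSpace ℝ E]
    [NormedAddCommGroup F] [NormedSpace ℝ F] {f : E → F} {s : Set E} (hs : Convex ℝ s) {K : NNReal}
    (hf : ∀ x ∈ s, DifferentiableAt ℝ f x) (hK : LipschitzOnWith K (fderiv ℝ f) s) {x y : E}
    (hx : x ∈ s) (hy : y ∈ s) :
    ‖f y - f x - fderiv ℝ f x (y - x)‖ ≤ K * ‖y - x‖ ^ 2 := by
  have hseg : segment ℝ x y ⊆ s := hs.segment_subset hx hy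
  have := (convex_segment x y).norm_image_sub_le_of_norm_hasFDerivWithin_le' (f := f)
    (f' := fderiv ℝ f) (φ := fderiv ℝ f x) (C := K * ‖y - x‖)
    (fun z hz => (hf z (hseg hz)).hasFDerivAt.hasFDerivWithinAt)
    (fun z hz => by
      have h1 := hK.norm_sub_le (hseg hz) hx
      refine h1.trans ?_
      gcongr
      obtain ⟨a, b, ha, hb, hab, rfl⟩ := hz
      have : a • x + b • y - x = b • (y - x) := by
        have : a = 1 - b := by linarith
        subst this; module
      rw [this, norm_smul, Real.norm_of_nonneg hb]
      exact mul_le_of_le_one_left (norm_nonneg _) (by linarith))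
    (left_mem_segment ℝ x y) (right_mem_segment ℝ x y)
  refine this.trans (le_of_eq (by ring))

/-- **Frobenius theorem**, analytic form: commuting vector fields `σ a`, depending linearly on a
parameter `a`, are the partial derivatives of a map defined near the origin. -/
theorem exists_map_hasFDerivAt_of_commute {A E : Type*} [NormedAddCommGroup A] [NormedSpace ℝ A]
    [NormedAddCommGroup E] [NormedSpace ℝ E] [CompleteSpace E] {σ : E → A →L[ℝ] E} {x₀ : E}
    {U : Set E} (hU : IsOpen U) (hx₀ : x₀ ∈ U) (hσ : ContDiffOn ℝ ∞ σ U)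
    (hcomm : ∀ x ∈ U, ∀ a b, fderiv ℝ σ x (σ x a) b = fderiv ℝ σ x (σ x b) a) :
    ∃ r > 0, ∃ f : A → E, f 0 = x₀ ∧ ∀ a ∈ ball (0 : A) r, f a ∈ U ∧ HasFDerivAt f (σ (f a)) a := by
  have hσ₀ : ContDiffAt ℝ ∞ σ x₀ := hσ.contDiffAt (hU.mem_nhds hx₀)
  obtain ⟨K₁, s₁, hs₁, hK₁⟩ :=
    (hσ₀.of_le (by exact_mod_cast le_top : (1 : WithTop ℕ∞) ≤ ∞)).exists_lipschitzOnWith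
  obtain ⟨K₂, s₂, hs₂, hK₂⟩ := (hσ₀.fderiv_right (m := 1) (by norm_cast)).exists_lipschitzOnWith
  have hb₁ : ∀ᶠ x in nhds x₀, ‖σ x‖ < ‖σ x₀‖ + 1 :=
    hσ₀.continuousAt.norm.eventually (gt_mem_nhds (by linarith))
  have hb₂ : ∀ᶠ x in nhds x₀, ‖fderiv ℝ σ x‖ < ‖fderiv ℝ σ x₀‖ + 1 :=
    (hσ₀.fderiv_right (m := 1) (by norm_cast)).continuousAt.norm.eventually
      (gt_mem_nhds (by linarith))
  obtain ⟨R', hR', hball⟩ := Metric.mem_nhds_iff.1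
    (Filter.inter_mem (Filter.inter_mem (hU.mem_nhds hx₀) (Filter.inter_mem hs₁ hs₂))
      (Filter.inter_mem hb₁ hb₂))
  obtain ⟨C, hC⟩ : ∃ C : NNReal, (C : ℝ) = ‖σ x₀‖ + 1 := ⟨⟨_, by positivity⟩, rfl⟩
  obtain ⟨D, hD⟩ : ∃ D : NNReal, (D : ℝ) = ‖fderiv ℝ σ x₀‖ + 1 := ⟨⟨_, by positivity⟩, rfl⟩
  have hC0 : (0 : ℝ) < C := by rw [hC]; positivity
  obtain ⟨R, hR⟩ : ∃ R : NNReal, (R : ℝ) = R' / 4 := ⟨⟨_, by positivity⟩, rfl⟩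
  have hR0 : (0 : ℝ) < R := by rw [hR]; positivity
  -- Trajectories stay within R of x₀, and the comparison curves below differ from them by at most
  -- R; hence the radius 2R, safely inside R' = 4R.
  set B := closedBall x₀ (2 * R : ℝ) with hBdef
  have hBsub : B ⊆ ball x₀ R' := closedBall_subset_ball (by rw [hR]; linarith)
  have hBU : B ⊆ U := fun x hx => (hball (hBsub hx)).1.1
  have hBK₁ : LipschitzOnWith K₁ σ B := hK₁.mono fun x hx => (hball (hBsub hx)).1.2.1
  have hBK₂ : LipschitzOnWith K₂ (fderiv ℝ σ) B := hK₂.mono fun x hx => (hball (hBsub hx)).1.2.2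
  have hBC : ∀ x ∈ B, ‖σ x‖ ≤ C := fun x hx => by rw [hC]; exact (hball (hBsub hx)).2.1.le
  have hBD : ∀ x ∈ B, ‖fderiv ℝ σ x‖ ≤ D := fun x hx => by rw [hD]; exact (hball (hBsub hx)).2.2.le
  have hdiff : ∀ x ∈ B, DifferentiableAt ℝ σ x := fun x hx =>
    ((hσ.contDiffAt (hU.mem_nhds (hBU hx))).differentiableAt (by simp))
  have hBR : closedBall x₀ (R : ℝ) ⊆ B := closedBall_subset_closedBall (by linarith)
  have hBconv : Convex ℝ B := convex_closedBall _ _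
  -- The bound R / C keeps the speed ‖σ x a‖ below R, so that solutions exist up to time 1; the
  -- bound 1 makes K₁ a Lipschitz constant of x ↦ σ x a.
  set r : ℝ := min 1 (R / C) with hr
  have hr0 : 0 < r := by positivity
  have hr1 : r ≤ 1 := min_le_left _ _
  have hrC : C * r ≤ R := by
    calc (C : ℝ) * r ≤ C * (R / C) := by gcongr; exact min_le_right _ _
      _ = R := by field_simp
  have hKa : ∀ a : A, ‖a‖ < r → LipschitzOnWith K₁ (fun x => σ x a) B := by
    intro a ha
    refine LipschitzOnWith.of_dist_le_mul fun x hx y hy => ?_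
    rw [dist_eq_norm, dist_eq_norm, ← sub_apply]
    calc ‖(σ x - σ y) a‖ ≤ ‖σ x - σ y‖ * ‖a‖ := ContinuousLinearMap.le_opNorm _ _
      _ ≤ (K₁ * ‖x - y‖) * 1 := by
        gcongr
        · exact hBK₁.norm_sub_le hx hy
        · linarith
      _ = _ := by ring
  have hex : ∀ a : A, ‖a‖ < r → ∃ y : ℝ → E, y 0 = x₀ ∧
      (∀ t ∈ Icc (0 : ℝ) 1, y t ∈ closedBall x₀ (R : ℝ)) ∧
      ∀ t ∈ Icc (0 : ℝ) 1, HasDerivWithinAt y (σ (y t) a) (Icc 0 1) t := by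
    intro a ha
    refine exists_solution_unit_time (f := fun x => σ x a) (R := R) (L := R) (K := K₁)
      (fun x hx => ?_) ((hKa a ha).mono hBR) le_rfl
    calc ‖σ x a‖ ≤ ‖σ x‖ * ‖a‖ := ContinuousLinearMap.le_opNorm _ _
      _ ≤ C * r := by
        gcongr
        exact hBC x (hBR hx)
      _ ≤ R := hrC
  choose! y hy0 hyR hyd using hex
  -- The map sought is the time-one value a ↦ y a 1. The curve z t = y a t + t σ(y a t) δ solves the
  -- equation with parameter a + δ up to O(‖δ‖²): to first order the defect is t (Dσ(σ a) δ - Dσ(σ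
  -- δ) a), which vanishes by commutation. Grönwall then compares z 1 with y (a + δ) 1.
  have hder : ∀ a : A, ‖a‖ < r → ∀ δ : A, ‖a + δ‖ < r → ‖δ‖ < r →
      ‖y (a + δ) 1 - y a 1 - σ (y a 1) δ‖ ≤
        (D * C + K₂ * C ^ 2) * gronwallBound 0 K₁ 1 1 * ‖δ‖ ^ 2 := by
    intro a ha δ haδ hδ
    have hI : ∀ b : A, ‖b‖ < r → ∀ t ∈ Ico (0 : ℝ) 1,
        HasDerivWithinAt (y b) (σ (y b t) b) (Ici t) t := fun b hb t ht =>
      (hyd b hb t (Ico_subset_Icc_self ht)).mono_of_mem_nhdsWithin (Icc_mem_nhdsGE_of_mem ht)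
    have hσδ : ∀ x ∈ B, ‖σ x δ‖ ≤ C * ‖δ‖ := fun x hx =>
      ((σ x).le_opNorm δ).trans (by gcongr; exact hBC x hx)
    have hyB : ∀ b : A, ‖b‖ < r → ∀ t ∈ Icc (0 : ℝ) 1, y b t ∈ B := fun b hb t ht =>
      hBR (hyR b hb t ht)
    have hzd : ∀ (s : Set ℝ) (t : ℝ) (v : E), y a t ∈ B → HasDerivWithinAt (y a) v s t →
        HasDerivWithinAt (fun t => y a t + t • σ (y a t) δ)
          (v + (t • fderiv ℝ σ (y a t) v δ + (1 : ℝ) • σ (y a t) δ)) s t := by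
      intro s t v hm hv
      have h1 : HasDerivWithinAt (fun t => σ (y a t)) (fderiv ℝ σ (y a t) v) s t :=
        (hdiff _ hm).hasFDerivAt.comp_hasDerivWithinAt t hv
      have h2 : HasDerivWithinAt (fun t => σ (y a t) δ) (fderiv ℝ σ (y a t) v δ) s t := by
        simpa using h1.clm_apply (hasDerivWithinAt_const t s δ)
      exact hv.add ((hasDerivWithinAt_id t s).smul h2)
    have hzB : ∀ t ∈ Icc (0 : ℝ) 1, y a t + t • σ (y a t) δ ∈ B := by
      intro t ht
      rw [hBdef, mem_closedBall, dist_eq_norm]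
      have h1 : ‖y a t - x₀‖ ≤ R := by
        have := hyR a ha t ht
        rwa [mem_closedBall, dist_eq_norm] at this
      have h2 : ‖t • σ (y a t) δ‖ ≤ R := by
        rw [norm_smul, Real.norm_of_nonneg ht.1]
        calc t * ‖σ (y a t) δ‖ ≤ 1 * (C * r) := by
              gcongr
              · exact ht.2
              · exact (hσδ _ (hyB a ha t ht)).trans (by gcongr)
          _ ≤ R := by simpa using hrC
      calc ‖y a t + t • σ (y a t) δ - x₀‖ = ‖(y a t - x₀) + t • σ (y a t) δ‖ := by congr 1; abel
        _ ≤ R + R := norm_add_le_of_le h1 h2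
        _ = 2 * R := by ring
    have hest : ∀ t ∈ Ico (0 : ℝ) 1,
        dist (σ (y a t) a + (t • fderiv ℝ σ (y a t) (σ (y a t) a) δ + (1 : ℝ) • σ (y a t) δ))
          (σ (y a t + t • σ (y a t) δ) (a + δ)) ≤ (D * C + K₂ * C ^ 2) * ‖δ‖ ^ 2 := by
      intro t ht
      have ht' := Ico_subset_Icc_self ht
      have hm := hyB a ha t ht'
      set x := y a t
      have hcm := hcomm x (hBU hm) a δ
      set z := x + t • σ x δ with hz
      have hT := norm_sub_fderiv_le hBconv hdiff hBK₂ hm (hzB t ht')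
      rw [← hz, show z - x = t • σ x δ by rw [hz]; abel] at hT
      set ρ := σ z - σ x - fderiv ℝ σ x (t • σ x δ) with hρ
      have hzs : σ z = ρ + σ x + t • fderiv ℝ σ x (σ x δ) := by
        rw [hρ, map_smul]; abel
      have hts : ‖t • σ x δ‖ ≤ C * ‖δ‖ := by
        rw [norm_smul, Real.norm_of_nonneg ht.1]
        calc t * ‖σ x δ‖ ≤ 1 * (C * ‖δ‖) := by
              gcongr
              · exact ht.2.le
              · exact hσδ x hm
          _ = _ := one_mul _
      have hkey : σ x a + (t • fderiv ℝ σ x (σ x a) δ + (1 : ℝ) • σ x δ) - σ z (a + δ) =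
          -(fderiv ℝ σ x (t • σ x δ) δ + ρ (a + δ)) := by
        rw [hzs, hcm, map_smul]
        simp only [add_apply, smul_apply, map_add]
        module
      rw [dist_eq_norm, hkey, norm_neg]
      have e1 : ‖fderiv ℝ σ x (t • σ x δ) δ‖ ≤ D * (C * ‖δ‖) * ‖δ‖ := by
        calc _ ≤ ‖fderiv ℝ σ x (t • σ x δ)‖ * ‖δ‖ := ContinuousLinearMap.le_opNorm _ _
          _ ≤ (‖fderiv ℝ σ x‖ * ‖t • σ x δ‖) * ‖δ‖ := by
            gcongr; exact ContinuousLinearMap.le_opNorm _ _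
          _ ≤ _ := by gcongr; exact hBD x hm
      have e2 : ‖ρ (a + δ)‖ ≤ K₂ * (C * ‖δ‖) ^ 2 * 1 := by
        calc _ ≤ ‖ρ‖ * ‖a + δ‖ := ContinuousLinearMap.le_opNorm _ _
          _ ≤ _ := by
            gcongr
            · exact hT.trans (by gcongr)
            · linarith
      refine (norm_add_le_of_le e1 e2).trans (le_of_eq (by ring))
    have hg := dist_le_of_approx_trajectories_ODE_of_mem
      (v := fun _ x => σ x (a + δ)) (s := fun _ => B) (K := K₁) (a := 0) (b := 1) (δ := 0)
      (f := y (a + δ)) (f' := fun t => σ (y (a + δ) t) (a + δ)) (εf := 0)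
      (g := fun t => y a t + t • σ (y a t) δ)
      (g' := fun t => σ (y a t) a +
        (t • fderiv ℝ σ (y a t) (σ (y a t) a) δ + (1 : ℝ) • σ (y a t) δ))
      (εg := (D * C + K₂ * C ^ 2) * ‖δ‖ ^ 2)
      (fun t _ => hKa _ haδ)
      (fun t ht => (hyd _ haδ t ht).continuousWithinAt)
      (fun t ht => hI _ haδ t ht) (fun t _ => by simp)
      (fun t ht => hyB _ haδ t (Ico_subset_Icc_self ht))
      (fun t ht => (hzd _ t _ (hyB _ ha t ht) (hyd _ ha t ht)).continuousWithinAt)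
      (fun t ht => hzd _ t _ (hyB _ ha t (Ico_subset_Icc_self ht)) (hI _ ha t ht))
      hest (fun t ht => hzB t (Ico_subset_Icc_self ht))
      (by simp [hy0 _ ha, hy0 _ haδ]) 1 (by simp)
    -- With no initial error the Grönwall bound is linear in the defect, so the final error stays
    -- quadratic in δ.
    have hlin : ∀ ε : ℝ, gronwallBound 0 K₁ ε 1 = ε * gronwallBound 0 K₁ 1 1 := by
      intro ε
      unfold gronwallBound
      split_ifs <;> ring
    rw [zero_add, sub_zero, hlin, dist_eq_norm] at hg
    convert hg using 1
    · congr 1; rw [one_smul]; abel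
    · ring
  refine ⟨r, hr0, fun a => y a 1, ?_, fun a ha => ?_⟩
  · have h0 : ‖(0 : A)‖ < r := by simpa using hr0
    -- For the parameter 0 the vector field vanishes and the trajectory does not move.
    have hc := constant_of_has_deriv_right_zero (f := y 0) (a := 0) (b := 1)
      (fun t ht => (hyd 0 h0 t ht).continuousWithinAt)
      (fun t ht => by
        have := (hyd 0 h0 t (Ico_subset_Icc_self ht)).mono_of_mem_nhdsWithin
          (Icc_mem_nhdsGE_of_mem ht)
        simpa using this)
    exact (hc 1 (by simp)).trans (hy0 0 h0)
  · rw [mem_ball_zero_iff] at ha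
    have h1 : y a 1 ∈ B := hBR (hyR a ha 1 (by simp))
    refine ⟨hBU h1, ?_⟩
    rw [hasFDerivAt_iff_isLittleO_nhds_zero]
    have hO : (fun δ => y (a + δ) 1 - y a 1 - σ (y a 1) δ) =O[nhds 0]
        fun δ : A => ‖δ‖ ^ 2 := by
      refine Asymptotics.IsBigO.of_bound ((D * C + K₂ * C ^ 2) * gronwallBound 0 K₁ 1 1) ?_
      have hev : ∀ᶠ δ : A in nhds 0, ‖δ‖ < r ∧ ‖a + δ‖ < r := by
        refine ((continuous_norm.tendsto' (0 : A) 0 (by simp)).eventually (gt_mem_nhds hr0)).and ?_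
        exact ((by fun_prop : Continuous fun δ : A => ‖a + δ‖).tendsto' 0 ‖a‖ (by simp)).eventually
          (gt_mem_nhds ha)
      filter_upwards [hev] with δ hδ
      simpa using hder a ha δ hδ.2 hδ.1
    refine hO.trans_isLittleO ?_
    exact (Asymptotics.isLittleO_norm_pow_id one_lt_two)

end Frobenius

/-! ### Rank of a two-form with vanishing power, and the linear algebra of contact pairs. -/

section WedgeRank

open Equiv

variable {V : Type*} [AddCommGroup V] [Module ℝ V]

theorem alternatization_domDomCongr {ι κ : Type*} [Fintype ι] [DecidableEq ι] [Fintype κ]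
    [DecidableEq κ] (e : ι ≃ κ) (f : MultilinearMap ℝ (fun _ : ι => V) ℝ) :
    MultilinearMap.alternatization (f.domDomCongr e) =
      (MultilinearMap.alternatization f).domDomCongr e := by
  ext v
  rw [AlternatingMap.domDomCongr_apply, MultilinearMap.alternatization_apply,
    MultilinearMap.alternatization_apply]
  rw [← Equiv.sum_comp e.permCongr]
  refine Finset.sum_congr rfl fun σ _ => ?_
  rw [Equiv.Perm.sign_permCongr]
  congr 1
  simp only [MultilinearMap.domDomCongr_apply]
  congr 1
  ext i
  simp [Equiv.permCongr_apply]

/-- The power `η ^ m` is, up to a positive factor, the alternatization of `η ⊗ ⋯ ⊗ η`. -/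
theorem exists_alternatization_eq_wedgePow (η : V [⋀^Fin 2]→ₗ[ℝ] ℝ) (m : ℕ) :
    ∃ C : ℝ, ∃ T : MultilinearMap ℝ (fun _ : Fin (2 * m) => V) ℝ, ∃ e : Fin m × Fin 2 ≃ Fin (2 * m),
      MultilinearMap.alternatization T = C • wedgePow η m ∧
      ∀ v, T v = ∏ i, η ![v (e (i, 0)), v (e (i, 1))] := by
  induction m with
  | zero =>
    have : IsEmpty (Fin (2 * 0)) := Fin.isEmpty
    refine ⟨1, wedgePow η 0, Equiv.equivOfIsEmpty _ _, ?_, fun v => ?_⟩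
    · rw [AlternatingMap.coe_alternatization]
      simp
    · simp [wedgePow]
  | succ m ih =>
    obtain ⟨C, T, e, hT, hTv⟩ := ih
    obtain ⟨e', he₁, he₂⟩ : ∃ e' : Fin (m + 1) × Fin 2 ≃ Fin (2 * m + 2),
        (∀ i s, e' (Fin.castSucc i, s) = finSumFinEquiv (Sum.inl (e (i, s)))) ∧
        ∀ s, e' (Fin.last m, s) = finSumFinEquiv (Sum.inr s) := by
      refine ⟨((Equiv.prodCongr finSumFinEquiv.symm (Equiv.refl _)).trans
        (Equiv.sumProdDistrib _ _ _)).trans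
          ((Equiv.sumCongr e (Equiv.uniqueProd (Fin 2) (Fin 1))).trans
          finSumFinEquiv), fun i s => ?_, fun s => ?_⟩
      · have : finSumFinEquiv.symm (Fin.castSucc i) = (Sum.inl i : Fin m ⊕ Fin 1) :=
          finSumFinEquiv_symm_apply_castAdd i
        simp [this]
      · have : finSumFinEquiv.symm (Fin.last m) = (Sum.inr 0 : Fin m ⊕ Fin 1) :=
          finSumFinEquiv_symm_apply_natAdd (0 : Fin 1)
        simp [this]
    -- Each new factor contributes 2 = 2!, the effect of alternatizing the already alternating form
    -- η.
    refine ⟨C * 2, ((LinearMap.mul' ℝ ℝ).compMultilinearMap (T.domCoprod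
      (η : MultilinearMap ℝ (fun _ : Fin 2 => V) ℝ))).domDomCongr finSumFinEquiv,
      e', ?_, fun v => ?_⟩
    · erw [alternatization_domDomCongr]
      rw [LinearMap.compMultilinearMap_alternatization, MultilinearMap.domCoprod_alternization, hT,
        AlternatingMap.coe_alternatization]
      have h : (C • wedgePow η m).domCoprod ((Fintype.card (Fin 2)).factorial • η) =
          (C * 2) • (wedgePow η m).domCoprod η := by
        rw [← AlternatingMap.domCoprod'_apply, ← AlternatingMap.domCoprod'_apply,
          TensorProduct.tmul_smul, ← TensorProduct.smul_tmul', ← Nat.cast_smul_eq_nsmul ℝ,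
          map_smul, map_smul, smul_smul]
        simp [mul_comm]
      rw [h]
      ext v
      simp [wedgePow, wedge, Finset.mul_sum]
    · rw [Fin.prod_univ_castSucc]
      have h : (fun i => v (finSumFinEquiv (Sum.inr i))) =
          ![v (e' (Fin.last m, 0)), v (e' (Fin.last m, 1))] := by
        ext i
        fin_cases i <;> simp [he₂]
      simp only [he₁, ← h]
      simp [hTv, -finSumFinEquiv_apply_left, -finSumFinEquiv_apply_right]

/-- The vectors `x (i, 0), x (i, 1)` form a symplectic family for `η`. -/
def IsSymplecticFamily (η : V [⋀^Fin 2]→ₗ[ℝ] ℝ) {m : ℕ} (x : Fin m × Fin 2 → V) : Prop :=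
  (∀ i j s t, i ≠ j → η ![x (i, s), x (j, t)] = 0) ∧ ∀ i, η ![x (i, 0), x (i, 1)] = 1

theorem alternating_two_self (η : V [⋀^Fin 2]→ₗ[ℝ] ℝ) (u : V) : η ![u, u] = 0 :=
  η.map_eq_zero_of_eq ![u, u] (i := 0) (j := 1) rfl (by simp)

theorem alternating_two_swap (η : V [⋀^Fin 2]→ₗ[ℝ] ℝ) (u v : V) : η ![u, v] = -η ![v, u] := by
  have := η.map_swap ![v, u] (i := 0) (j := 1) (by simp)
  rw [← this]
  congr 1
  ext i; fin_cases i <;> simp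

/-- A nonzero product forces σ to map each pair {i} × Fin 2 onto a pair, so σ is a permutation ρ of
the pairs composed with permutations κ i inside them. As ρ acts on both copies of Fin m, it has sign
1 on the product; the i-th factor is the sign of κ i, so the term is the square of ∏ sign (κ i). -/
theorem IsSymplecticFamily.term_nonneg {η : V [⋀^Fin 2]→ₗ[ℝ] ℝ} {m : ℕ} {x : Fin m × Fin 2 → V}
    (hx : IsSymplecticFamily η x) (σ : Perm (Fin m × Fin 2)) :
    0 ≤ ((Equiv.Perm.sign σ : ℤ) : ℝ) * ∏ i, η ![x (σ (i, 0)), x (σ (i, 1))] := by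
  by_cases h0 : ∏ i, η ![x (σ (i, 0)), x (σ (i, 1))] = 0
  · rw [h0, mul_zero]
  have hne : ∀ i, η ![x (σ (i, 0)), x (σ (i, 1))] ≠ 0 := fun i h =>
    h0 (Finset.prod_eq_zero (Finset.mem_univ i) h)
  have h1 : ∀ i, (σ (i, 0)).1 = (σ (i, 1)).1 := by
    intro i
    by_contra hi
    exact hne i (hx.1 _ _ (σ (i, 0)).2 (σ (i, 1)).2 hi)
  have h1' : ∀ i s, (σ (i, s)).1 = (σ (i, 0)).1 := by
    intro i s
    fin_cases s
    · rfl
    · exact (h1 i).symm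
  have hκ : ∀ i, Function.Injective fun s => (σ (i, s)).2 := by
    intro i s t hst
    have : σ (i, s) = σ (i, t) := Prod.ext ((h1' i s).trans (h1' i t).symm) hst
    simpa using σ.injective this
  set κ : Fin m → Perm (Fin 2) := fun i =>
    Equiv.ofBijective _ (Finite.injective_iff_bijective.1 (hκ i)) with hκdef
  have hκa : ∀ i s, κ i s = (σ (i, s)).2 := fun i s => rfl
  have hρ : Function.Injective fun i => (σ (i, 0)).1 := by
    intro i j hij
    obtain ⟨s, hs⟩ := (κ j).surjective (κ i 0)
    have : σ (j, s) = σ (i, 0) := Prod.ext ((h1' j s).trans hij.symm) hs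
    exact (congrArg Prod.fst (σ.injective this)).symm
  set ρ : Perm (Fin m) := Equiv.ofBijective _ (Finite.injective_iff_bijective.1 hρ) with hρdef
  have hσ : σ = (Equiv.prodCongrLeft fun _ => ρ) * Equiv.prodCongrRight κ := by
    ext ⟨i, s⟩ : 1
    exact Prod.ext (h1' i s) rfl
  have hsign : Equiv.Perm.sign σ = ∏ i, Equiv.Perm.sign (κ i) := by
    rw [hσ, Equiv.Perm.sign_mul, Equiv.Perm.sign_prodCongrRight]
    erw [Equiv.Perm.sign_prodCongrLeft]
    simp
  have hfac : ∀ i, η ![x (σ (i, 0)), x (σ (i, 1))] = ((Equiv.Perm.sign (κ i) : ℤ) : ℝ) := by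
    intro i
    have e0 : σ (i, 0) = (ρ i, κ i 0) := rfl
    have e1 : σ (i, 1) = (ρ i, κ i 1) := Prod.ext (h1 i).symm rfl
    rw [e0, e1]
    have hκi : κ i = 1 ∨ κ i = Equiv.swap 0 1 := by
      generalize κ i = τ
      revert τ; decide
    rcases hκi with h | h <;> rw [h]
    · simpa using hx.2 (ρ i)
    · rw [Equiv.swap_apply_left, Equiv.swap_apply_right, alternating_two_swap, hx.2]
      simp
  simp_rw [hfac, hsign]
  push_cast
  exact mul_self_nonneg _

/-- Evaluated on the family, a multiple of the power is a sum of nonnegative terms, and the identity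
permutation contributes 1. No cancellation can occur, so the sum need not be computed. -/
theorem IsSymplecticFamily.wedgePow_ne_zero {η : V [⋀^Fin 2]→ₗ[ℝ] ℝ} {m : ℕ}
    {x : Fin m × Fin 2 → V} (hx : IsSymplecticFamily η x) : wedgePow η m ≠ 0 := by
  intro h0
  obtain ⟨C, T, e, hT, hTv⟩ := exists_alternatization_eq_wedgePow η m
  have h1 : MultilinearMap.alternatization T (x ∘ e.symm) = 0 := by
    rw [hT, h0]; simp
  rw [MultilinearMap.alternatization_apply, ← Equiv.sum_comp e.permCongr] at h1
  have h2 : ∀ σ : Perm (Fin m × Fin 2), Equiv.Perm.sign (e.permCongr σ) •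
      (MultilinearMap.domDomCongr (e.permCongr σ) T) (x ∘ e.symm) =
      ((Equiv.Perm.sign σ : ℤ) : ℝ) * ∏ i, η ![x (σ (i, 0)), x (σ (i, 1))] := by
    intro σ
    rw [Equiv.Perm.sign_permCongr, MultilinearMap.domDomCongr_apply, hTv, Units.smul_def,
      zsmul_eq_mul]
    simp [Equiv.permCongr_apply]
  simp_rw [h2] at h1
  rw [Finset.sum_eq_zero_iff_of_nonneg fun σ _ => hx.term_nonneg σ] at h1
  have := h1 1 (Finset.mem_univ _)
  simp [hx.2] at this

/-- A `2`-form as a bilinear map. -/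
noncomputable def altBilin (η : V [⋀^Fin 2]→ₗ[ℝ] ℝ) : V →ₗ[ℝ] V →ₗ[ℝ] ℝ :=
  LinearMap.mk₂ ℝ (fun u v => η ![u, v]) (fun u u' v => η.map_vecCons_add ![v] u u')
    (fun c u v => η.map_vecCons_smul ![v] c u)
    (fun u v v' => by
      rw [alternating_two_swap, alternating_two_swap η u v, alternating_two_swap η u v',
        η.map_vecCons_add ![u] v v']
      ring)
    (fun c u v => by
      rw [alternating_two_swap, alternating_two_swap η u v, η.map_vecCons_smul ![u] c v]
      simp)

@[simp]
theorem altBilin_apply (η : V [⋀^Fin 2]→ₗ[ℝ] ℝ) (u v : V) : altBilin η u v = η ![u, v] := rfl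

theorem mem_ker_curryLeft_iff (η : V [⋀^Fin 2]→ₗ[ℝ] ℝ) (u : V) :
    u ∈ LinearMap.ker η.curryLeft ↔ ∀ v, η ![u, v] = 0 := by
  rw [LinearMap.mem_ker]
  refine ⟨fun h v => by simpa using congrArg (fun a => a ![v]) h, fun h => ?_⟩
  ext w
  have : w = ![w 0] := by ext i; fin_cases i; rfl
  rw [this]
  exact h _

/-- The η-orthogonal of the family has codimension at most 2m. If η vanished on it, it would lie in
the kernel of η, which is too small by hypothesis; so it contains a new symplectic couple, after
rescaling one vector. -/
theorem IsSymplecticFamily.exists_succ [FiniteDimensional ℝ V] {η : V [⋀^Fin 2]→ₗ[ℝ] ℝ} {m : ℕ}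
    {x : Fin m × Fin 2 → V} (hx : IsSymplecticFamily η x)
    (hm : Module.finrank ℝ (LinearMap.ker η.curryLeft) + 2 * m < Module.finrank ℝ V) :
    ∃ y : Fin (m + 1) × Fin 2 → V, IsSymplecticFamily η y := by
  set B : V →ₗ[ℝ] (Fin m × Fin 2 → ℝ) := LinearMap.pi fun p => (altBilin η).flip (x p) with hB
  have hBa : ∀ v p, B v p = η ![v, x p] := fun v p => rfl
  have hdim := LinearMap.finrank_range_add_finrank_ker B
  have hr : Module.finrank ℝ (LinearMap.range B) ≤ 2 * m := by
    refine (Submodule.finrank_le _).trans ?_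
    simp [mul_comm]
  have hex : ∃ u ∈ LinearMap.ker B, ∃ v ∈ LinearMap.ker B, η ![u, v] ≠ 0 := by
    by_contra! hcon
    have hle : LinearMap.ker B ≤ LinearMap.ker η.curryLeft := by
      intro u hu
      rw [mem_ker_curryLeft_iff]
      intro w
      have hu' : ∀ p, η ![u, x p] = 0 := fun p => congrFun (LinearMap.mem_ker.1 hu) p
      -- c is the symplectic projection of w onto the span of the family: w - c is orthogonal to the
      -- family, and u is orthogonal to c.
      set c : V := ∑ i, (η ![w, x (i, 1)] • x (i, 0) - η ![w, x (i, 0)] • x (i, 1)) with hc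
      have hw : w - c ∈ LinearMap.ker B := by
        rw [LinearMap.mem_ker]
        ext ⟨j, t⟩
        rw [hBa, ← altBilin_apply, hc, map_sub, map_sum, LinearMap.sub_apply,
          LinearMap.sum_apply, Finset.sum_eq_single j]
        · simp only [map_sub, map_smul, LinearMap.sub_apply, LinearMap.smul_apply, altBilin_apply,
            smul_eq_mul, Pi.zero_apply]
          fin_cases t
          · simp [alternating_two_self, alternating_two_swap η (x (j, 1)), hx.2]
          · simp [alternating_two_self, hx.2]
        · intro i _ hij
          simp [hx.1 i j _ _ hij]
        · simp
      have h0 := hcon u hu _ hw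
      rw [← altBilin_apply, map_sub, altBilin_apply, hc, map_sum] at h0
      simp only [map_sub, map_smul, altBilin_apply, hu'] at h0
      simpa using h0
    have := Submodule.finrank_mono hle
    omega
  obtain ⟨u, hu, v, hv, huv⟩ := hex
  have hu' : ∀ p, η ![u, x p] = 0 := fun p => congrFun (LinearMap.mem_ker.1 hu) p
  have hv' : ∀ p, η ![v, x p] = 0 := fun p => congrFun (LinearMap.mem_ker.1 hv) p
  have hyu : ∀ p, η ![x p, u] = 0 := fun p => by rw [alternating_two_swap, hu', neg_zero]
  have hyv : ∀ p, η ![x p, v] = 0 := fun p => by rw [alternating_two_swap, hv', neg_zero]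
  refine ⟨fun p => Fin.lastCases (motive := fun _ => V) (![(η ![u, v])⁻¹ • u, v] p.2)
    (fun i => x (i, p.2)) p.1, ?_, ?_⟩
  · intro i j s t hij
    induction i using Fin.lastCases with
    | last =>
      induction j using Fin.lastCases with
      | last => exact absurd rfl hij
      | cast j =>
        simp only [Fin.lastCases_last, Fin.lastCases_castSucc]
        fin_cases s <;> simp [← altBilin_apply]
        · simp [hu']
        · simp [hv']
    | cast i =>
      induction j using Fin.lastCases with
      | last =>
        simp only [Fin.lastCases_last, Fin.lastCases_castSucc]
        fin_cases t <;> simp [← altBilin_apply]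
        · simp [hyu]
        · simp [hyv]
      | cast j =>
        simp only [Fin.lastCases_castSucc]
        exact hx.1 i j s t fun h => hij (by rw [h])
  · intro i
    induction i using Fin.lastCases with
    | last =>
      simp only [Fin.lastCases_last]
      have : altBilin η ((η ![u, v])⁻¹ • u) v = 1 := by
        rw [map_smul, LinearMap.smul_apply, altBilin_apply, smul_eq_mul, inv_mul_cancel₀ huv]
      exact this
    | cast i => simpa using hx.2 i

/-- If `η ^ (h + 1) = 0`, the `2`-form `η` has rank at most `2 h`. -/
theorem finrank_le_of_wedgePow_eq_zero [FiniteDimensional ℝ V] {η : V [⋀^Fin 2]→ₗ[ℝ] ℝ} {h : ℕ}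
    (hη : wedgePow η (h + 1) = 0) :
    Module.finrank ℝ V ≤ Module.finrank ℝ (LinearMap.ker η.curryLeft) + 2 * h := by
  by_contra! hlt
  have key : ∀ m ≤ h + 1, ∃ x : Fin m × Fin 2 → V, IsSymplecticFamily η x := by
    intro m
    induction m with
    | zero => exact fun _ => ⟨fun p => p.1.elim0, fun i => i.elim0, fun i => i.elim0⟩
    | succ m ih =>
      intro hm
      obtain ⟨x, hx⟩ := ih (by omega)
      exact hx.exists_succ (by omega)
  obtain ⟨x, hx⟩ := key (h + 1) le_rfl
  exact hx.wedgePow_ne_zero hη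

/-- A vector is in the kernel of a form if the form vanishes on all families that contain it. -/
def IsKernelVector {n : ℕ} (a : V [⋀^Fin n]→ₗ[ℝ] ℝ) (v : V) : Prop :=
  ∀ w : Fin n → V, (∃ i, w i = v) → a w = 0

/-- In every shuffle the vector v is an argument of one of the two factors, so every summand
vanishes. -/
theorem IsKernelVector.wedge {m n : ℕ} {a : V [⋀^Fin m]→ₗ[ℝ] ℝ} {b : V [⋀^Fin n]→ₗ[ℝ] ℝ} {v : V}
    (ha : IsKernelVector a v) (hb : IsKernelVector b v) : IsKernelVector (wedge a b) v := by
  rintro w ⟨i, hi⟩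
  have : ∀ σ : Equiv.Perm.ModSumCongr (Fin m) (Fin n), (LinearMap.mul' ℝ ℝ)
      (AlternatingMap.domCoprod.summand a b σ (w ∘ finSumFinEquiv)) = 0 := by
    intro σ
    induction σ using Quotient.inductionOn' with | _ σ
    rw [AlternatingMap.domCoprod.summand_mk'']
    have h0 : a (fun i => w (finSumFinEquiv (σ (Sum.inl i)))) *
        b (fun i => w (finSumFinEquiv (σ (Sum.inr i)))) = 0 := by
      rcases hp : σ.symm (finSumFinEquiv.symm i) with j | j
      · rw [ha _ ⟨j, ?_⟩, zero_mul]
        rw [← hp]; simpa using hi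
      · rw [hb _ ⟨j, ?_⟩, mul_zero]
        rw [← hp]; simpa using hi
    rw [smul_apply, Units.smul_def, map_zsmul]
    have h1 : (LinearMap.mul' ℝ ℝ) ((MultilinearMap.domDomCongr σ
        ((a : MultilinearMap ℝ (fun _ => V) ℝ).domCoprod (b : MultilinearMap ℝ (fun _ => V) ℝ)))
        (w ∘ finSumFinEquiv)) = 0 := by
      simpa [-finSumFinEquiv_apply_left, -finSumFinEquiv_apply_right] using h0
    rw [h1, smul_zero]
  simp [ContactPairs.wedge, this]

theorem IsKernelVector.wedgePow {η : V [⋀^Fin 2]→ₗ[ℝ] ℝ} {v : V}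
    (hv : v ∈ LinearMap.ker η.curryLeft) (m : ℕ) : IsKernelVector (wedgePow η m) v := by
  induction m with
  | zero => rintro w ⟨i, -⟩; exact i.elim0
  | succ m ih =>
    refine ih.wedge ?_
    rw [mem_ker_curryLeft_iff] at hv
    rintro w ⟨i, hi⟩
    have hw : w = ![w 0, w 1] := by ext i; fin_cases i <;> rfl
    rw [hw]
    fin_cases i
    · rw [show w 0 = v from hi]; exact hv _
    · rw [show w 1 = v from hi, alternating_two_swap, hv, neg_zero]

theorem IsKernelVector.oneForm {a : V →ₗ[ℝ] ℝ} {v : V} (hv : a v = 0) :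
    IsKernelVector (oneForm a) v := by
  rintro w ⟨i, hi⟩
  fin_cases i
  simpa [ContactPairs.oneForm, ← hi] using hv

/-- A nonzero form of top degree has no kernel vector apart from zero. -/
theorem IsKernelVector.eq_zero [FiniteDimensional ℝ V] {n : ℕ} (hn : Module.finrank ℝ V = n)
    {Ω : V [⋀^Fin n]→ₗ[ℝ] ℝ} (hΩ : Ω ≠ 0) {v : V} (hv : IsKernelVector Ω v) : v = 0 := by
  by_contra hv0
  apply hΩ
  have hli : LinearIndepOn ℝ id ({v} : Set V) := LinearIndepOn.singleton (v := id) hv0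
  set b := Module.Basis.extend hli
  have : Fintype (hli.extend (Set.subset_univ _)) := FiniteDimensional.fintypeBasisIndex b
  refine b.ext_alternating fun w hw => ?_
  have hcard : Fintype.card (Fin n) = Fintype.card (hli.extend (Set.subset_univ _)) := by
    rw [← Module.finrank_eq_card_basis b, hn, Fintype.card_fin]
  -- An injective choice of n basis vectors exhausts the basis, which contains v.
  have hsurj := ((Fintype.bijective_iff_injective_and_card w).2 ⟨hw, hcard⟩).2
  obtain ⟨i, hi⟩ := hsurj ⟨v, Module.Basis.subset_extend hli rfl⟩
  rw [hv _ ⟨i, by rw [hi]; simp [b]⟩]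
  rfl

/-- The pointwise linear algebra of a contact pair: the characteristic subspaces are complementary,
of dimensions `2 k + 1` and `2 h + 1`. -/
theorem isCompl_of_wedge_ne_zero [FiniteDimensional ℝ V] {h k : ℕ}
    (hn : Module.finrank ℝ V = 2 * h + 2 * k + 2) {a₁ a₂ : V →ₗ[ℝ] ℝ} {η₁ η₂ : V [⋀^Fin 2]→ₗ[ℝ] ℝ}
    (hvol : wedge (oneForm a₁) (wedge (wedgePow η₁ h) (wedge (oneForm a₂) (wedgePow η₂ k))) ≠ 0)
    (h₁ : wedgePow η₁ (h + 1) = 0) (h₂ : wedgePow η₂ (k + 1) = 0) :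
    IsCompl (LinearMap.ker a₁ ⊓ LinearMap.ker η₁.curryLeft)
      (LinearMap.ker a₂ ⊓ LinearMap.ker η₂.curryLeft) ∧
    Module.finrank ℝ ↥(LinearMap.ker a₁ ⊓ LinearMap.ker η₁.curryLeft) = 2 * k + 1 ∧
    Module.finrank ℝ ↥(LinearMap.ker a₂ ⊓ LinearMap.ker η₂.curryLeft) = 2 * h + 1 := by
  have hinf : (LinearMap.ker a₁ ⊓ LinearMap.ker η₁.curryLeft) ⊓
      (LinearMap.ker a₂ ⊓ LinearMap.ker η₂.curryLeft) = ⊥ := by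
    rw [eq_bot_iff]
    rintro v ⟨⟨hv₁, hw₁⟩, hv₂, hw₂⟩
    refine IsKernelVector.eq_zero (hn.trans (by ring)) hvol ?_
    exact (IsKernelVector.oneForm hv₁).wedge ((IsKernelVector.wedgePow hw₁ h).wedge
      ((IsKernelVector.oneForm hv₂).wedge (IsKernelVector.wedgePow hw₂ k)))
  have hker : ∀ (a : V →ₗ[ℝ] ℝ) (W : Submodule ℝ V),
      Module.finrank ℝ W ≤ Module.finrank ℝ ↥(LinearMap.ker a ⊓ W) + 1 := by
    intro a W
    have e1 := Submodule.finrank_sup_add_finrank_inf_eq (LinearMap.ker a) W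
    have e2 := LinearMap.finrank_range_add_finrank_ker a
    have e3 : Module.finrank ℝ (LinearMap.range a) ≤ 1 :=
      (Submodule.finrank_le _).trans (by simp)
    have e4 := Submodule.finrank_le (LinearMap.ker a ⊔ W)
    omega
  -- The rank bounds give dimensions at least 2k + 1 and 2h + 1. Their sum is already the dimension
  -- of V and the intersection is zero, so both bounds are equalities and the subspaces span.
  have r₁ := finrank_le_of_wedgePow_eq_zero h₁
  have r₂ := finrank_le_of_wedgePow_eq_zero h₂
  have k₁ := hker a₁ (LinearMap.ker η₁.curryLeft)
  have k₂ := hker a₂ (LinearMap.ker η₂.curryLeft)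
  have hsum := Submodule.finrank_sup_add_finrank_inf_eq
    (LinearMap.ker a₁ ⊓ LinearMap.ker η₁.curryLeft) (LinearMap.ker a₂ ⊓ LinearMap.ker η₂.curryLeft)
  rw [hinf, finrank_bot] at hsum
  have hle := Submodule.finrank_le ((LinearMap.ker a₁ ⊓ LinearMap.ker η₁.curryLeft) ⊔
    (LinearMap.ker a₂ ⊓ LinearMap.ker η₂.curryLeft))
  refine ⟨⟨disjoint_iff.2 hinf, codisjoint_iff.2 (Submodule.eq_top_of_finrank_eq ?_)⟩, ?_, ?_⟩ <;>
    omega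

end WedgeRank

/-! ### Torsion, exterior derivative and Lie derivative on a normed space, and identities for pairs.
-/

section Coordinates
open Filter Topology

variable {E : Type*} [NormedAddCommGroup E] [NormedSpace ℝ E]

/-- The Nijenhuis tensor of a field of endomorphisms of a normed space. -/
noncomputable def nij (Φ : E → E →L[ℝ] E) (y u v : E) : E :=
  fderiv ℝ Φ y (Φ y u) v - fderiv ℝ Φ y (Φ y v) u - Φ y (fderiv ℝ Φ y u v - fderiv ℝ Φ y v u)

/-- The exterior derivative of a `1`-form on a normed space. -/
noncomputable def dform (α : E → E →L[ℝ] ℝ) (y u v : E) : ℝ :=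
  fderiv ℝ α y u v - fderiv ℝ α y v u

/-- The Lie derivative of a field of endomorphisms of a normed space. -/
noncomputable def lieEnd (Z : E → E) (Φ : E → E →L[ℝ] E) (y u : E) : E :=
  fderiv ℝ Φ y (Z y) u - fderiv ℝ Z y (Φ y u) + Φ y (fderiv ℝ Z y u)

theorem fderiv_apply_eq {F G : Type*} [NormedAddCommGroup F] [NormedSpace ℝ F]
    [NormedAddCommGroup G] [NormedSpace ℝ G] {Φ : E → F →L[ℝ] G} {y : E}
    (hΦ : DifferentiableAt ℝ Φ y) (w : E) (u : F) :
    fderiv ℝ Φ y w u = fderiv ℝ (fun z => Φ z u) y w := by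
  have := (hΦ.hasFDerivAt.clm_apply (hasFDerivAt_const u y)).fderiv
  rw [this]; simp

/-- The product rule for an identity valid near y. It differentiates each algebraic relation among
φ, αᵢ and Zᵢ. -/
theorem fderiv_clm_apply_eq_of_eventuallyEq {F G : Type*} [NormedAddCommGroup F] [NormedSpace ℝ F]
    [NormedAddCommGroup G] [NormedSpace ℝ G] {Φ : E → F →L[ℝ] G} {f : E → F} {g : E → G} {y : E}
    (hΦ : DifferentiableAt ℝ Φ y) (hf : DifferentiableAt ℝ f y)
    (h : ∀ᶠ z in 𝓝 y, Φ z (f z) = g z) (w : E) :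
    fderiv ℝ Φ y w (f y) + Φ y (fderiv ℝ f y w) = fderiv ℝ g y w := by
  have h1 := (hΦ.hasFDerivAt.clm_apply hf.hasFDerivAt).fderiv
  have h2 : fderiv ℝ g y = fderiv ℝ (fun z => Φ z (f z)) y :=
    (EventuallyEq.fderiv_eq h).symm
  rw [h2, h1]
  simp [add_comm]

section nijLinear
variable (Φ : E → E →L[ℝ] E) (α : E → E →L[ℝ] ℝ) (Z : E → E) (y : E)

theorem nij_add_left (u u' v : E) : nij Φ y (u + u') v = nij Φ y u v + nij Φ y u' v := by
  simp only [nij, map_add, map_sub, add_apply]; abel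

theorem nij_smul_left (c : ℝ) (u v : E) : nij Φ y (c • u) v = c • nij Φ y u v := by
  simp only [nij, map_smul, map_sub, smul_apply]; module

theorem nij_swap (u v : E) : nij Φ y u v = -nij Φ y v u := by
  simp only [nij, map_sub]; abel

theorem nij_add_right (u v v' : E) : nij Φ y u (v + v') = nij Φ y u v + nij Φ y u v' := by
  rw [nij_swap, nij_add_left, nij_swap Φ y v, nij_swap Φ y v']; abel

theorem nij_smul_right (c : ℝ) (u v : E) : nij Φ y u (c • v) = c • nij Φ y u v := by
  rw [nij_swap, nij_smul_left, nij_swap Φ y v]; module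

theorem dform_add_left (u u' v : E) : dform α y (u + u') v = dform α y u v + dform α y u' v := by
  simp only [dform, map_add, add_apply]; abel

theorem dform_smul_left (c : ℝ) (u v : E) : dform α y (c • u) v = c * dform α y u v := by
  simp only [dform, map_smul, smul_apply, smul_eq_mul]; ring

theorem dform_swap (u v : E) : dform α y u v = -dform α y v u := by
  simp only [dform]; abel

theorem dform_add_right (u v v' : E) : dform α y u (v + v') = dform α y u v + dform α y u v' := by
  simp only [dform, map_add, add_apply]; abel

theorem dform_smul_right (c : ℝ) (u v : E) : dform α y u (c • v) = c * dform α y u v := by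
  simp only [dform, map_smul, smul_apply, smul_eq_mul]; ring

theorem lieEnd_add (u u' : E) : lieEnd Z Φ y (u + u') = lieEnd Z Φ y u + lieEnd Z Φ y u' := by
  simp only [lieEnd, map_add]; abel

theorem lieEnd_smul (c : ℝ) (u : E) : lieEnd Z Φ y (c • u) = c • lieEnd Z Φ y u := by
  simp only [lieEnd, map_smul]; module

end nijLinear

/-- Local expression near a point of a pair of `1`-forms with Reeb fields and an endomorphism field
`φ` such that `φ² = -1 + α₁ ⊗ Z₁ + α₂ ⊗ Z₂`. -/
structure LocalPair (φ : E → E →L[ℝ] E) (α₁ α₂ : E → E →L[ℝ] ℝ) (Z₁ Z₂ : E → E) (y : E) :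
    Prop where
  diff_φ : DifferentiableAt ℝ φ y
  diff_α₁ : DifferentiableAt ℝ α₁ y
  diff_α₂ : DifferentiableAt ℝ α₂ y
  diff_Z₁ : DifferentiableAt ℝ Z₁ y
  diff_Z₂ : DifferentiableAt ℝ Z₂ y
  sq : ∀ᶠ z in 𝓝 y, ∀ u, φ z (φ z u) = -u + α₁ z u • Z₁ z + α₂ z u • Z₂ z
  φ_Z₁ : ∀ᶠ z in 𝓝 y, φ z (Z₁ z) = 0
  φ_Z₂ : ∀ᶠ z in 𝓝 y, φ z (Z₂ z) = 0
  form₁₁ : ∀ᶠ z in 𝓝 y, α₁ z (Z₁ z) = 1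
  form₁₂ : ∀ᶠ z in 𝓝 y, α₁ z (Z₂ z) = 0
  form₂₁ : ∀ᶠ z in 𝓝 y, α₂ z (Z₁ z) = 0
  form₂₂ : ∀ᶠ z in 𝓝 y, α₂ z (Z₂ z) = 1
  contract₁₁ : ∀ u, dform α₁ y (Z₁ y) u = 0
  contract₁₂ : ∀ u, dform α₁ y (Z₂ y) u = 0
  contract₂₁ : ∀ u, dform α₂ y (Z₁ y) u = 0
  contract₂₂ : ∀ u, dform α₂ y (Z₂ y) u = 0

namespace LocalPair

variable {φ : E → E →L[ℝ] E} {α₁ α₂ : E → E →L[ℝ] ℝ} {Z₁ Z₂ : E → E} {y : E}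

/-- The symmetry between the indices, from which most statements for the second index are deduced.
-/
theorem swap (P : LocalPair φ α₁ α₂ Z₁ Z₂ y) : LocalPair φ α₂ α₁ Z₂ Z₁ y where
  diff_φ := P.diff_φ
  diff_α₁ := P.diff_α₂
  diff_α₂ := P.diff_α₁
  diff_Z₁ := P.diff_Z₂
  diff_Z₂ := P.diff_Z₁
  sq := P.sq.mono fun z hz u => by rw [hz]; abel
  φ_Z₁ := P.φ_Z₂
  φ_Z₂ := P.φ_Z₁
  form₁₁ := P.form₂₂
  form₁₂ := P.form₂₁
  form₂₁ := P.form₁₂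
  form₂₂ := P.form₁₁
  contract₁₁ := P.contract₂₂
  contract₁₂ := P.contract₂₁
  contract₂₁ := P.contract₁₂
  contract₂₂ := P.contract₁₁

variable (P : LocalPair φ α₁ α₂ Z₁ Z₂ y)
include P

/-- Computing φ³ as φ² ∘ φ and as φ ∘ φ² gives α₁(φu) Z₁ + α₂(φu) Z₂ = 0; apply α₁. -/
theorem form_φ₁ : ∀ᶠ z in 𝓝 y, ∀ u, α₁ z (φ z u) = 0 := by
  filter_upwards [P.sq, P.φ_Z₁, P.φ_Z₂, P.form₁₁, P.form₁₂] with z h h1 h2 h3 h4 u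
  have e1 := h (φ z u)
  rw [h u] at e1
  simp only [map_add, map_neg, map_smul, h1, h2, smul_zero, add_zero] at e1
  have e2 : α₁ z (φ z u) • Z₁ z + α₂ z (φ z u) • Z₂ z = 0 := by
    have := congrArg (fun w => w + φ z u) e1
    simp only [neg_add_cancel] at this
    rw [this]; abel
  have e3 := congrArg (α₁ z) e2
  simpa [h3, h4] using e3

theorem form_φ₂ : ∀ᶠ z in 𝓝 y, ∀ u, α₂ z (φ z u) = 0 := P.swap.form_φ₁

theorem fderiv_form_φ₁ (w u : E) :
    fderiv ℝ α₁ y w (φ y u) + α₁ y (fderiv ℝ φ y w u) = 0 := by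
  have := fderiv_clm_apply_eq_of_eventuallyEq (f := fun z => φ z u) (g := fun _ => (0 : ℝ))
    P.diff_α₁ (P.diff_φ.clm_apply (differentiableAt_const u)) (P.form_φ₁.mono fun z hz => hz u) w
  rw [← fderiv_apply_eq P.diff_φ] at this
  simpa using this

theorem fderiv_form_φ₂ (w u : E) :
    fderiv ℝ α₂ y w (φ y u) + α₂ y (fderiv ℝ φ y w u) = 0 := P.swap.fderiv_form_φ₁ w u

theorem fderiv_φ_Z₁ (w : E) : fderiv ℝ φ y w (Z₁ y) + φ y (fderiv ℝ Z₁ y w) = 0 := by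
  simpa using fderiv_clm_apply_eq_of_eventuallyEq (g := fun _ => (0 : E))
    P.diff_φ P.diff_Z₁ P.φ_Z₁ w

theorem fderiv_φ_Z₂ (w : E) : fderiv ℝ φ y w (Z₂ y) + φ y (fderiv ℝ Z₂ y w) = 0 :=
  P.swap.fderiv_φ_Z₁ w

theorem fderiv_form₁₁ (w : E) : fderiv ℝ α₁ y w (Z₁ y) + α₁ y (fderiv ℝ Z₁ y w) = 0 := by
  simpa using fderiv_clm_apply_eq_of_eventuallyEq (g := fun _ => (1 : ℝ))
    P.diff_α₁ P.diff_Z₁ P.form₁₁ w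

theorem fderiv_form₁₂ (w : E) : fderiv ℝ α₁ y w (Z₂ y) + α₁ y (fderiv ℝ Z₂ y w) = 0 := by
  simpa using fderiv_clm_apply_eq_of_eventuallyEq (g := fun _ => (0 : ℝ))
    P.diff_α₁ P.diff_Z₂ P.form₁₂ w

theorem fderiv_form₂₁ (w : E) : fderiv ℝ α₂ y w (Z₁ y) + α₂ y (fderiv ℝ Z₁ y w) = 0 :=
  P.swap.fderiv_form₁₂ w

theorem fderiv_form₂₂ (w : E) : fderiv ℝ α₂ y w (Z₂ y) + α₂ y (fderiv ℝ Z₂ y w) = 0 :=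
  P.swap.fderiv_form₁₁ w

/-- Take the Lie derivative of α₁ ∘ φ = 0 along Z₁: it preserves α₁, because α₁(Z₁) is constant and
the contraction of dα₁ with Z₁ is zero. -/
theorem form_lieEnd₁₁ (u : E) : α₁ y (lieEnd Z₁ φ y u) = 0 := by
  have h1 := P.fderiv_form_φ₁ (Z₁ y) u
  have h2 := P.fderiv_form₁₁ (φ y u)
  have h3 := P.contract₁₁ (φ y u)
  have h4 := P.form_φ₁.self_of_nhds (fderiv ℝ Z₁ y u)
  simp only [lieEnd, map_add, map_sub, h4]
  rw [dform] at h3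
  linarith

theorem form_lieEnd₁₂ (u : E) : α₁ y (lieEnd Z₂ φ y u) = 0 := by
  have h1 := P.fderiv_form_φ₁ (Z₂ y) u
  have h2 := P.fderiv_form₁₂ (φ y u)
  have h3 := P.contract₁₂ (φ y u)
  have h4 := P.form_φ₁.self_of_nhds (fderiv ℝ Z₂ y u)
  simp only [lieEnd, map_add, map_sub, h4]
  rw [dform] at h3
  linarith

theorem form_lieEnd₂₁ (u : E) : α₂ y (lieEnd Z₁ φ y u) = 0 := P.swap.form_lieEnd₁₂ u

/-- As φ Z₁ = 0, only the brackets with Z₁ itself survive in the torsion. -/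
theorem nij_Z₁ (v : E) : nij φ y (Z₁ y) v = -φ y (lieEnd Z₁ φ y v) := by
  have h0 := P.φ_Z₁.self_of_nhds
  have h1 := P.fderiv_φ_Z₁ (φ y v)
  have h2 := P.fderiv_φ_Z₁ v
  have e1 := eq_neg_of_add_eq_zero_left h1
  have e2 := eq_neg_of_add_eq_zero_left h2
  simp only [nij, lieEnd, map_add, map_sub, h0, map_zero, zero_apply, e1, e2, map_neg]
  abel

theorem nij_Z₂ (v : E) : nij φ y (Z₂ y) v = -φ y (lieEnd Z₂ φ y v) := P.swap.nij_Z₁ v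

/-- As α₁ ∘ φ = 0, only α₁ of the bracket [φu, φv] survives, and it is -dα₁(φu, φv). -/
theorem form_nij₁ (u v : E) : α₁ y (nij φ y u v) = -dform α₁ y (φ y u) (φ y v) := by
  have h0 := P.form_φ₁.self_of_nhds (fderiv ℝ φ y u v - fderiv ℝ φ y v u)
  have h1 := P.fderiv_form_φ₁ (φ y u) v
  have h2 := P.fderiv_form_φ₁ (φ y v) u
  rw [nij, map_sub, map_sub, h0, dform]
  linarith

theorem form_nij₂ (u v : E) : α₂ y (nij φ y u v) = -dform α₂ y (φ y u) (φ y v) :=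
  P.swap.form_nij₁ u v

theorem lieEnd_Z₁_Z₁ : lieEnd Z₁ φ y (Z₁ y) = 0 := by
  have h0 := P.φ_Z₁.self_of_nhds
  have h1 := P.fderiv_φ_Z₁ (Z₁ y)
  simpa [lieEnd, h0] using h1

theorem lieEnd_Z₂_Z₂ : lieEnd Z₂ φ y (Z₂ y) = 0 := P.swap.lieEnd_Z₁_Z₁

/-- The left side is -φ [Z₁, Z₂], antisymmetric in the indices. This transfers invariance of φ
between Reeb fields on Reeb vectors. -/
theorem lieEnd_Z₁_Z₂ : lieEnd Z₁ φ y (Z₂ y) = -lieEnd Z₂ φ y (Z₁ y) := by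
  have h0 := P.φ_Z₁.self_of_nhds
  have h0' := P.φ_Z₂.self_of_nhds
  have e1 := eq_neg_of_add_eq_zero_left (P.fderiv_φ_Z₁ (Z₂ y))
  have e2 := eq_neg_of_add_eq_zero_left (P.fderiv_φ_Z₂ (Z₁ y))
  simp only [lieEnd, h0, h0', e1, e2, map_zero]
  abel

theorem eq_zero_of_φ_eq_zero {u : E} (h : φ y u = 0) (h₁ : α₁ y u = 0) (h₂ : α₂ y u = 0) :
    u = 0 := by
  have := P.sq.self_of_nhds u
  rw [h, h₁, h₂] at this
  simpa using this

end LocalPair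

end Coordinates

/-! ### Torsion of J and of the almost complex structure on the product with the line. -/

section Coordinates
open Filter Topology

variable {E : Type*} [NormedAddCommGroup E] [NormedSpace ℝ E]

theorem differentiableAt_smulRight {G F : Type*} [NormedAddCommGroup G] [NormedSpace ℝ G]
    [NormedAddCommGroup F] [NormedSpace ℝ F] {α : G → E →L[ℝ] ℝ} {Z : G → F} {y : G}
    (hα : DifferentiableAt ℝ α y) (hZ : DifferentiableAt ℝ Z y) :
    DifferentiableAt ℝ (fun z => (α z).smulRight (Z z)) y :=
  DifferentiableAt.comp (g := fun p : (E →L[ℝ] ℝ) × F => p.1.smulRight p.2) y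
    (isBoundedBilinearMap_smulRight.differentiableAt (α y, Z y)) (hα.prodMk hZ)

/-- The almost complex structure `φ - α₂ ⊗ Z₁ + α₁ ⊗ Z₂`. -/
noncomputable def localJ (φ : E → E →L[ℝ] E) (α₁ α₂ : E → E →L[ℝ] ℝ) (Z₁ Z₂ : E → E) (z : E) :
    E →L[ℝ] E :=
  φ z - (α₂ z).smulRight (Z₁ z) + (α₁ z).smulRight (Z₂ z)

/-- Local expression of the almost complex structure on the product with the line. -/
noncomputable def localCone (φ : E → E →L[ℝ] E) (α : E → E →L[ℝ] ℝ) (Z : E → E) (q : E × ℝ) :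
    E × ℝ →L[ℝ] E × ℝ :=
  ((φ q.1).comp (ContinuousLinearMap.fst ℝ E ℝ) -
    (ContinuousLinearMap.snd ℝ E ℝ).smulRight (Z q.1)).prod
      ((α q.1).comp (ContinuousLinearMap.fst ℝ E ℝ))

theorem localCone_apply (φ : E → E →L[ℝ] E) (α : E → E →L[ℝ] ℝ) (Z : E → E) (q U : E × ℝ) :
    localCone φ α Z q U = (φ q.1 U.1 - U.2 • Z q.1, α q.1 U.1) := rfl

theorem differentiableAt_localCone {φ : E → E →L[ℝ] E} {α : E → E →L[ℝ] ℝ} {Z : E → E} {y : E}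
    (hφ : DifferentiableAt ℝ φ y) (hα : DifferentiableAt ℝ α y) (hZ : DifferentiableAt ℝ Z y)
    (t : ℝ) : DifferentiableAt ℝ (localCone φ α Z) (y, t) := by
  have h1 : DifferentiableAt ℝ (fun q : E × ℝ => φ q.1) (y, t) :=
    DifferentiableAt.comp (g := φ) (y, t) hφ differentiableAt_fst
  have h2 : DifferentiableAt ℝ (fun q : E × ℝ => α q.1) (y, t) :=
    DifferentiableAt.comp (g := α) (y, t) hα differentiableAt_fst
  have h3 : DifferentiableAt ℝ (fun q : E × ℝ => Z q.1) (y, t) :=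
    DifferentiableAt.comp (g := Z) (y, t) hZ differentiableAt_fst
  have e1 : DifferentiableAt ℝ (fun q : E × ℝ => (φ q.1).comp (ContinuousLinearMap.fst ℝ E ℝ) -
    (ContinuousLinearMap.snd ℝ E ℝ).smulRight (Z q.1)) (y, t) :=
    (h1.clm_comp (differentiableAt_const _)).sub
      (differentiableAt_smulRight (differentiableAt_const _) h3)
  have e2 : DifferentiableAt ℝ (fun q : E × ℝ => (α q.1).comp (ContinuousLinearMap.fst ℝ E ℝ))
      (y, t) := h2.clm_comp (differentiableAt_const _)
  -- A map into the product is the sum of its components followed by the two inclusions, which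
  -- reduces the claim to compositions.
  have e3 := ((differentiableAt_const (c := ContinuousLinearMap.inl ℝ E ℝ)).clm_comp e1).add
    ((differentiableAt_const (c := ContinuousLinearMap.inr ℝ E ℝ)).clm_comp e2)
  refine e3.congr_of_eventuallyEq (Eventually.of_forall fun q => ?_)
  ext U <;> simp [localCone]

theorem fderiv_localCone {φ : E → E →L[ℝ] E} {α : E → E →L[ℝ] ℝ} {Z : E → E} {y : E}
    (hφ : DifferentiableAt ℝ φ y) (hα : DifferentiableAt ℝ α y) (hZ : DifferentiableAt ℝ Z y)
    (t : ℝ) (W U : E × ℝ) :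
    fderiv ℝ (localCone φ α Z) (y, t) W U =
      (fderiv ℝ φ y W.1 U.1 - U.2 • fderiv ℝ Z y W.1, fderiv ℝ α y W.1 U.1) := by
  rw [fderiv_apply_eq (differentiableAt_localCone hφ hα hZ t)]
  have hf : HasFDerivAt (fun q : E × ℝ => q.1) (ContinuousLinearMap.fst ℝ E ℝ) (y, t) :=
    hasFDerivAt_fst
  have h1 : HasFDerivAt (fun q : E × ℝ => φ q.1 U.1) _ (y, t) :=
    (HasFDerivAt.comp (g := φ) (y, t) hφ.hasFDerivAt hf).clm_apply (hasFDerivAt_const U.1 _)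
  have h2 : HasFDerivAt (fun q : E × ℝ => α q.1 U.1) _ (y, t) :=
    (HasFDerivAt.comp (g := α) (y, t) hα.hasFDerivAt hf).clm_apply (hasFDerivAt_const U.1 _)
  have h3 : HasFDerivAt (fun q : E × ℝ => U.2 • Z q.1) _ (y, t) :=
    (HasFDerivAt.comp (g := Z) (y, t) hZ.hasFDerivAt hf).const_smul U.2
  have := ((h1.sub h3).prodMk h2).fderiv
  have h4 : (fun q => localCone φ α Z q U) = fun q : E × ℝ =>
    (φ q.1 U.1 - U.2 • Z q.1, α q.1 U.1) := rfl
  rw [h4]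
  erw [this]
  simp

namespace LocalPair

variable {φ : E → E →L[ℝ] E} {α₁ α₂ : E → E →L[ℝ] ℝ} {Z₁ Z₂ : E → E} {y : E}
  (P : LocalPair φ α₁ α₂ Z₁ Z₂ y)
include P

theorem differentiableAt_localJ : DifferentiableAt ℝ (localJ φ α₁ α₂ Z₁ Z₂) y :=
  (P.diff_φ.sub (differentiableAt_smulRight P.diff_α₂ P.diff_Z₁)).add
    (differentiableAt_smulRight P.diff_α₁ P.diff_Z₂)

theorem fderiv_localJ (w u : E) : fderiv ℝ (localJ φ α₁ α₂ Z₁ Z₂) y w u =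
    fderiv ℝ φ y w u - (fderiv ℝ α₂ y w u • Z₁ y + α₂ y u • fderiv ℝ Z₁ y w) +
      (fderiv ℝ α₁ y w u • Z₂ y + α₁ y u • fderiv ℝ Z₂ y w) := by
  rw [fderiv_apply_eq P.differentiableAt_localJ]
  have h1 := P.diff_φ.hasFDerivAt.clm_apply (hasFDerivAt_const u y)
  have h2 := (P.diff_α₂.hasFDerivAt.clm_apply (hasFDerivAt_const u y)).smul P.diff_Z₁.hasFDerivAt
  have h3 := (P.diff_α₁.hasFDerivAt.clm_apply (hasFDerivAt_const u y)).smul P.diff_Z₂.hasFDerivAt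
  have := ((h1.sub h2).add h3).fderiv
  have h4 : (fun z => localJ φ α₁ α₂ Z₁ Z₂ z u) =
    fun z => φ z u - α₂ z u • Z₁ z + α₁ z u • Z₂ z := rfl
  rw [h4]
  erw [this]
  simp [add_comm]

/-- At horizontal vectors the derivatives of Z₁ and Z₂ drop out. The terms dαᵢ(u,v) Zᵢ come from J
Z₁ = Z₂ and J Z₂ = -Z₁; the mixed terms come from differentiating αᵢ along φu and φv. -/
theorem nij_localJ_horizontal {u v : E} (hu₁ : α₁ y u = 0) (hu₂ : α₂ y u = 0) (hv₁ : α₁ y v = 0)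
    (hv₂ : α₂ y v = 0) :
    nij (localJ φ α₁ α₂ Z₁ Z₂) y u v = nij φ y u v + dform α₁ y u v • Z₁ y + dform α₂ y u v • Z₂ y
      - (dform α₂ y (φ y u) v + dform α₂ y u (φ y v)) • Z₁ y
      + (dform α₁ y (φ y u) v + dform α₁ y u (φ y v)) • Z₂ y := by
  have a1 := eq_neg_of_add_eq_zero_right (P.fderiv_form_φ₁ u v)
  have a2 := eq_neg_of_add_eq_zero_right (P.fderiv_form_φ₁ v u)
  have b1 := eq_neg_of_add_eq_zero_right (P.fderiv_form_φ₂ u v)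
  have b2 := eq_neg_of_add_eq_zero_right (P.fderiv_form_φ₂ v u)
  have hJ : ∀ w, localJ φ α₁ α₂ Z₁ Z₂ y w = φ y w - α₂ y w • Z₁ y + α₁ y w • Z₂ y := fun w => rfl
  simp only [nij, P.fderiv_localJ, hJ, hu₁, hu₂, hv₁, hv₂, zero_smul, sub_zero, add_zero, map_sub,
    map_add, map_smul, P.φ_Z₁.self_of_nhds, P.φ_Z₂.self_of_nhds, P.form₁₁.self_of_nhds,
    P.form₁₂.self_of_nhds, P.form₂₁.self_of_nhds, P.form₂₂.self_of_nhds, a1, a2, b1, b2, dform,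
    smul_zero, smul_eq_mul, mul_zero, mul_one]
  module

/-- In general [J,J](X,v) = (L_{JX}J)v - J(L_X J)v, and J Z₁ = Z₂. The Reeb fields preserve both
forms, so on horizontal v only L φ remains, with horizontal values, where J is φ. -/
theorem nij_localJ_Z₁ {v : E} (hv₁ : α₁ y v = 0) (hv₂ : α₂ y v = 0) :
    nij (localJ φ α₁ α₂ Z₁ Z₂) y (Z₁ y) v = lieEnd Z₂ φ y v - φ y (lieEnd Z₁ φ y v) := by
  have hJ : ∀ w, localJ φ α₁ α₂ Z₁ Z₂ y w = φ y w - α₂ y w • Z₁ y + α₁ y w • Z₂ y := fun w => rfl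
  have a0 : ∀ w, α₁ y (φ y w) = 0 := P.form_φ₁.self_of_nhds
  have b0 : ∀ w, α₂ y (φ y w) = 0 := P.form_φ₂.self_of_nhds
  have a1 := fun w => eq_neg_of_add_eq_zero_left (P.fderiv_form₁₁ w)
  have a2 := fun w => eq_neg_of_add_eq_zero_left (P.fderiv_form₂₁ w)
  have a3 := fun w => eq_neg_of_add_eq_zero_left (P.fderiv_φ_Z₁ w)
  have a4 := eq_neg_of_add_eq_zero_right (P.fderiv_form_φ₁ (Z₁ y) v)
  have a5 := eq_neg_of_add_eq_zero_right (P.fderiv_form_φ₂ (Z₁ y) v)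
  have c1 : ∀ w, fderiv ℝ α₁ y (Z₁ y) w = fderiv ℝ α₁ y w (Z₁ y) :=
    fun w => sub_eq_zero.1 (P.contract₁₁ w)
  have c2 : ∀ w, fderiv ℝ α₁ y (Z₂ y) w = fderiv ℝ α₁ y w (Z₂ y) :=
    fun w => sub_eq_zero.1 (P.contract₁₂ w)
  have c3 : ∀ w, fderiv ℝ α₂ y (Z₁ y) w = fderiv ℝ α₂ y w (Z₁ y) :=
    fun w => sub_eq_zero.1 (P.contract₂₁ w)
  have c4 : ∀ w, fderiv ℝ α₂ y (Z₂ y) w = fderiv ℝ α₂ y w (Z₂ y) :=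
    fun w => sub_eq_zero.1 (P.contract₂₂ w)
  have d1 := fun w => eq_neg_of_add_eq_zero_left (P.fderiv_form₁₂ w)
  have d2 := fun w => eq_neg_of_add_eq_zero_left (P.fderiv_form₂₂ w)
  simp only [nij, lieEnd, P.fderiv_localJ, hJ, hv₁, hv₂, zero_smul, sub_zero, add_zero, map_sub,
    map_add, map_smul, map_neg, P.φ_Z₁.self_of_nhds, P.φ_Z₂.self_of_nhds, P.form₁₁.self_of_nhds,
    P.form₁₂.self_of_nhds, P.form₂₁.self_of_nhds, P.form₂₂.self_of_nhds, a0, b0, a3, a4, a5,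
    smul_zero, smul_eq_mul, mul_zero, mul_one, one_smul, zero_add, c1, c2, c3, c4,
    a1, a2, d1, d2]
  module

theorem nij_localJ_Z₂ {v : E} (hv₁ : α₁ y v = 0) (hv₂ : α₂ y v = 0) :
    nij (localJ φ α₁ α₂ Z₁ Z₂) y (Z₂ y) v = -lieEnd Z₁ φ y v - φ y (lieEnd Z₂ φ y v) := by
  have hJ : ∀ w, localJ φ α₁ α₂ Z₁ Z₂ y w = φ y w - α₂ y w • Z₁ y + α₁ y w • Z₂ y := fun w => rfl
  have a0 : ∀ w, α₁ y (φ y w) = 0 := P.form_φ₁.self_of_nhds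
  have b0 : ∀ w, α₂ y (φ y w) = 0 := P.form_φ₂.self_of_nhds
  have a1 := fun w => eq_neg_of_add_eq_zero_left (P.fderiv_form₁₁ w)
  have a2 := fun w => eq_neg_of_add_eq_zero_left (P.fderiv_form₂₁ w)
  have c1 : ∀ w, fderiv ℝ α₁ y (Z₁ y) w = fderiv ℝ α₁ y w (Z₁ y) :=
    fun w => sub_eq_zero.1 (P.contract₁₁ w)
  have c3 : ∀ w, fderiv ℝ α₂ y (Z₁ y) w = fderiv ℝ α₂ y w (Z₁ y) :=
    fun w => sub_eq_zero.1 (P.contract₂₁ w)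
  have a3 := fun w => eq_neg_of_add_eq_zero_left (P.fderiv_φ_Z₂ w)
  have a4 := eq_neg_of_add_eq_zero_right (P.fderiv_form_φ₁ (Z₂ y) v)
  have a5 := eq_neg_of_add_eq_zero_right (P.fderiv_form_φ₂ (Z₂ y) v)
  have c2 : ∀ w, fderiv ℝ α₁ y (Z₂ y) w = fderiv ℝ α₁ y w (Z₂ y) :=
    fun w => sub_eq_zero.1 (P.contract₁₂ w)
  have c4 : ∀ w, fderiv ℝ α₂ y (Z₂ y) w = fderiv ℝ α₂ y w (Z₂ y) :=
    fun w => sub_eq_zero.1 (P.contract₂₂ w)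
  have d1 := fun w => eq_neg_of_add_eq_zero_left (P.fderiv_form₁₂ w)
  have d2 := fun w => eq_neg_of_add_eq_zero_left (P.fderiv_form₂₂ w)
  simp only [nij, lieEnd, P.fderiv_localJ, hJ, hv₁, hv₂, zero_smul, sub_zero, add_zero, map_sub,
    map_add, map_smul, map_neg, P.φ_Z₁.self_of_nhds, P.φ_Z₂.self_of_nhds, P.form₁₁.self_of_nhds,
    P.form₁₂.self_of_nhds, P.form₂₁.self_of_nhds, P.form₂₂.self_of_nhds, a0, b0, a3, a4, a5,
    smul_zero, smul_eq_mul, mul_zero, mul_one, one_smul, zero_sub,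
    a1, a2, c1, c2, c3, c4, d1, d2, neg_smul, neg_apply]
  module

/-- Z₂ = J Z₁, and the torsion of an almost complex structure vanishes on a couple (X, JX). -/
theorem nij_localJ_Z₁_Z₂ : nij (localJ φ α₁ α₂ Z₁ Z₂) y (Z₁ y) (Z₂ y) = 0 := by
  have hJ : ∀ w, localJ φ α₁ α₂ Z₁ Z₂ y w = φ y w - α₂ y w • Z₁ y + α₁ y w • Z₂ y := fun w => rfl
  have a0 : ∀ w, α₁ y (φ y w) = 0 := P.form_φ₁.self_of_nhds
  have b0 : ∀ w, α₂ y (φ y w) = 0 := P.form_φ₂.self_of_nhds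
  have a1 := fun w => eq_neg_of_add_eq_zero_left (P.fderiv_form₁₁ w)
  have a2 := fun w => eq_neg_of_add_eq_zero_left (P.fderiv_form₂₁ w)
  have d1 := fun w => eq_neg_of_add_eq_zero_left (P.fderiv_form₁₂ w)
  have d2 := fun w => eq_neg_of_add_eq_zero_left (P.fderiv_form₂₂ w)
  have a3 := fun w => eq_neg_of_add_eq_zero_left (P.fderiv_φ_Z₁ w)
  have a3' := fun w => eq_neg_of_add_eq_zero_left (P.fderiv_φ_Z₂ w)
  have hs := P.sq.self_of_nhds
  simp only [nij, P.fderiv_localJ, hJ, zero_smul, sub_zero, add_zero, map_sub,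
    map_add, map_smul, map_neg, P.φ_Z₁.self_of_nhds, P.φ_Z₂.self_of_nhds, P.form₁₁.self_of_nhds,
    P.form₁₂.self_of_nhds, P.form₂₁.self_of_nhds, P.form₂₂.self_of_nhds, a0, b0, a3, a3',
    smul_zero, smul_eq_mul, mul_zero, mul_one, one_smul, zero_add, zero_sub,
    a1, a2, d1, d2, neg_smul, neg_apply, hs]
  module

/-- Without ℝ-components, the first entry is the part of N carried by index 1. This is how normality
of leaves sees N. -/
theorem nij_localCone (t : ℝ) (U V : E × ℝ) :
    nij (localCone φ α₁ Z₁) (y, t) U V =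
      (nij φ y U.1 V.1 + dform α₁ y U.1 V.1 • Z₁ y - U.2 • lieEnd Z₁ φ y V.1
        + V.2 • lieEnd Z₁ φ y U.1,
       dform α₁ y (φ y U.1) V.1 + dform α₁ y U.1 (φ y V.1)) := by
  obtain ⟨u, a⟩ := U
  obtain ⟨v, b⟩ := V
  have a1 := eq_neg_of_add_eq_zero_right (P.fderiv_form_φ₁ u v)
  have a2 := eq_neg_of_add_eq_zero_right (P.fderiv_form_φ₁ v u)
  have c1 : ∀ w, fderiv ℝ α₁ y (Z₁ y) w = fderiv ℝ α₁ y w (Z₁ y) :=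
    fun w => sub_eq_zero.1 (P.contract₁₁ w)
  have d1 := fun w => eq_neg_of_add_eq_zero_left (P.fderiv_form₁₁ w)
  simp only [nij, fderiv_localCone P.diff_φ P.diff_α₁ P.diff_Z₁, localCone_apply, dform, lieEnd,
    map_sub, map_smul, Prod.mk_sub_mk, a1, a2, c1, d1, sub_apply, smul_apply, smul_eq_mul]
  refine Prod.ext ?_ ?_
  · simp only
    module
  · simp only
    ring

end LocalPair

end Coordinates

/-! ### Naturality, and the pointwise equivalences with N = 0. -/

section Coordinates
open Filter Topology

variable {E : Type*} [NormedAddCommGroup E] [NormedSpace ℝ E]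

/-- The Nijenhuis tensor is natural: a map intertwining two fields of endomorphisms intertwines
their Nijenhuis tensors. -/
theorem fderiv_nij_of_intertwine {E' : Type*} [NormedAddCommGroup E'] [NormedSpace ℝ E']
    {g : E' → E} {Ψ : E' → E' →L[ℝ] E'} {Φ : E → E →L[ℝ] E} {p : E'} (hg : ContDiffAt ℝ 2 g p)
    (hΨ : DifferentiableAt ℝ Ψ p) (hΦ : DifferentiableAt ℝ Φ (g p))
    (h : ∀ᶠ z in 𝓝 p, ∀ u, fderiv ℝ g z (Ψ z u) = Φ (g z) (fderiv ℝ g z u)) (u v : E') :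
    fderiv ℝ g p (nij Ψ p u v) = nij Φ (g p) (fderiv ℝ g p u) (fderiv ℝ g p v) := by
  have hg1 : DifferentiableAt ℝ g p := hg.differentiableAt (by simp)
  have hg2 : DifferentiableAt ℝ (fderiv ℝ g) p :=
    (hg.fderiv_right (m := 1) (by norm_num)).differentiableAt (by simp)
  have hsymm : ∀ a b, fderiv ℝ (fderiv ℝ g) p a b = fderiv ℝ (fderiv ℝ g) p b a := fun a b =>
    (hg.isSymmSndFDerivAt (by simp)) a b
  have key : ∀ w u, fderiv ℝ g p (fderiv ℝ Ψ p w u) = fderiv ℝ Φ (g p) (fderiv ℝ g p w)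
      (fderiv ℝ g p u) + Φ (g p) (fderiv ℝ (fderiv ℝ g) p w u)
        - fderiv ℝ (fderiv ℝ g) p w (Ψ p u) := by
    intro w u
    have hc := (hΦ.hasFDerivAt.comp p hg1.hasFDerivAt).clm_apply
      (hg2.hasFDerivAt.clm_apply (hasFDerivAt_const u p))
    have h1 := fderiv_clm_apply_eq_of_eventuallyEq (f := fun z => Ψ z u) hg2
      (hΨ.clm_apply (differentiableAt_const u)) (h.mono fun z hz => hz u) w
    erw [hc.fderiv, ← fderiv_apply_eq hΨ] at h1
    have h2 : fderiv ℝ g p (fderiv ℝ Ψ p w u) = _ := eq_sub_of_add_eq' h1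
    rw [h2]
    simp [add_comm]
  have h0 := h.self_of_nhds
  simp only [nij, map_sub, key, h0, map_add]
  -- The second derivative of g is symmetric, so all its contributions cancel.
  rw [hsymm (Ψ p u) v, hsymm (Ψ p v) u, hsymm u v, hsymm (Ψ p u) (Ψ p v)]
  abel

/-- The exterior derivative of `1`-forms commutes with pullback. -/
theorem dform_pullback {E' : Type*} [NormedAddCommGroup E'] [NormedSpace ℝ E']
    {g : E' → E} {β : E' → E' →L[ℝ] ℝ} {α : E → E →L[ℝ] ℝ} {p : E'} (hg : ContDiffAt ℝ 2 g p)
    (hβ : DifferentiableAt ℝ β p) (hα : DifferentiableAt ℝ α (g p))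
    (h : ∀ᶠ z in 𝓝 p, ∀ u, β z u = α (g z) (fderiv ℝ g z u)) (u v : E') :
    dform β p u v = dform α (g p) (fderiv ℝ g p u) (fderiv ℝ g p v) := by
  have hg1 : DifferentiableAt ℝ g p := hg.differentiableAt (by simp)
  have hg2 : DifferentiableAt ℝ (fderiv ℝ g) p :=
    (hg.fderiv_right (m := 1) (by norm_num)).differentiableAt (by simp)
  have hsymm : ∀ a b, fderiv ℝ (fderiv ℝ g) p a b = fderiv ℝ (fderiv ℝ g) p b a := fun a b =>
    (hg.isSymmSndFDerivAt (by simp)) a b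
  have key : ∀ w u, fderiv ℝ β p w u = fderiv ℝ α (g p) (fderiv ℝ g p w) (fderiv ℝ g p u) +
      α (g p) (fderiv ℝ (fderiv ℝ g) p w u) := by
    intro w u
    have hc := (hα.hasFDerivAt.comp p hg1.hasFDerivAt).clm_apply
      (hg2.hasFDerivAt.clm_apply (hasFDerivAt_const u p))
    rw [fderiv_apply_eq hβ, EventuallyEq.fderiv_eq (h.mono fun z hz => hz u)]
    erw [hc.fderiv]
    simp [add_comm]
  rw [dform, key, key, hsymm u v, dform]
  ring

/-- The subspace `ker α ∩ ker dα` of a `1`-form on a normed space. -/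
noncomputable def localChar (α : E → E →L[ℝ] ℝ) (y : E) : Submodule ℝ E where
  carrier := {u | α y u = 0 ∧ ∀ w, dform α y u w = 0}
  add_mem' := fun ha hb => ⟨by rw [map_add, ha.1, hb.1, add_zero],
    fun w => by rw [dform_add_left, ha.2, hb.2, add_zero]⟩
  zero_mem' := ⟨map_zero _, fun w => by simp [dform]⟩
  smul_mem' := fun c a ha => ⟨by rw [map_smul, ha.1, smul_zero],
    fun w => by rw [dform_smul_left, ha.2, mul_zero]⟩

theorem mem_localChar {α : E → E →L[ℝ] ℝ} {y u : E} :
    u ∈ localChar α y ↔ α y u = 0 ∧ ∀ w, dform α y u w = 0 := Iff.rfl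

/-- The torsion condition `[φ, φ] + dα₁ ⊗ Z₁ + dα₂ ⊗ Z₂ = 0` at a point. -/
def IsNormalAt (φ : E → E →L[ℝ] E) (α₁ α₂ : E → E →L[ℝ] ℝ) (Z₁ Z₂ : E → E) (y : E) : Prop :=
  ∀ u v, nij φ y u v + dform α₁ y u v • Z₁ y + dform α₂ y u v • Z₂ y = 0

theorem IsNormalAt.swap {φ : E → E →L[ℝ] E} {α₁ α₂ : E → E →L[ℝ] ℝ} {Z₁ Z₂ : E → E} {y : E}
    (h : IsNormalAt φ α₁ α₂ Z₁ Z₂ y) : IsNormalAt φ α₂ α₁ Z₂ Z₁ y := fun u v => by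
  rw [← h u v]; abel

namespace LocalPair

variable {φ : E → E →L[ℝ] E} {α₁ α₂ : E → E →L[ℝ] ℝ} {Z₁ Z₂ : E → E} {y : E}
  (P : LocalPair φ α₁ α₂ Z₁ Z₂ y)
include P

/-- A linear condition holds for all vectors if it holds for horizontal vectors and Reeb vectors. -/
theorem induction_horizontal {p : E → Prop} (hadd : ∀ u v, p u → p v → p (u + v))
    (hsmul : ∀ (c : ℝ) u, p u → p (c • u)) (h₁ : p (Z₁ y)) (h₂ : p (Z₂ y))
    (h : ∀ u, α₁ y u = 0 → α₂ y u = 0 → p u) (u : E) : p u := by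
  have hu : u = (u - α₁ y u • Z₁ y - α₂ y u • Z₂ y) + (α₁ y u • Z₁ y + α₂ y u • Z₂ y) := by abel
  rw [hu]
  refine hadd _ _ (h _ ?_ ?_) (hadd _ _ (hsmul _ _ h₁) (hsmul _ _ h₂)) <;>
  simp [P.form₁₁.self_of_nhds, P.form₁₂.self_of_nhds, P.form₂₁.self_of_nhds,
    P.form₂₂.self_of_nhds]

/-- On horizontal vectors [J,J](Z₁,v) = 0 reads L_{Z₂}φ v = φ L_{Z₁}φ v; on Reeb vectors the
antisymmetry of `lieEnd_Z₁_Z₂` concludes. -/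
theorem lieEnd_Z₂_eq_zero (hJ : ∀ u v, nij (localJ φ α₁ α₂ Z₁ Z₂) y u v = 0)
    (hL : ∀ u, lieEnd Z₁ φ y u = 0) (u : E) : lieEnd Z₂ φ y u = 0 := by
  refine P.induction_horizontal (p := fun u => lieEnd Z₂ φ y u = 0)
    (fun u v hu hv => by rw [lieEnd_add, hu, hv, add_zero])
    (fun c u hu => by rw [lieEnd_smul, hu, smul_zero]) ?_ P.lieEnd_Z₂_Z₂ (fun v h₁ h₂ => ?_) u
  · rw [← neg_eq_zero, ← P.lieEnd_Z₁_Z₂, hL]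
  · have := P.nij_localJ_Z₁ h₁ h₂
    rw [hJ, hL, map_zero, sub_zero] at this
    exact this.symm

theorem lieEnd_Z₁_eq_zero (hJ : ∀ u v, nij (localJ φ α₁ α₂ Z₁ Z₂) y u v = 0)
    (hL : ∀ u, lieEnd Z₂ φ y u = 0) (u : E) : lieEnd Z₁ φ y u = 0 := by
  refine P.induction_horizontal (p := fun u => lieEnd Z₁ φ y u = 0)
    (fun u v hu hv => by rw [lieEnd_add, hu, hv, add_zero])
    (fun c u hu => by rw [lieEnd_smul, hu, smul_zero]) P.lieEnd_Z₁_Z₁ ?_ (fun v h₁ h₂ => ?_) u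
  · rw [P.lieEnd_Z₁_Z₂, hL, neg_zero]
  · have := P.nij_localJ_Z₂ h₁ h₂
    rw [hJ, hL, map_zero, sub_zero] at this
    exact neg_eq_zero.1 this.symm

/-- Invariance of φ gives N on Reeb vectors. On horizontal vectors N is [J,J] up to the mixed terms
dαᵢ(φu,v) + dαᵢ(u,φv), and decomposability is what removes them. -/
theorem isNormalAt_of_nij_localJ (hJ : ∀ u v, nij (localJ φ α₁ α₂ Z₁ Z₂) y u v = 0)
    (hL₁ : ∀ u, lieEnd Z₁ φ y u = 0) (hL₂ : ∀ u, lieEnd Z₂ φ y u = 0)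
    (hF : ∀ u, ∃ u₁ ∈ localChar α₁ y, ∃ u₂ ∈ localChar α₂ y, u = u₁ + u₂)
    (hφ₁ : ∀ u ∈ localChar α₁ y, φ y u ∈ localChar α₁ y)
    (hφ₂ : ∀ u ∈ localChar α₂ y, φ y u ∈ localChar α₂ y) :
    IsNormalAt φ α₁ α₂ Z₁ Z₂ y := by
  -- Split u = a + b along the two distributions. As a and φa are in the kernel of dα₁, the
  -- Z₁-component of [J,J](a,v) is just minus the mixed term of dα₂; the Z₂-component of [J,J](b,v)
  -- is likewise the mixed term of dα₁. The remaining mixed terms vanish trivially.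
  have hH : ∀ u v, α₁ y u = 0 → α₂ y u = 0 → α₁ y v = 0 → α₂ y v = 0 →
      dform α₁ y (φ y u) v + dform α₁ y u (φ y v) = 0 ∧
      dform α₂ y (φ y u) v + dform α₂ y u (φ y v) = 0 := by
    intro u v hu₁ hu₂ hv₁ hv₂
    obtain ⟨a, ha, b, hb, rfl⟩ := hF u
    have ha₂ : α₂ y a = 0 := by rw [map_add, hb.1, add_zero] at hu₂; exact hu₂
    have hb₁ : α₁ y b = 0 := by rw [map_add, ha.1, zero_add] at hu₁; exact hu₁
    have A := P.nij_localJ_horizontal ha.1 ha₂ hv₁ hv₂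
    have B := P.nij_localJ_horizontal hb₁ hb.1 hv₁ hv₂
    rw [hJ] at A B
    have A' := congrArg (α₁ y) A
    have B' := congrArg (α₂ y) B
    simp only [map_add, map_sub, map_smul, map_zero, P.form_nij₁, P.form_nij₂,
      P.form₁₁.self_of_nhds, P.form₁₂.self_of_nhds, P.form₂₁.self_of_nhds,
      P.form₂₂.self_of_nhds, ha.2, (hφ₁ a ha).2, hb.2, (hφ₂ b hb).2, smul_eq_mul] at A' B'
    simp only [map_add, dform_add_left, ha.2, (hφ₁ a ha).2, hb.2, (hφ₂ b hb).2]
    constructor <;> linarith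
  have hn₁ : ∀ v, nij φ y (Z₁ y) v = 0 := fun v => by rw [P.nij_Z₁, hL₁, map_zero, neg_zero]
  have hn₂ : ∀ v, nij φ y (Z₂ y) v = 0 := fun v => by rw [P.nij_Z₂, hL₂, map_zero, neg_zero]
  intro u v
  refine P.induction_horizontal
    (p := fun u => nij φ y u v + dform α₁ y u v • Z₁ y + dform α₂ y u v • Z₂ y = 0)
    (fun a b ha hb => ?_) (fun c a ha => ?_) ?_ ?_ (fun u hu₁ hu₂ => ?_) u
  · rw [nij_add_left, dform_add_left, dform_add_left, ← add_zero (0 : E)]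
    nth_rewrite 1 [← ha]
    nth_rewrite 1 [← hb]
    module
  · rw [nij_smul_left, dform_smul_left, dform_smul_left, ← smul_zero c, ← ha]
    module
  · simp [hn₁, P.contract₁₁, P.contract₂₁]
  · simp [hn₂, P.contract₁₂, P.contract₂₂]
  · refine P.induction_horizontal
      (p := fun v => nij φ y u v + dform α₁ y u v • Z₁ y + dform α₂ y u v • Z₂ y = 0)
      (fun a b ha hb => ?_) (fun c a ha => ?_) ?_ ?_ (fun v hv₁ hv₂ => ?_) v
    · rw [nij_add_right, dform_add_right, dform_add_right, ← add_zero (0 : E)]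
      nth_rewrite 1 [← ha]
      nth_rewrite 1 [← hb]
      module
    · rw [nij_smul_right, dform_smul_right, dform_smul_right, ← smul_zero c, ← ha]
      module
    · rw [nij_swap, dform_swap, dform_swap α₂]
      simp [hn₁, P.contract₁₁, P.contract₂₁]
    · rw [nij_swap, dform_swap, dform_swap α₂]
      simp [hn₂, P.contract₁₂, P.contract₂₂]
    · have A := P.nij_localJ_horizontal hu₁ hu₂ hv₁ hv₂
      rw [hJ, (hH u v hu₁ hu₂ hv₁ hv₂).1, (hH u v hu₁ hu₂ hv₁ hv₂).2, zero_smul, zero_smul,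
        add_zero, sub_zero] at A
      exact A.symm

/-- N(Z₁,u) = -φ(L_{Z₁}φ u), and L_{Z₁}φ u is horizontal, where φ is injective. -/
theorem lieEnd_Z₁_eq_zero_of_isNormalAt (hN : IsNormalAt φ α₁ α₂ Z₁ Z₂ y) (u : E) :
    lieEnd Z₁ φ y u = 0 := by
  have := hN (Z₁ y) u
  rw [P.nij_Z₁, P.contract₁₁, P.contract₂₁, zero_smul, zero_smul, add_zero, add_zero,
    neg_eq_zero] at this
  exact P.eq_zero_of_φ_eq_zero this (P.form_lieEnd₁₁ u) (P.form_lieEnd₂₁ u)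

theorem lieEnd_Z₂_eq_zero_of_isNormalAt (hN : IsNormalAt φ α₁ α₂ Z₁ Z₂ y) (u : E) :
    lieEnd Z₂ φ y u = 0 := P.swap.lieEnd_Z₁_eq_zero_of_isNormalAt hN.swap u

/-- The α₁-component of N = 0 says that dα₁ is φ-invariant; replace v by φv and use φ² = -1 modulo
Reeb vectors, which dα₁ ignores. -/
theorem dform₁_add_eq_zero_of_isNormalAt (hN : IsNormalAt φ α₁ α₂ Z₁ Z₂ y) (u v : E) :
    dform α₁ y (φ y u) v + dform α₁ y u (φ y v) = 0 := by
  have h : ∀ u v, dform α₁ y u v = dform α₁ y (φ y u) (φ y v) := by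
    intro u v
    have := congrArg (α₁ y) (hN u v)
    simp only [map_add, map_smul, map_zero, P.form_nij₁, P.form₁₁.self_of_nhds,
      P.form₁₂.self_of_nhds, smul_eq_mul] at this
    linarith
  rw [h u (φ y v), P.sq.self_of_nhds, dform_add_right, dform_add_right, dform_smul_right,
    dform_smul_right, dform_swap α₁ y (φ y u) (Z₁ y), dform_swap α₁ y (φ y u) (Z₂ y),
    P.contract₁₁, P.contract₁₂, ← neg_one_smul ℝ v, dform_smul_right]
  ring

theorem dform₂_add_eq_zero_of_isNormalAt (hN : IsNormalAt φ α₁ α₂ Z₁ Z₂ y) (u v : E) :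
    dform α₂ y (φ y u) v + dform α₂ y u (φ y v) = 0 :=
  P.swap.dform₁_add_eq_zero_of_isNormalAt hN.swap u v

theorem nij_localJ_eq_zero_of_isNormalAt (hN : IsNormalAt φ α₁ α₂ Z₁ Z₂ y) (u v : E) :
    nij (localJ φ α₁ α₂ Z₁ Z₂) y u v = 0 := by
  have h0 : ∀ w, nij (localJ φ α₁ α₂ Z₁ Z₂) y w w = 0 := fun w => by simp [nij]
  have hL₁ := P.lieEnd_Z₁_eq_zero_of_isNormalAt hN
  have hL₂ := P.lieEnd_Z₂_eq_zero_of_isNormalAt hN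
  have h₁ : ∀ v, nij (localJ φ α₁ α₂ Z₁ Z₂) y (Z₁ y) v = 0 := P.induction_horizontal
    (fun a b ha hb => by rw [nij_add_right, ha, hb, add_zero])
    (fun c a ha => by rw [nij_smul_right, ha, smul_zero]) (h0 _) P.nij_localJ_Z₁_Z₂
    (fun v hv₁ hv₂ => by rw [P.nij_localJ_Z₁ hv₁ hv₂, hL₁, hL₂, map_zero, sub_zero])
  have h₂ : ∀ v, nij (localJ φ α₁ α₂ Z₁ Z₂) y (Z₂ y) v = 0 := P.induction_horizontal
    (fun a b ha hb => by rw [nij_add_right, ha, hb, add_zero])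
    (fun c a ha => by rw [nij_smul_right, ha, smul_zero])
    (by rw [nij_swap, h₁, neg_zero]) (h0 _)
    (fun v hv₁ hv₂ => by rw [P.nij_localJ_Z₂ hv₁ hv₂, hL₁, hL₂, map_zero, neg_zero, sub_zero])
  refine P.induction_horizontal (p := fun u => nij (localJ φ α₁ α₂ Z₁ Z₂) y u v = 0)
    (fun a b ha hb => by rw [nij_add_left, ha, hb, add_zero])
    (fun c a ha => by rw [nij_smul_left, ha, smul_zero]) (h₁ v) (h₂ v) (fun u hu₁ hu₂ => ?_) u
  refine P.induction_horizontal (p := fun v => nij (localJ φ α₁ α₂ Z₁ Z₂) y u v = 0)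
    (fun a b ha hb => by rw [nij_add_right, ha, hb, add_zero])
    (fun c a ha => by rw [nij_smul_right, ha, smul_zero])
    (by rw [nij_swap, h₁, neg_zero]) (by rw [nij_swap, h₂, neg_zero]) (fun v hv₁ hv₂ => ?_) v
  rw [P.nij_localJ_horizontal hu₁ hu₂ hv₁ hv₂, hN, P.dform₁_add_eq_zero_of_isNormalAt hN,
    P.dform₂_add_eq_zero_of_isNormalAt hN]
  simp

theorem nij_localCone_eq_zero_of_isNormalAt (hN : IsNormalAt φ α₁ α₂ Z₁ Z₂ y) (t : ℝ) {U : E × ℝ}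
    (hU : U.1 ∈ localChar α₂ y) (V : E × ℝ) :
    nij (localCone φ α₁ Z₁) (y, t) U V = 0 := by
  have h1 := hN U.1 V.1
  rw [hU.2, zero_smul, add_zero] at h1
  rw [P.nij_localCone, h1, P.lieEnd_Z₁_eq_zero_of_isNormalAt hN,
    P.lieEnd_Z₁_eq_zero_of_isNormalAt hN, P.dform₁_add_eq_zero_of_isNormalAt hN]
  simp

/-- By bilinearity N is determined by its blocks: normality of each kind of leaf controls a diagonal
block. On the mixed blocks both exterior derivatives vanish, leaving only [φ,φ]. -/
theorem isNormalAt_of_nij_localCone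
    (hF : ∀ u, ∃ u₁ ∈ localChar α₁ y, ∃ u₂ ∈ localChar α₂ y, u = u₁ + u₂)
    (h₁ : ∀ u ∈ localChar α₂ y, ∀ v ∈ localChar α₂ y,
      nij (localCone φ α₁ Z₁) (y, 0) (u, 0) (v, 0) = 0)
    (h₂ : ∀ u ∈ localChar α₁ y, ∀ v ∈ localChar α₁ y,
      nij (localCone φ α₂ Z₂) (y, 0) (u, 0) (v, 0) = 0)
    (h₁₂ : ∀ u ∈ localChar α₁ y, ∀ v ∈ localChar α₂ y, nij φ y u v = 0) :
    IsNormalAt φ α₁ α₂ Z₁ Z₂ y := by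
  intro u v
  obtain ⟨a, ha, b, hb, rfl⟩ := hF u
  obtain ⟨c, hc, d, hd, rfl⟩ := hF v
  have e1 := congrArg Prod.fst (h₁ b hb d hd)
  have e2 := congrArg Prod.fst (h₂ a ha c hc)
  rw [P.nij_localCone] at e1
  rw [P.swap.nij_localCone] at e2
  simp only [zero_smul, sub_zero, add_zero, Prod.fst_zero] at e1 e2
  have e3 := h₁₂ a ha d hd
  have e4 : nij φ y b c = 0 := by rw [nij_swap, h₁₂ c hc b hb, neg_zero]
  simp only [nij_add_left, nij_add_right, dform_add_left, dform_add_right, ha.2, hb.2, e3, e4,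
    dform_swap α₁ y b c, hc.2, dform_swap α₂ y a d, hd.2, neg_zero, zero_add, add_zero]
  rw [← add_zero (0 : E)]
  nth_rewrite 1 [← e1]
  rw [← e2]
  abel

end LocalPair

end Coordinates

/-! ### Expressions of tensor fields in the preferred charts. -/

section Charts
open Filter Topology Set Bundle

variable {E : Type*} [NormedAddCommGroup E] [NormedSpace ℝ E]
  {H : Type*} [TopologicalSpace H] (I : ModelWithCorners ℝ E H)
  {M : Type*} [TopologicalSpace M] [ChartedSpace H M]

/-- The derivative of the inverse of the preferred chart at `x₀`, as an endomorphism of the model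
space. -/
noncomputable def chartD (x₀ : M) (y : E) : E →L[ℝ] E :=
  mfderivWithin 𝓘(ℝ, E) I (extChartAt I x₀).symm (range I) y

variable {I} in
/-- A vector field, with values in the model space. -/
def modelField (X : Π x : M, TangentSpace I x) (x : M) : E := X x

variable {I} in
/-- A field of endomorphisms of the tangent spaces, with values in the endomorphisms of the model
space. -/
def modelEnd (φ : Π x : M, TangentSpace I x →L[ℝ] TangentSpace I x) (x : M) : E →L[ℝ] E := φ x

variable {I} in
/-- A `1`-form, with values in the dual of the model space. -/
def modelForm (α : Π x : M, TangentSpace I x →L[ℝ] ℝ) (x : M) : E →L[ℝ] ℝ := α x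

/-- The expression of a vector field in the preferred chart at `x₀`. -/
noncomputable def fieldHat (X : Π x : M, TangentSpace I x) (x₀ : M) (y : E) : E :=
  (chartD I x₀ y).inverse (modelField X ((extChartAt I x₀).symm y))

/-- The expression of a field of endomorphisms in the preferred chart at `x₀`. -/
noncomputable def endHat (φ : Π x : M, TangentSpace I x →L[ℝ] TangentSpace I x) (x₀ : M) (y : E) :
    E →L[ℝ] E :=
  (chartD I x₀ y).inverse ∘L modelEnd φ ((extChartAt I x₀).symm y) ∘L chartD I x₀ y

/-- The expression of a `1`-form in the preferred chart at `x₀`. -/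
noncomputable def formHat (α : Π x : M, TangentSpace I x →L[ℝ] ℝ) (x₀ : M) (y : E) : E →L[ℝ] ℝ :=
  modelForm α ((extChartAt I x₀).symm y) ∘L chartD I x₀ y

variable {I}

section Basic
variable [IsManifold I 1 M] {x₀ : M} {y : E}

theorem chartD_comp_inverse (hy : y ∈ (extChartAt I x₀).target) (v : E) :
    chartD I x₀ y ((chartD I x₀ y).inverse v) = v := by
  obtain ⟨e, he⟩ := isInvertible_mfderivWithin_extChartAt_symm hy
  have : chartD I x₀ y = (show E ≃L[ℝ] E from e) := he.symm
  rw [this, ContinuousLinearMap.inverse_equiv]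
  exact (show E ≃L[ℝ] E from e).apply_symm_apply v

theorem inverse_comp_chartD (hy : y ∈ (extChartAt I x₀).target) (v : E) :
    (chartD I x₀ y).inverse (chartD I x₀ y v) = v := by
  obtain ⟨e, he⟩ := isInvertible_mfderivWithin_extChartAt_symm hy
  have : chartD I x₀ y = (show E ≃L[ℝ] E from e) := he.symm
  rw [this, ContinuousLinearMap.inverse_equiv]
  exact (show E ≃L[ℝ] E from e).symm_apply_apply v

theorem chartD_self (x₀ : M) : chartD I x₀ (extChartAt I x₀ x₀) = ContinuousLinearMap.id ℝ E :=
  mfderivWithin_range_extChartAt_symm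

theorem chartD_inverse_eq (hy : y ∈ (extChartAt I x₀).target) :
    (chartD I x₀ y).inverse = mfderiv I 𝓘(ℝ, E) (extChartAt I x₀) ((extChartAt I x₀).symm y) :=
  ContinuousLinearMap.inverse_eq (mfderivWithin_extChartAt_symm_comp_mfderiv_extChartAt hy)
    (mfderiv_extChartAt_comp_mfderivWithin_extChartAt_symm hy)

theorem fieldHat_self (X : Π x : M, TangentSpace I x) (x₀ : M) :
    fieldHat I X x₀ (extChartAt I x₀ x₀) = modelField X x₀ := by
  rw [fieldHat, chartD_self, ContinuousLinearMap.inverse_id, extChartAt_to_inv]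
  rfl

theorem endHat_self (φ : Π x : M, TangentSpace I x →L[ℝ] TangentSpace I x) (x₀ : M) (u : E) :
    endHat I φ x₀ (extChartAt I x₀ x₀) u = modelEnd φ x₀ u := by
  rw [endHat, chartD_self, ContinuousLinearMap.inverse_id, extChartAt_to_inv]
  rfl

theorem formHat_self (α : Π x : M, TangentSpace I x →L[ℝ] ℝ) (x₀ : M) (u : E) :
    formHat I α x₀ (extChartAt I x₀ x₀) u = modelForm α x₀ u := by
  rw [formHat, chartD_self, extChartAt_to_inv]
  rfl

theorem fieldHat_apply_end (φ : Π x : M, TangentSpace I x →L[ℝ] TangentSpace I x)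
    (X : Π x : M, TangentSpace I x) (hy : y ∈ (extChartAt I x₀).target) :
    fieldHat I (fun x => φ x (X x)) x₀ y = endHat I φ x₀ y (fieldHat I X x₀ y) := by
  simp only [fieldHat, endHat, ContinuousLinearMap.comp_apply, chartD_comp_inverse hy]
  rfl

theorem formHat_fieldHat (α : Π x : M, TangentSpace I x →L[ℝ] ℝ)
    (X : Π x : M, TangentSpace I x) (hy : y ∈ (extChartAt I x₀).target) :
    formHat I α x₀ y (fieldHat I X x₀ y)
      = modelForm α ((extChartAt I x₀).symm y) (modelField X ((extChartAt I x₀).symm y)) := by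
  simp only [fieldHat, formHat, ContinuousLinearMap.comp_apply, chartD_comp_inverse hy]

end Basic

section Smooth
variable [IsManifold I ∞ M] (x₀ : M)

/-- The trivialization of the tangent bundle at x₀ is the derivative of the chart, so the chart
expression is the section read in that trivialization. The same identification serves endomorphisms
and forms. -/
theorem contDiffOn_fieldHat {X : Π x : M, TangentSpace I x} (hX : IsSmoothVectorField I X) :
    ContDiffOn ℝ ∞ (fieldHat I X x₀) (extChartAt I x₀).target := by
  have : IsManifold I 1 M := .of_le (n := ∞) (by norm_num)
  have h1 := (Trivialization.contMDiffOn_section_baseSet_iff (IB := I) (n := ∞) (s := X)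
    (trivializationAt E (TangentSpace I) x₀)).1 hX.contMDiffOn
  have h2 := h1.comp (contMDiffOn_extChartAt_symm x₀) (fun y hy => by
    have := (extChartAt I x₀).map_target hy
    simpa using this)
  refine (contMDiffOn_iff_contDiffOn.1 h2).congr fun y hy => ?_
  have h3 : (extChartAt I x₀).symm y ∈ (chartAt H x₀).source := by
    simpa using (extChartAt I x₀).map_target hy
  have h4 := TangentBundle.continuousLinearMapAt_trivializationAt (I := I) h3
  rw [fieldHat, chartD_inverse_eq hy, ← h4]
  exact congrFun (Trivialization.coe_linearMapAt_of_mem (R := ℝ)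
    (trivializationAt E (TangentSpace I) x₀) (by simpa using h3)) _

theorem contDiffOn_endHat {φ : Π x : M, TangentSpace I x →L[ℝ] TangentSpace I x}
    (hφ : IsSmoothEndomorphism I φ) :
    ContDiffOn ℝ ∞ (endHat I φ x₀) (extChartAt I x₀).target := by
  have : IsManifold I 1 M := .of_le (n := ∞) (by norm_num)
  have h1 := (Trivialization.contMDiffOn_section_baseSet_iff (IB := I) (n := ∞) (s := φ)
    (trivializationAt (E →L[ℝ] E) (fun x : M => TangentSpace I x →L[ℝ] TangentSpace I x) x₀)).1
      hφ.contMDiffOn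
  have h2 := h1.comp (contMDiffOn_extChartAt_symm x₀) (fun y hy => by
    have := (extChartAt I x₀).map_target hy
    simpa using this)
  refine (contMDiffOn_iff_contDiffOn.1 h2).congr fun y hy => ?_
  have h3 : (extChartAt I x₀).symm y ∈ (chartAt H x₀).source := by
    simpa using (extChartAt I x₀).map_target hy
  have h4 := TangentBundle.continuousLinearMapAt_trivializationAt (I := I) h3
  have h5 := TangentBundle.symmL_trivializationAt (I := I) h3
  rw [(extChartAt I x₀).right_inv hy] at h5
  rw [endHat, chartD_inverse_eq hy, ← h4, chartD, ← h5]
  rfl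

theorem contDiffOn_formHat {α : Π x : M, TangentSpace I x →L[ℝ] ℝ} (hα : IsSmoothOneForm I α) :
    ContDiffOn ℝ ∞ (formHat I α x₀) (extChartAt I x₀).target := by
  have : IsManifold I 1 M := .of_le (n := ∞) (by norm_num)
  have h1 := (Trivialization.contMDiffOn_section_baseSet_iff (IB := I) (n := ∞) (s := α)
    (trivializationAt (E →L[ℝ] ℝ) (fun x : M => TangentSpace I x →L[ℝ] Bundle.Trivial M ℝ x) x₀)).1
      hα.contMDiffOn
  have h2 := h1.comp (contMDiffOn_extChartAt_symm x₀) (fun y hy => by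
    have := (extChartAt I x₀).map_target hy
    simpa using this)
  refine (contMDiffOn_iff_contDiffOn.1 h2).congr fun y hy => ?_
  have h3 : (extChartAt I x₀).symm y ∈ (chartAt H x₀).source := by
    simpa using (extChartAt I x₀).map_target hy
  have h5 := TangentBundle.symmL_trivializationAt (I := I) h3
  rw [(extChartAt I x₀).right_inv hy] at h5
  rw [formHat, chartD, ← h5]
  ext v
  simp [hom_trivializationAt_apply, ContinuousLinearMap.inCoordinates]
  rfl

end Smooth

section Bracket
variable [IsManifold I 1 M] [I.Boundaryless] {x₀ : M}

/-- At the centre of the chart the frame change is the identity, so the bracket is the flat one of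
the chart expressions. -/
theorem mlieBracket_eq_hat (X Y : Π x : M, TangentSpace I x) :
    modelField (VectorField.mlieBracket I X Y) x₀
      = fderiv ℝ (fieldHat I Y x₀) (extChartAt I x₀ x₀) (modelField X x₀)
        - fderiv ℝ (fieldHat I X x₀) (extChartAt I x₀ x₀) (modelField Y x₀) := by
  rw [modelField, VectorField.mlieBracket, VectorField.mlieBracketWithin_apply,
    mfderiv_extChartAt_self]
  have h := VectorField.lieBracketWithin_univ (𝕜 := ℝ) (V := fieldHat I X x₀)
    (W := fieldHat I Y x₀)
  have h2 : (extChartAt I x₀).symm ⁻¹' univ ∩ range I = univ := by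
    rw [preimage_univ, univ_inter, I.range_eq_univ]
  rw [h2]
  change (ContinuousLinearMap.id ℝ E).inverse
    (VectorField.lieBracketWithin ℝ (fieldHat I X x₀) (fieldHat I Y x₀) univ _) = _
  rw [ContinuousLinearMap.inverse_id, h, VectorField.lieBracket, fieldHat_self, fieldHat_self]
  rfl

theorem fderiv_fieldHat_apply_end (φ : Π x : M, TangentSpace I x →L[ℝ] TangentSpace I x)
    (X : Π x : M, TangentSpace I x)
    (hφ : DifferentiableAt ℝ (endHat I φ x₀) (extChartAt I x₀ x₀))
    (hX : DifferentiableAt ℝ (fieldHat I X x₀) (extChartAt I x₀ x₀)) (w : E) :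
    fderiv ℝ (fieldHat I (fun x => φ x (X x)) x₀) (extChartAt I x₀ x₀) w
      = fderiv ℝ (endHat I φ x₀) (extChartAt I x₀ x₀) w (modelField X x₀)
        + modelEnd φ x₀ (fderiv ℝ (fieldHat I X x₀) (extChartAt I x₀ x₀) w) := by
  have h := fderiv_clm_apply_eq_of_eventuallyEq (g := fieldHat I (fun x => φ x (X x)) x₀) hφ hX
    (by filter_upwards [extChartAt_target_mem_nhds (I := I) x₀] with y hy
        exact (fieldHat_apply_end φ X hy).symm) w
  rw [← h, fieldHat_self, endHat_self]

/-- Derivatives of the vector fields cancel: the torsion is tensorial and depends only on the values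
of X and Y. -/
theorem nijenhuis_eq_nij (φ : Π x : M, TangentSpace I x →L[ℝ] TangentSpace I x)
    (X Y : Π x : M, TangentSpace I x)
    (hφ : DifferentiableAt ℝ (endHat I φ x₀) (extChartAt I x₀ x₀))
    (hX : DifferentiableAt ℝ (fieldHat I X x₀) (extChartAt I x₀ x₀))
    (hY : DifferentiableAt ℝ (fieldHat I Y x₀) (extChartAt I x₀ x₀)) :
    modelField (nijenhuis I φ X Y) x₀
      = nij (endHat I φ x₀) (extChartAt I x₀ x₀) (modelField X x₀) (modelField Y x₀) := by
  have e : modelField (nijenhuis I φ X Y) x₀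
      = modelEnd φ x₀ (modelEnd φ x₀ (modelField (VectorField.mlieBracket I X Y) x₀))
        + modelField (VectorField.mlieBracket I (fun x => φ x (X x)) (fun x => φ x (Y x))) x₀
        - modelEnd φ x₀ (modelField (VectorField.mlieBracket I (fun x => φ x (X x)) Y) x₀)
        - modelEnd φ x₀ (modelField (VectorField.mlieBracket I X (fun x => φ x (Y x))) x₀) := rfl
  have eX : modelField (fun x => φ x (X x)) x₀ = modelEnd φ x₀ (modelField X x₀) := rfl
  have eY : modelField (fun x => φ x (Y x)) x₀ = modelEnd φ x₀ (modelField Y x₀) := rfl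
  rw [e, mlieBracket_eq_hat, mlieBracket_eq_hat, mlieBracket_eq_hat, mlieBracket_eq_hat, eX, eY,
    fderiv_fieldHat_apply_end φ X hφ hX, fderiv_fieldHat_apply_end φ X hφ hX,
    fderiv_fieldHat_apply_end φ Y hφ hY, fderiv_fieldHat_apply_end φ Y hφ hY, nij]
  simp only [endHat_self, map_sub, map_add]
  abel

theorem lieDerivative_eq_lieEnd (φ : Π x : M, TangentSpace I x →L[ℝ] TangentSpace I x)
    (Z X : Π x : M, TangentSpace I x)
    (hφ : DifferentiableAt ℝ (endHat I φ x₀) (extChartAt I x₀ x₀))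
    (hX : DifferentiableAt ℝ (fieldHat I X x₀) (extChartAt I x₀ x₀)) :
    modelField (lieDerivative I Z φ X) x₀
      = lieEnd (fieldHat I Z x₀) (endHat I φ x₀) (extChartAt I x₀ x₀) (modelField X x₀) := by
  have e : modelField (lieDerivative I Z φ X) x₀
      = modelField (VectorField.mlieBracket I Z (fun x => φ x (X x))) x₀
        - modelEnd φ x₀ (modelField (VectorField.mlieBracket I Z X) x₀) := rfl
  have eX : modelField (fun x => φ x (X x)) x₀ = modelEnd φ x₀ (modelField X x₀) := rfl
  rw [e, mlieBracket_eq_hat, mlieBracket_eq_hat, eX, fderiv_fieldHat_apply_end φ X hφ hX, lieEnd,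
    fieldHat_self]
  simp only [endHat_self, map_sub]
  abel

theorem extDer_eq_dform (α : Π x : M, TangentSpace I x →L[ℝ] ℝ)
    (hα : DifferentiableAt ℝ (formHat I α x₀) (extChartAt I x₀ x₀)) (u v : E) :
    extDer I α x₀ (![u, v] : Fin 2 → E) = dform (formHat I α x₀) (extChartAt I x₀ x₀) u v := by
  have h2 : DifferentiableAt ℝ (chartForm I α x₀) (extChartAt I x₀ x₀) :=
    (ContinuousAlternatingMap.ofSubsingletonLIE (𝕜 := ℝ) (E := E) (F := ℝ)
      (0 : Fin 1)).toContinuousLinearEquiv.differentiableAt.comp (extChartAt I x₀ x₀) hα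
  have h3 : ∀ a b : E, fderiv ℝ (fun y => chartForm I α x₀ y ![a]) (extChartAt I x₀ x₀) b
      = fderiv ℝ (formHat I α x₀) (extChartAt I x₀ x₀) b a := fun a b => by
    rw [fderiv_apply_eq hα]
    rfl
  rw [extDer, mfderiv_extChartAt_self, I.range_eq_univ, extDerivWithin_univ]
  change extDeriv (chartForm I α x₀) (extChartAt I x₀ x₀) ![u, v] = _
  rw [extDeriv_apply h2, Fin.sum_univ_two]
  have e0 : Fin.removeNth 0 ![u, v] = ![v] := by
    ext i; fin_cases i; rfl
  have e1 : Fin.removeNth 1 ![u, v] = ![u] := by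
    ext i; fin_cases i; rfl
  rw [e0, e1, h3, h3, dform]
  simp [sub_eq_add_neg]

theorem mem_charDistribution_iff (α : Π x : M, TangentSpace I x →L[ℝ] ℝ)
    (hα : DifferentiableAt ℝ (formHat I α x₀) (extChartAt I x₀ x₀)) (u : E) :
    u ∈ charDistribution I α x₀ ↔ u ∈ localChar (formHat I α x₀) (extChartAt I x₀ x₀) := by
  rw [mem_localChar, formHat_self, charDistribution]
  exact and_congr Iff.rfl ((mem_ker_curryLeft_iff _ _).trans
    (forall_congr' fun w => Iff.of_eq (congrArg (· = 0) (extDer_eq_dform α hα u w))))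

end Bracket
end Charts

/-! ### Maps, changes of chart, extension of local fields, and charts of the product with the line.
-/

section LocalRepresentatives
open Filter Topology Set Bundle

variable {E : Type*} [NormedAddCommGroup E] [NormedSpace ℝ E]
  {H : Type*} [TopologicalSpace H] {I : ModelWithCorners ℝ E H}
  {M : Type*} [TopologicalSpace M] [ChartedSpace H M]
  {E' : Type*} [NormedAddCommGroup E'] [NormedSpace ℝ E']
  {H' : Type*} [TopologicalSpace H'] {I' : ModelWithCorners ℝ E' H'}
  {L : Type*} [TopologicalSpace L] [ChartedSpace H' L]

variable (I I') in
/-- The derivative of a map between manifolds, as a map between the model spaces. -/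
noncomputable def modelDeriv (f : L → M) (p : L) : E' →L[ℝ] E := mfderiv I' I f p

variable (I I') in
/-- The expression of a map in the preferred charts at `p` and `q`. -/
noncomputable def mapHat (f : L → M) (p : L) (q : M) (z : E') : E :=
  extChartAt I q (f ((extChartAt I' p).symm z))

theorem hasMFDerivAt_extChartAt_symm [I.Boundaryless] [IsManifold I 1 M] {q : M} {y : E}
    (hy : y ∈ (extChartAt I q).target) :
    HasMFDerivAt 𝓘(ℝ, E) I (extChartAt I q).symm y (chartD (E := E) I q y) := by
  have h := (mdifferentiableWithinAt_extChartAt_symm hy).hasMFDerivWithinAt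
  rw [I.range_eq_univ, hasMFDerivWithinAt_univ] at h
  have e : chartD I q y = mfderivWithin 𝓘(ℝ, E) I (extChartAt I q).symm univ y := by
    rw [chartD, I.range_eq_univ]
  rw [e]
  exact h

theorem chartD_mapHat [I.Boundaryless] [I'.Boundaryless] [IsManifold I 1 M] [IsManifold I' 1 L]
    {f : L → M} {p : L} {q : M} {z : E'} (hz : z ∈ (extChartAt I' p).target)
    (hfz : f ((extChartAt I' p).symm z) ∈ (extChartAt I q).source)
    (hf : MDifferentiableAt I' I f ((extChartAt I' p).symm z)) (u : E') :
    chartD I q (mapHat I I' f p q z) (fderiv ℝ (mapHat I I' f p q) z u)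
      = modelDeriv I I' f ((extChartAt I' p).symm z) (chartD I' p z u) := by
  have h2 := hf.hasMFDerivAt
  have h3 := (mdifferentiableAt_extChartAt (I := I) (x := q)
    (by simpa using hfz)).hasMFDerivAt
  have h4 := (h3.comp _ h2).comp z (hasMFDerivAt_extChartAt_symm hz)
  have h5 := mfderiv_eq_fderiv (𝕜 := ℝ) (f := mapHat I I' f p q) (x := z)
  have h6 := mfderivWithin_extChartAt_symm_comp_mfderiv_extChartAt' hfz
  rw [← h5]
  refine (congrArg (fun A : E' →L[ℝ] E => chartD I q (mapHat I I' f p q z) (A u))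
    h4.mfderiv).trans ?_
  exact congrArg (fun A : E →L[ℝ] E => A (modelDeriv I I' f ((extChartAt I' p).symm z)
    (chartD I' p z u))) h6

theorem contDiffAt_mapHat [I.Boundaryless] [I'.Boundaryless] [IsManifold I ∞ M] [IsManifold I' ∞ L]
    {f : L → M} {p : L} {q : M} {z : E'} (hz : z ∈ (extChartAt I' p).target)
    (hfz : f ((extChartAt I' p).symm z) ∈ (extChartAt I q).source)
    (hf : ContMDiffAt I' I ∞ f ((extChartAt I' p).symm z)) :
    ContDiffAt ℝ ∞ (mapHat I I' f p q) z := by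
  have h1 := (contMDiffOn_extChartAt_symm (I := I') (n := ∞) p).contMDiffAt
    ((isOpen_extChartAt_target p).mem_nhds hz)
  have h3 := contMDiffAt_extChartAt' (I := I) (n := ∞) (x := q) (by simpa using hfz)
  exact ((h3.comp _ hf).comp z h1).contDiffAt

theorem eventually_mem_target_mapHat [I'.Boundaryless]
    {f : L → M} {p : L} {q : M} {z : E'} (hz : z ∈ (extChartAt I' p).target)
    (hfz : f ((extChartAt I' p).symm z) ∈ (extChartAt I q).source)
    (hf : Continuous f) : ∀ᶠ w in 𝓝 z, w ∈ (extChartAt I' p).target ∧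
      f ((extChartAt I' p).symm w) ∈ (extChartAt I q).source := by
  have h1 := (isOpen_extChartAt_target p).mem_nhds hz
  have h2 : ContinuousAt (fun w => f ((extChartAt I' p).symm w)) z :=
    hf.continuousAt.comp ((continuousOn_extChartAt_symm p).continuousAt h1)
  filter_upwards [h1, h2 ((isOpen_extChartAt_source q).mem_nhds hfz)] with w hw hw'
  exact ⟨hw, hw'⟩

/-- `charDistribution` is defined through the chart centred at each point. Away from the centre of
the chart at x₀, the two charts are compared by the transition map, under which dα pulls back. -/
theorem localChar_formHat_iff [I.Boundaryless] [IsManifold I ∞ M]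
    {α : Π x : M, TangentSpace I x →L[ℝ] ℝ} (hα : IsSmoothOneForm I α) {x₀ : M} {y : E}
    (hy : y ∈ (extChartAt I x₀).target) (u : E) :
    u ∈ localChar (formHat I α x₀) y ↔
      chartD I x₀ y u ∈ charDistribution I α ((extChartAt I x₀).symm y) := by
  have : IsManifold I 1 M := .of_le (n := ∞) (by norm_num)
  set x := (extChartAt I x₀).symm y with hx
  set g := mapHat I I (id : M → M) x₀ x with hg
  have hgy : g y = extChartAt I x x := rfl
  have hs : id ((extChartAt I x₀).symm y) ∈ (extChartAt I x).source := mem_extChartAt_source x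
  have hev := eventually_mem_target_mapHat hy hs continuous_id
  have hD : ∀ᶠ w in 𝓝 y, ∀ v, chartD I x (g w) (fderiv ℝ g w v) = chartD I x₀ w v := by
    filter_upwards [hev] with w hw v
    refine (chartD_mapHat hw.1 hw.2 mdifferentiableAt_id v).trans ?_
    rw [modelDeriv, mfderiv_id]
    rfl
  have hDy : ∀ v, fderiv ℝ g y v = chartD I x₀ y v := fun v => by
    rw [← hD.self_of_nhds v, hgy, chartD_self]
    rfl
  have hform : ∀ᶠ w in 𝓝 y, ∀ v, formHat I α x₀ w v = formHat I α x (g w) (fderiv ℝ g w v) := by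
    filter_upwards [hD, hev] with w hw hw' v
    have e : (extChartAt I x).symm (g w) = (extChartAt I x₀).symm w :=
      (extChartAt I x).left_inv hw'.2
    rw [formHat, formHat, ContinuousLinearMap.comp_apply, ContinuousLinearMap.comp_apply, hw, e]
  have hd : ∀ (z : M) (w : E), w ∈ (extChartAt I z).target →
      DifferentiableAt ℝ (formHat I α z) w := fun z w hw =>
    ((contDiffOn_formHat z hα).contDiffAt ((isOpen_extChartAt_target z).mem_nhds
      hw)).differentiableAt (by simp)
  have hdx : DifferentiableAt ℝ (formHat I α x) (g y) := hd x _ (mem_extChartAt_target x)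
  have hpull := dform_pullback (g := g) ((contDiffAt_mapHat hy hs contMDiffAt_id).of_le
    (by norm_cast)) (hd x₀ y hy) hdx hform
  rw [mem_charDistribution_iff α hdx, mem_localChar, mem_localChar, hform.self_of_nhds, hDy, hgy]
  refine and_congr Iff.rfl ⟨fun h w => ?_, fun h w => ?_⟩
  · have := h ((chartD I x₀ y).inverse w)
    rwa [hpull, hDy, hDy, chartD_comp_inverse hy] at this
  · rw [hpull, hDy, hDy]
    exact h _

/-- Multiply by a bump function. The last conclusion records that every value is a multiple of a
value of s, so the extension remains a section of any distribution that contains s. -/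
theorem exists_smooth_extension [FiniteDimensional ℝ E] [T2Space M] [I.Boundaryless]
    [IsManifold I ∞ M] (x₀ : M) {s : E → E} {V : Set E} (hV : IsOpen V)
    (hx₀ : extChartAt I x₀ x₀ ∈ V)
    (hs : ContDiffOn ℝ ∞ s V) :
    ∃ X : Π x : M, TangentSpace I x, IsSmoothVectorField I X ∧
      fieldHat I X x₀ =ᶠ[𝓝 (extChartAt I x₀ x₀)] s ∧
      ∀ x, ∃ c : ℝ, modelField X x = c • chartD I x₀ (extChartAt I x₀ x) (s (extChartAt I x₀ x)) ∧
        (c ≠ 0 → x ∈ (extChartAt I x₀).source ∧ extChartAt I x₀ x ∈ V) := by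
  have : IsManifold I 1 M := .of_le (n := ∞) (by norm_num)
  set c := extChartAt I x₀
  set W := c.source ∩ c ⁻¹' V with hW
  have hWo : IsOpen W := (continuousOn_extChartAt x₀).isOpen_inter_preimage
    (isOpen_extChartAt_source x₀) hV
  have hWx : x₀ ∈ W := ⟨mem_extChartAt_source x₀, hx₀⟩
  obtain ⟨f, -, hf⟩ := (SmoothBumpFunction.nhds_basis_tsupport (I := I) x₀).mem_iff.1
    (hWo.mem_nhds hWx)
  let S : Π x : M, TangentSpace I x := fun x => chartD I x₀ (c x) (s (c x))
  have hS : ContMDiffOn I I.tangent ∞ (fun x => (⟨x, S x⟩ : TangentBundle I M)) W := by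
    refine (Trivialization.contMDiffOn_section_iff (IB := I) (n := ∞) (s := S)
      (trivializationAt E (TangentSpace I) x₀) hWo (fun x hx => by simpa [c] using hx.1)).2 ?_
    have h1 : ContMDiffOn I 𝓘(ℝ, E) ∞ (s ∘ c) W := (contMDiffOn_iff_contDiffOn.2 hs).comp
      ((contMDiffOn_extChartAt (x := x₀)).mono fun x hx => by simpa [c] using hx.1) fun x hx => hx.2
    refine h1.congr fun x hx => ?_
    have h3 : x ∈ (chartAt H x₀).source := by simpa [c] using hx.1
    have h4 := TangentBundle.continuousLinearMapAt_trivializationAt (I := I) h3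
    have h5 := mfderiv_extChartAt_comp_mfderivWithin_extChartAt_symm' hx.1
    refine (congrFun (Trivialization.coe_linearMapAt_of_mem (R := ℝ)
      (trivializationAt E (TangentSpace I) x₀) (by simpa using h3)) _).symm.trans ?_
    refine (congrArg (fun A : E →L[ℝ] E => A (chartD I x₀ (c x) (s (c x)))) h4).trans ?_
    exact congrArg (fun A : E →L[ℝ] E => A (s (c x))) h5
  refine ⟨fun x => f x • S x, ?_, ?_, ?_⟩
  · exact ContMDiffOn.smul_section_of_tsupport (ψ := f) f.contMDiff.contMDiffOn hWo hf hS
  · have h1 : ∀ᶠ y in 𝓝 (c x₀), f (c.symm y) = 1 := by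
      have h2 : ContinuousAt c.symm (c x₀) := continuousAt_extChartAt_symm x₀
      have h3 : ∀ᶠ x in 𝓝 (c.symm (c x₀)), f x = 1 := by
        rw [extChartAt_to_inv]
        exact f.eventuallyEq_one
      exact h2.eventually h3
    filter_upwards [h1, extChartAt_target_mem_nhds (I := I) x₀] with y hy hyt
    have e : modelField (fun x => f x • S x) (c.symm y)
        = f (c.symm y) • chartD I x₀ (c (c.symm y)) (s (c (c.symm y))) := rfl
    rw [fieldHat, e, hy, one_smul, c.right_inv hyt, inverse_comp_chartD hyt]
  · refine fun x => ⟨f x, rfl, fun h => ?_⟩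
    exact hf (subset_closure h)

theorem extChartAt_prod_real (q : M × ℝ) :
    extChartAt (I.prod 𝓘(ℝ, ℝ)) q = (extChartAt I q.1).prod (PartialEquiv.refl ℝ) := by
  rw [extChartAt_prod, extChartAt_model_space_eq_id]

theorem chartD_prod_real [I.Boundaryless] [IsManifold I 1 M] (q : M × ℝ) {y : E} (t : ℝ)
    (hy : y ∈ (extChartAt I q.1).target) (U : E × ℝ) :
    chartD (I.prod 𝓘(ℝ, ℝ)) q (y, t) U = (chartD I q.1 y U.1, U.2) := by
  have h1 := hasMFDerivAt_extChartAt_symm hy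
  have h2 : HasMFDerivAt 𝓘(ℝ, ℝ) 𝓘(ℝ, ℝ) (id : ℝ → ℝ) t (ContinuousLinearMap.id ℝ ℝ) :=
    hasMFDerivAt_id t
  have h3 := HasMFDerivAt.prodMap (p := (y, t)) h1 h2
  have e : ((extChartAt (I.prod 𝓘(ℝ, ℝ)) q).symm : E × ℝ → M × ℝ)
      = Prod.map (extChartAt I q.1).symm id := by
    rw [extChartAt_prod_real]
    rfl
  rw [← e] at h3
  have h4 := h3.mfderiv
  rw [h1.mfderiv, h2.mfderiv] at h4
  have e2 : chartD (I.prod 𝓘(ℝ, ℝ)) q (y, t)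
      = mfderiv 𝓘(ℝ, E × ℝ) (I.prod 𝓘(ℝ, ℝ)) (extChartAt (I.prod 𝓘(ℝ, ℝ)) q).symm (y, t) := by
    rw [chartD, ModelWithCorners.range_eq_univ, mfderivWithin_univ]
  rw [e2, modelWithCornersSelf_prod, ← chartedSpaceSelf_prod]
  exact congrArg (fun A : E × ℝ →L[ℝ] E × ℝ => A U) h4

theorem modelEnd_coneStructure (α : Π x : M, TangentSpace I x →L[ℝ] ℝ)
    (Z : Π x : M, TangentSpace I x) (φ : Π x : M, TangentSpace I x →L[ℝ] TangentSpace I x)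
    (q : M × ℝ) (U : E × ℝ) :
    modelEnd (coneStructure I α Z φ) q U
      = (modelEnd φ q.1 U.1 - U.2 • modelField Z q.1, modelForm α q.1 U.1) := rfl

theorem endHat_coneStructure [I.Boundaryless] [IsManifold I 1 M]
    (α : Π x : M, TangentSpace I x →L[ℝ] ℝ)
    (Z : Π x : M, TangentSpace I x) (φ : Π x : M, TangentSpace I x →L[ℝ] TangentSpace I x)
    (q : M × ℝ) {w : E × ℝ} (hw : w.1 ∈ (extChartAt I q.1).target) :
    endHat (I.prod 𝓘(ℝ, ℝ)) (coneStructure I α Z φ) q w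
      = localCone (endHat I φ q.1) (formHat I α q.1) (fieldHat I Z q.1) w := by
  have hw' : w ∈ (extChartAt (I.prod 𝓘(ℝ, ℝ)) q).target := by
    rw [extChartAt_prod_real]
    exact ⟨hw, mem_univ _⟩
  have e : (extChartAt (I.prod 𝓘(ℝ, ℝ)) q).symm w = ((extChartAt I q.1).symm w.1, w.2) := by
    rw [extChartAt_prod_real]
    rfl
  refine ContinuousLinearMap.ext fun U => ?_
  have h1 := chartD_prod_real q w.2 hw
  have h2 := chartD_comp_inverse hw' (modelEnd (coneStructure I α Z φ)
    ((extChartAt I q.1).symm w.1, w.2) (chartD (I.prod 𝓘(ℝ, ℝ)) q w U))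
  rw [h1, modelEnd_coneStructure, h1] at h2
  have h3 := congrArg Prod.fst h2
  have h4 := congrArg Prod.snd h2
  simp only at h3 h4
  rw [endHat, e, ContinuousLinearMap.comp_apply, ContinuousLinearMap.comp_apply, localCone_apply]
  rw [modelEnd_coneStructure, h1]
  refine Prod.ext ?_ h4
  have h5 := congrArg (chartD I q.1 w.1).inverse h3
  rw [inverse_comp_chartD hw] at h5
  refine h5.trans ?_
  simp only [map_sub, map_smul]
  rfl

end LocalRepresentatives

/-! ### Conditions on vector fields as pointwise conditions in charts. -/

section Pointwise
open Filter Topology Set Bundle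

variable {E : Type*} [NormedAddCommGroup E] [NormedSpace ℝ E]

theorem nij_congr {Φ Ψ : E → E →L[ℝ] E} {y : E} (h : Φ =ᶠ[𝓝 y] Ψ) (u v : E) :
    nij Φ y u v = nij Ψ y u v := by
  rw [nij, nij, h.fderiv_eq, h.self_of_nhds]

variable {H : Type*} [TopologicalSpace H] {I : ModelWithCorners ℝ E H} [I.Boundaryless]
  {M : Type*} [TopologicalSpace M] [ChartedSpace H M]

theorem differentiableAt_of_contDiffOn_target {F : Type*} [NormedAddCommGroup F] [NormedSpace ℝ F]
    {x₀ : M} {f : E → F} (hf : ContDiffOn ℝ ∞ f (extChartAt I x₀).target) {y : E}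
    (hy : y ∈ (extChartAt I x₀).target) : DifferentiableAt ℝ f y :=
  (hf.contDiffAt ((isOpen_extChartAt_target x₀).mem_nhds hy)).differentiableAt (by simp)

variable [IsManifold I ∞ M]

theorem differentiableAt_fieldHat {X : Π x : M, TangentSpace I x} (hX : IsSmoothVectorField I X)
    (x₀ : M) : DifferentiableAt ℝ (fieldHat I X x₀) (extChartAt I x₀ x₀) :=
  differentiableAt_of_contDiffOn_target (contDiffOn_fieldHat x₀ hX) (mem_extChartAt_target x₀)

theorem differentiableAt_endHat {φ : Π x : M, TangentSpace I x →L[ℝ] TangentSpace I x}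
    (hφ : IsSmoothEndomorphism I φ) (x₀ : M) :
    DifferentiableAt ℝ (endHat I φ x₀) (extChartAt I x₀ x₀) :=
  differentiableAt_of_contDiffOn_target (contDiffOn_endHat x₀ hφ) (mem_extChartAt_target x₀)

theorem differentiableAt_formHat {α : Π x : M, TangentSpace I x →L[ℝ] ℝ}
    (hα : IsSmoothOneForm I α) (x₀ : M) :
    DifferentiableAt ℝ (formHat I α x₀) (extChartAt I x₀ x₀) :=
  differentiableAt_of_contDiffOn_target (contDiffOn_formHat x₀ hα) (mem_extChartAt_target x₀)

variable [FiniteDimensional ℝ E]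

/-- Vanishing of the torsion on sections of two distributions, evaluated on vectors that extend to
smooth sections. -/
theorem nij_eq_zero_of_nijenhuis [T2Space M]
    {φ : Π x : M, TangentSpace I x →L[ℝ] TangentSpace I x} {x₀ : M}
    (hφ : DifferentiableAt ℝ (endHat I φ x₀) (extChartAt I x₀ x₀))
    {F G : Π x : M, Submodule ℝ (TangentSpace I x)}
    (h : ∀ X Y : Π x : M, TangentSpace I x, IsSmoothVectorField I X → IsSmoothVectorField I Y →
      (∀ x, X x ∈ F x) → (∀ x, Y x ∈ G x) → ∀ x, nijenhuis I φ X Y x = 0)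
    {V : Set E} (hV : IsOpen V) (hx₀ : extChartAt I x₀ x₀ ∈ V) {s t : E → E}
    (hs : ContDiffOn ℝ ∞ s V) (ht : ContDiffOn ℝ ∞ t V)
    (hsF : ∀ y ∈ V, y ∈ (extChartAt I x₀).target →
      chartD I x₀ y (s y) ∈ F ((extChartAt I x₀).symm y))
    (htG : ∀ y ∈ V, y ∈ (extChartAt I x₀).target →
      chartD I x₀ y (t y) ∈ G ((extChartAt I x₀).symm y)) :
    nij (endHat I φ x₀) (extChartAt I x₀ x₀) (s (extChartAt I x₀ x₀))
      (t (extChartAt I x₀ x₀)) = 0 := by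
  have : IsManifold I 1 M := .of_le (n := ∞) (by norm_num)
  have aux : ∀ {F : Π x : M, Submodule ℝ (TangentSpace I x)} {s : E → E},
      (∀ y ∈ V, y ∈ (extChartAt I x₀).target →
        chartD I x₀ y (s y) ∈ F ((extChartAt I x₀).symm y)) → ∀ {X : Π x : M, TangentSpace I x},
      (∀ x, ∃ c : ℝ, modelField X x = c • chartD I x₀ (extChartAt I x₀ x) (s (extChartAt I x₀ x)) ∧
        (c ≠ 0 → x ∈ (extChartAt I x₀).source ∧ extChartAt I x₀ x ∈ V)) → ∀ x, X x ∈ F x := by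
    intro F s hs X hX x
    obtain ⟨c, hc, hc'⟩ := hX x
    by_cases h0 : c = 0
    · rw [h0, zero_smul] at hc
      have : X x = 0 := hc
      rw [this]
      exact zero_mem _
    · obtain ⟨h1, h2⟩ := hc' h0
      have h3 := hs _ h2 ((extChartAt I x₀).map_source h1)
      rw [(extChartAt I x₀).left_inv h1] at h3
      have h4 : X x = c • (chartD I x₀ (extChartAt I x₀ x) (s (extChartAt I x₀ x)) :
        TangentSpace I x) := hc
      rw [h4]
      exact (F x).smul_mem c h3
  obtain ⟨X, hX, hXs, hX'⟩ := exists_smooth_extension x₀ hV hx₀ hs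
  obtain ⟨Y, hY, hYs, hY'⟩ := exists_smooth_extension x₀ hV hx₀ ht
  have h1 := nijenhuis_eq_nij φ X Y hφ (differentiableAt_fieldHat hX x₀)
    (differentiableAt_fieldHat hY x₀)
  rw [← fieldHat_self X, ← fieldHat_self Y, hXs.self_of_nhds, hYs.self_of_nhds] at h1
  rw [← h1]
  exact h X Y hX hY (aux hsF hX') (aux htG hY') x₀

/-- Fields constant in a chart extend globally and reach every pair of vectors. Only
differentiability at the centres is required, which is also all that is established for structures
restricted to leaves. -/
theorem isIntegrable_iff [T2Space M] {φ : Π x : M, TangentSpace I x →L[ℝ] TangentSpace I x}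
    (hφ : ∀ x₀, DifferentiableAt ℝ (endHat I φ x₀) (extChartAt I x₀ x₀)) :
    IsIntegrable I φ ↔ ∀ x₀ u v, nij (endHat I φ x₀) (extChartAt I x₀ x₀) u v = 0 := by
  have : IsManifold I 1 M := .of_le (n := ∞) (by norm_num)
  refine ⟨fun h x₀ u v => ?_, fun h X Y hX hY x => ?_⟩
  · exact nij_eq_zero_of_nijenhuis (hφ x₀) (F := fun x => (⊤ : Submodule ℝ (TangentSpace I x)))
      (G := fun x => (⊤ : Submodule ℝ (TangentSpace I x)))
      (fun X Y hX hY _ _ => h X Y hX hY) isOpen_univ (mem_univ _)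
      (s := fun _ => u) (t := fun _ => v) contDiffOn_const contDiffOn_const
      (fun _ _ _ => trivial) (fun _ _ _ => trivial)
  · exact (nijenhuis_eq_nij φ X Y (hφ x) (differentiableAt_fieldHat hX x)
      (differentiableAt_fieldHat hY x)).trans (h x _ _)

theorem lieDerivativeVanishes_iff [T2Space M]
    {φ : Π x : M, TangentSpace I x →L[ℝ] TangentSpace I x} (hφ : IsSmoothEndomorphism I φ)
    (Z : Π x : M, TangentSpace I x) :
    LieDerivativeVanishes I Z φ ↔
      ∀ x₀ u, lieEnd (fieldHat I Z x₀) (endHat I φ x₀) (extChartAt I x₀ x₀) u = 0 := by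
  have : IsManifold I 1 M := .of_le (n := ∞) (by norm_num)
  refine ⟨fun h x₀ u => ?_, fun h X hX x => ?_⟩
  · obtain ⟨X, hX, hXs, -⟩ := exists_smooth_extension (I := I) x₀ isOpen_univ (mem_univ _)
      (s := fun _ => u) contDiffOn_const
    have h1 := lieDerivative_eq_lieEnd φ Z X (differentiableAt_endHat hφ x₀)
      (differentiableAt_fieldHat hX x₀)
    rw [← fieldHat_self X, hXs.self_of_nhds] at h1
    rw [← h1]
    exact h X hX x₀
  · exact (lieDerivative_eq_lieEnd φ Z X (differentiableAt_endHat hφ x)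
      (differentiableAt_fieldHat hX x)).trans (h x _)

theorem isNormalAlmostContact_iff [T2Space M] {α : Π x : M, TangentSpace I x →L[ℝ] ℝ}
    {Z : Π x : M, TangentSpace I x} {φ : Π x : M, TangentSpace I x →L[ℝ] TangentSpace I x}
    (hα : ∀ x₀, DifferentiableAt ℝ (formHat I α x₀) (extChartAt I x₀ x₀))
    (hZ : ∀ x₀, DifferentiableAt ℝ (fieldHat I Z x₀) (extChartAt I x₀ x₀))
    (hφ : ∀ x₀, DifferentiableAt ℝ (endHat I φ x₀) (extChartAt I x₀ x₀)) :
    IsNormalAlmostContact I α Z φ ↔ ∀ x₀ t U V,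
      nij (localCone (endHat I φ x₀) (formHat I α x₀) (fieldHat I Z x₀))
        (extChartAt I x₀ x₀, t) U V = 0 := by
  have : IsManifold I 1 M := .of_le (n := ∞) (by norm_num)
  have e : ∀ (x₀ : M) (t : ℝ), extChartAt (I.prod 𝓘(ℝ, ℝ)) (x₀, t) (x₀, t)
      = (extChartAt I x₀ x₀, t) := fun x₀ t => by
    rw [extChartAt_prod_real]
    rfl
  have hc : ∀ (x₀ : M) (t : ℝ), endHat (I.prod 𝓘(ℝ, ℝ)) (coneStructure I α Z φ) (x₀, t)
      =ᶠ[𝓝 (extChartAt I x₀ x₀, t)]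
        localCone (endHat I φ x₀) (formHat I α x₀) (fieldHat I Z x₀) := fun x₀ t => by
    have h1 : ∀ᶠ w : E × ℝ in 𝓝 (extChartAt I x₀ x₀, t), w.1 ∈ (extChartAt I x₀).target :=
      continuous_fst.continuousAt.eventually (extChartAt_target_mem_nhds (I := I) x₀)
    filter_upwards [h1] with w hw
    exact endHat_coneStructure α Z φ (x₀, t) hw
  have hd : ∀ q : M × ℝ, DifferentiableAt ℝ (endHat (I.prod 𝓘(ℝ, ℝ)) (coneStructure I α Z φ) q)
      (extChartAt (I.prod 𝓘(ℝ, ℝ)) q q) := fun ⟨x₀, t⟩ => by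
    rw [e, (hc x₀ t).differentiableAt_iff]
    exact differentiableAt_localCone (hφ x₀) (hα x₀) (hZ x₀) t
  rw [IsNormalAlmostContact, isIntegrable_iff hd]
  refine ⟨fun h x₀ t U V => ?_, fun h q U V => ?_⟩
  · rw [← nij_congr (hc x₀ t), ← e]
    exact h (x₀, t) U V
  · obtain ⟨x₀, t⟩ := q
    rw [e, nij_congr (hc x₀ t)]
    exact h x₀ t U V

end Pointwise

/-! ### Intertwining maps and the product with the line. -/

section Restriction
open Filter Topology Set

variable {E : Type*} [NormedAddCommGroup E] [NormedSpace ℝ E]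
  {E' : Type*} [NormedAddCommGroup E'] [NormedSpace ℝ E']

/-- A differentiable family of linear maps, one of which has a left inverse, has a differentiable
family of left inverses. -/
theorem exists_differentiableAt_leftInverse [CompleteSpace E'] {A : E' → E' →L[ℝ] E} {p : E'}
    (hA : DifferentiableAt ℝ A p) {Λ : E →L[ℝ] E'} (hΛ : ∀ u, Λ (A p u) = u) :
    ∃ B : E' → E →L[ℝ] E', DifferentiableAt ℝ B p ∧ ∀ᶠ z in 𝓝 p, ∀ u, B z (A z u) = u := by
  -- C is the identity at p, hence invertible nearby, and C(z)⁻¹ Λ is a left inverse of A(z).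
  set C : E' → E' →L[ℝ] E' := fun z => Λ ∘L A z
  have hC : DifferentiableAt ℝ C p := (differentiableAt_const Λ).clm_comp hA
  have hCp : C p = (ContinuousLinearEquiv.refl ℝ E' : E' →L[ℝ] E') :=
    ContinuousLinearMap.ext hΛ
  have hinv : DifferentiableAt ℝ (ContinuousLinearMap.inverse : (E' →L[ℝ] E') → _) (C p) := by
    rw [hCp]
    exact (contDiffAt_map_inverse (n := 1) _).differentiableAt (by simp)
  have hev : ∀ᶠ z in 𝓝 p, C z ∈ range ((↑) : (E' ≃L[ℝ] E') → E' →L[ℝ] E') :=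
    hC.continuousAt.eventually (by rw [hCp]; exact ContinuousLinearEquiv.nhds _)
  refine ⟨fun z => (C z).inverse ∘L Λ, (hinv.comp p hC).clm_comp (differentiableAt_const Λ),
    hev.mono fun z hz u => ?_⟩
  obtain ⟨e, he⟩ := hz
  have h1 : Λ (A z u) = e u := by rw [← ContinuousLinearEquiv.coe_coe, he]; rfl
  rw [ContinuousLinearMap.comp_apply, h1, ← he, ContinuousLinearMap.inverse_equiv]
  exact e.symm_apply_apply u

/-- The map g × id intertwines the two structures on the products, so naturality of the torsion
applies. -/
theorem nij_localCone_intertwine {g : E' → E} {φ' : E' → E' →L[ℝ] E'} {α' : E' → E' →L[ℝ] ℝ}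
    {Z' : E' → E'} {φ : E → E →L[ℝ] E} {α : E → E →L[ℝ] ℝ} {Z : E → E} {p : E'}
    (hg : ContDiffAt ℝ 2 g p)
    (hφ' : DifferentiableAt ℝ φ' p) (hα' : DifferentiableAt ℝ α' p) (hZ' : DifferentiableAt ℝ Z' p)
    (hφ : DifferentiableAt ℝ φ (g p)) (hα : DifferentiableAt ℝ α (g p))
    (hZ : DifferentiableAt ℝ Z (g p))
    (h₁ : ∀ᶠ z in 𝓝 p, ∀ u, fderiv ℝ g z (φ' z u) = φ (g z) (fderiv ℝ g z u))
    (h₂ : ∀ᶠ z in 𝓝 p, ∀ u, α' z u = α (g z) (fderiv ℝ g z u))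
    (h₃ : ∀ᶠ z in 𝓝 p, fderiv ℝ g z (Z' z) = Z (g z)) (t : ℝ) (U V : E' × ℝ) :
    (fderiv ℝ g p (nij (localCone φ' α' Z') (p, t) U V).1, (nij (localCone φ' α' Z') (p, t) U V).2)
      = nij (localCone φ α Z) (g p, t) (fderiv ℝ g p U.1, U.2) (fderiv ℝ g p V.1, V.2) := by
  have hD : ∀ᶠ w : E' × ℝ in 𝓝 (p, t), ∀ W : E' × ℝ,
      fderiv ℝ (Prod.map g (id : ℝ → ℝ)) w W = (fderiv ℝ g w.1 W.1, W.2) := by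
    have h1 : ∀ᶠ z in 𝓝 p, DifferentiableAt ℝ g z :=
      (hg.eventually (by simp)).mono fun z hz => hz.differentiableAt (by simp)
    have h2 : ∀ᶠ w : E' × ℝ in 𝓝 (p, t), DifferentiableAt ℝ g w.1 :=
      continuous_fst.continuousAt.eventually h1
    filter_upwards [h2] with w hw W
    rw [(hw.hasFDerivAt.prodMap w (hasFDerivAt_id w.2)).fderiv]
    rfl
  have hint : ∀ᶠ w : E' × ℝ in 𝓝 (p, t), ∀ W : E' × ℝ,
      fderiv ℝ (Prod.map g (id : ℝ → ℝ)) w (localCone φ' α' Z' w W)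
        = localCone φ α Z (Prod.map g id w) (fderiv ℝ (Prod.map g (id : ℝ → ℝ)) w W) := by
    have hfst : ContinuousAt (Prod.fst : E' × ℝ → E') (p, t) := continuous_fst.continuousAt
    filter_upwards [hD, hfst.eventually h₁, hfst.eventually h₂, hfst.eventually h₃]
      with w hw k₁ k₂ k₃ W
    rw [hw, hw, localCone_apply, localCone_apply]
    simp only [Prod.map_fst, map_sub, map_smul, k₁, k₂, k₃]
  have hg' : ContDiffAt ℝ 2 (Prod.map g (id : ℝ → ℝ)) (p, t) := hg.prodMap contDiffAt_id
  have key := fderiv_nij_of_intertwine (Ψ := localCone φ' α' Z') (Φ := localCone φ α Z) hg'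
    (differentiableAt_localCone hφ' hα' hZ' t) (differentiableAt_localCone hφ hα hZ t) hint U V
  rwa [hD.self_of_nhds, hD.self_of_nhds, hD.self_of_nhds] at key

end Restriction

/-! ### Structures restricted to integral manifolds. -/

section IntegralManifold
open Filter Topology Set

theorem mapHat_self {E : Type*} [NormedAddCommGroup E] [NormedSpace ℝ E]
    {H : Type*} [TopologicalSpace H] {I : ModelWithCorners ℝ E H}
    {M : Type*} [TopologicalSpace M] [ChartedSpace H M]
    {E' : Type*} [NormedAddCommGroup E'] [NormedSpace ℝ E']
    {H' : Type*} [TopologicalSpace H'] {I' : ModelWithCorners ℝ E' H'}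
    {L : Type*} [TopologicalSpace L] [ChartedSpace H' L] (ι : L → M) (p : L) :
    mapHat I I' ι p (ι p) (extChartAt I' p p) = extChartAt I (ι p) (ι p) := by
  rw [mapHat, extChartAt_to_inv]

variable {E : Type*} [NormedAddCommGroup E] [NormedSpace ℝ E]
  {H : Type*} [TopologicalSpace H] {I : ModelWithCorners ℝ E H} [I.Boundaryless]
  {M : Type*} [TopologicalSpace M] [ChartedSpace H M] [IsManifold I ∞ M]
  {E' : Type*} [NormedAddCommGroup E'] [NormedSpace ℝ E']
  {H' : Type*} [TopologicalSpace H'] {I' : ModelWithCorners ℝ E' H'} [I'.Boundaryless]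
  {L : Type*} [TopologicalSpace L] [ChartedSpace H' L] [IsManifold I' ∞ L]
  {F : Π x : M, Submodule ℝ (TangentSpace I x)} {ι : L → M} (hι : IsIntegralManifold I I' F ι)

include hι

theorem IsIntegralManifold.contDiffAt_mapHat (p : L) :
    ContDiffAt ℝ ∞ (mapHat I I' ι p (ι p)) (extChartAt I' p p) :=
  ContactPairs.contDiffAt_mapHat (mem_extChartAt_target p) (by simp) hι.smooth.contMDiffAt

theorem IsIntegralManifold.eventually_chartD_mapHat (p : L) :
    ∀ᶠ z in 𝓝 (extChartAt I' p p), z ∈ (extChartAt I' p).target ∧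
      mapHat I I' ι p (ι p) z ∈ (extChartAt I (ι p)).target ∧
      (extChartAt I (ι p)).symm (mapHat I I' ι p (ι p) z) = ι ((extChartAt I' p).symm z) ∧
      ∀ u, chartD I (ι p) (mapHat I I' ι p (ι p) z) (fderiv ℝ (mapHat I I' ι p (ι p)) z u)
        = modelDeriv I I' ι ((extChartAt I' p).symm z) (chartD I' p z u) := by
  have : IsManifold I 1 M := .of_le (n := ∞) (by norm_num)
  have : IsManifold I' 1 L := .of_le (n := ∞) (by norm_num)
  filter_upwards [eventually_mem_target_mapHat (I := I) (I' := I') (f := ι) (q := ι p)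
    (mem_extChartAt_target p) (by simp) hι.smooth.continuous] with z hz
  exact ⟨hz.1, (extChartAt I (ι p)).map_source hz.2, (extChartAt I (ι p)).left_inv hz.2,
    chartD_mapHat hz.1 hz.2 (hι.smooth.mdifferentiableAt (by simp))⟩

theorem IsIntegralManifold.fderiv_mapHat_self (p : L) (u : E') :
    fderiv ℝ (mapHat I I' ι p (ι p)) (extChartAt I' p p) u = modelDeriv I I' ι p u := by
  have : IsManifold I 1 M := .of_le (n := ∞) (by norm_num)
  have : IsManifold I' 1 L := .of_le (n := ∞) (by norm_num)
  have h := (hι.eventually_chartD_mapHat p).self_of_nhds.2.2.2 u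
  have e := mapHat_self (I := I) (I' := I') ι p
  rw [e, chartD_self, chartD_self, extChartAt_to_inv] at h
  exact h

theorem IsIntegralManifold.mem_iff_exists_fderiv (p : L) (v : E) :
    v ∈ F (ι p) ↔ ∃ u, fderiv ℝ (mapHat I I' ι p (ι p)) (extChartAt I' p p) u = v := by
  rw [← hι.tangent p]
  simp only [hι.fderiv_mapHat_self]
  rfl

theorem IsIntegralManifold.eventually_formHat (α : Π x : M, TangentSpace I x →L[ℝ] ℝ) (p : L) :
    ∀ᶠ z in 𝓝 (extChartAt I' p p), ∀ u, formHat I' (restrictForm ι α) p z u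
      = formHat I α (ι p) (mapHat I I' ι p (ι p) z) (fderiv ℝ (mapHat I I' ι p (ι p)) z u) := by
  filter_upwards [hι.eventually_chartD_mapHat p] with z hz u
  rw [formHat, formHat, ContinuousLinearMap.comp_apply, ContinuousLinearMap.comp_apply, hz.2.2.2,
    hz.2.2.1]
  rfl

theorem IsIntegralManifold.eventually_fieldHat {Z : Π x : M, TangentSpace I x}
    (hZ : ∀ x, Z x ∈ F x) (p : L) :
    ∀ᶠ z in 𝓝 (extChartAt I' p p), fderiv ℝ (mapHat I I' ι p (ι p)) z
      (fieldHat I' (restrictField hι Z) p z) = fieldHat I Z (ι p) (mapHat I I' ι p (ι p) z) := by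
  have : IsManifold I 1 M := .of_le (n := ∞) (by norm_num)
  have : IsManifold I' 1 L := .of_le (n := ∞) (by norm_num)
  filter_upwards [hι.eventually_chartD_mapHat p] with z hz
  have h := hz.2.2.2 (fieldHat I' (restrictField hι Z) p z)
  have h2 : modelDeriv I I' ι ((extChartAt I' p).symm z)
      (modelField (restrictField hι Z) ((extChartAt I' p).symm z))
      = modelField Z (ι ((extChartAt I' p).symm z)) :=
    mfderiv_restrictField hι Z _ (hZ _)
  have h3 : chartD I' p z (fieldHat I' (restrictField hι Z) p z) = _ :=
    chartD_comp_inverse hz.1 _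
  rw [h3, h2, ← hz.2.2.1] at h
  rw [fieldHat.eq_def I Z, ← h, inverse_comp_chartD hz.2.1]

theorem IsIntegralManifold.eventually_endHat {φ : Π x : M, TangentSpace I x →L[ℝ] TangentSpace I x}
    (hφ : ∀ x, ∀ v ∈ F x, φ x v ∈ F x) (p : L) :
    ∀ᶠ z in 𝓝 (extChartAt I' p p), ∀ u, fderiv ℝ (mapHat I I' ι p (ι p)) z
      (endHat I' (restrictEndomorphism hι φ) p z u)
        = endHat I φ (ι p) (mapHat I I' ι p (ι p) z) (fderiv ℝ (mapHat I I' ι p (ι p)) z u) := by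
  have : IsManifold I 1 M := .of_le (n := ∞) (by norm_num)
  have : IsManifold I' 1 L := .of_le (n := ∞) (by norm_num)
  filter_upwards [hι.eventually_chartD_mapHat p] with z hz u
  have h := hz.2.2.2 (endHat I' (restrictEndomorphism hι φ) p z u)
  have h2 : modelDeriv I I' ι ((extChartAt I' p).symm z)
      (modelEnd (restrictEndomorphism hι φ) ((extChartAt I' p).symm z) (chartD I' p z u))
      = modelEnd φ (ι ((extChartAt I' p).symm z))
        (modelDeriv I I' ι ((extChartAt I' p).symm z) (chartD I' p z u)) :=
    mfderiv_restrictEndomorphism hι φ _ (hφ _) _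
  have h3 : chartD I' p z (endHat I' (restrictEndomorphism hι φ) p z u)
      = modelEnd (restrictEndomorphism hι φ) ((extChartAt I' p).symm z) (chartD I' p z u) :=
    chartD_comp_inverse hz.1 _
  rw [h3, h2, ← hz.2.2.1, ← hz.2.2.2] at h
  rw [endHat.eq_def I φ, ContinuousLinearMap.comp_apply, ContinuousLinearMap.comp_apply, ← h,
    inverse_comp_chartD hz.2.1]

theorem IsIntegralManifold.exists_leftInverse (p : L) : ∃ Λ : E →L[ℝ] E',
    ∀ u, Λ (fderiv ℝ (mapHat I I' ι p (ι p)) (extChartAt I' p p) u) = u := by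
  refine ⟨(hι.immersion p).leftInverse, fun u => ?_⟩
  rw [hι.fderiv_mapHat_self]
  exact (hι.immersion p).leftInverse_leftInverse u

variable {α : Π x : M, TangentSpace I x →L[ℝ] ℝ}
  {Z : Π x : M, TangentSpace I x} {φ : Π x : M, TangentSpace I x →L[ℝ] TangentSpace I x}

theorem IsIntegralManifold.differentiableAt_fderiv_mapHat (p : L) :
    DifferentiableAt ℝ (fderiv ℝ (mapHat I I' ι p (ι p))) (extChartAt I' p p) :=
  ((hι.contDiffAt_mapHat p).fderiv_right (m := 1) (by norm_cast)).differentiableAt (by simp)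

theorem IsIntegralManifold.differentiableAt_comp_mapHat {G : Type*} [NormedAddCommGroup G]
    [NormedSpace ℝ G] (p : L) {f : E → G}
    (hf : DifferentiableAt ℝ f (extChartAt I (ι p) (ι p))) :
    DifferentiableAt ℝ (fun z => f (mapHat I I' ι p (ι p) z)) (extChartAt I' p p) :=
  DifferentiableAt.comp (g := f) _ (by rwa [mapHat_self])
    ((hι.contDiffAt_mapHat p).differentiableAt (by simp))

theorem IsIntegralManifold.differentiableAt_formHat (hα : IsSmoothOneForm I α) (p : L) :
    DifferentiableAt ℝ (formHat I' (restrictForm ι α) p) (extChartAt I' p p) := by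
  refine DifferentiableAt.congr_of_eventuallyEq (f := fun z => (formHat I α (ι p)
    (mapHat I I' ι p (ι p) z)) ∘L fderiv ℝ (mapHat I I' ι p (ι p)) z) ?_
    ((hι.eventually_formHat α p).mono fun z hz => ContinuousLinearMap.ext hz)
  exact (hι.differentiableAt_comp_mapHat p (ContactPairs.differentiableAt_formHat hα _)).clm_comp
    (hι.differentiableAt_fderiv_mapHat p)

variable [CompleteSpace E']

/-- The left inverses in `restrictField` are chosen point by point, with no regularity. The
restricted field is nevertheless unique, so it can be recomputed with a differentiable family of
left inverses. -/
theorem IsIntegralManifold.differentiableAt_fieldHat (hZ : IsSmoothVectorField I Z)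
    (hZF : ∀ x, Z x ∈ F x) (p : L) :
    DifferentiableAt ℝ (fieldHat I' (restrictField hι Z) p) (extChartAt I' p p) := by
  obtain ⟨Λ, hΛ⟩ := hι.exists_leftInverse p
  obtain ⟨B, hB, hBA⟩ := exists_differentiableAt_leftInverse
    (hι.differentiableAt_fderiv_mapHat p) hΛ
  refine DifferentiableAt.congr_of_eventuallyEq (f := fun z => B z (fieldHat I Z (ι p)
    (mapHat I I' ι p (ι p) z))) ?_ ?_
  · exact hB.clm_apply
      (hι.differentiableAt_comp_mapHat p (ContactPairs.differentiableAt_fieldHat hZ _))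
  · filter_upwards [hBA, hι.eventually_fieldHat hZF p] with z h1 h2
    rw [← h2, h1]

theorem IsIntegralManifold.differentiableAt_endHat (hφ : IsSmoothEndomorphism I φ)
    (hφF : ∀ x, ∀ v ∈ F x, φ x v ∈ F x) (p : L) :
    DifferentiableAt ℝ (endHat I' (restrictEndomorphism hι φ) p) (extChartAt I' p p) := by
  obtain ⟨Λ, hΛ⟩ := hι.exists_leftInverse p
  obtain ⟨B, hB, hBA⟩ := exists_differentiableAt_leftInverse
    (hι.differentiableAt_fderiv_mapHat p) hΛ
  refine DifferentiableAt.congr_of_eventuallyEq (f := fun z => B z ∘L endHat I φ (ι p)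
    (mapHat I I' ι p (ι p) z) ∘L fderiv ℝ (mapHat I I' ι p (ι p)) z) ?_ ?_
  · exact hB.clm_comp ((hι.differentiableAt_comp_mapHat p
      (ContactPairs.differentiableAt_endHat hφ _)).clm_comp (hι.differentiableAt_fderiv_mapHat p))
  · filter_upwards [hBA, hι.eventually_endHat hφF p] with z h1 h2
    refine ContinuousLinearMap.ext fun u => ?_
    rw [ContinuousLinearMap.comp_apply, ContinuousLinearMap.comp_apply, ← h2, h1]

/-- The structure induced on an integral manifold is normal if and only if the torsion of the
associated field of endomorphisms of the product with the line vanishes on the distribution. -/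
theorem IsIntegralManifold.isNormalAlmostContact_iff [FiniteDimensional ℝ E'] [T2Space L]
    (hα : IsSmoothOneForm I α) (hZ : IsSmoothVectorField I Z) (hφ : IsSmoothEndomorphism I φ)
    (hZF : ∀ x, Z x ∈ F x) (hφF : ∀ x, ∀ v ∈ F x, φ x v ∈ F x) :
    IsNormalAlmostContact I' (restrictForm ι α) (restrictField hι Z) (restrictEndomorphism hι φ) ↔
      ∀ (p : L) (t a b : ℝ) (u v : E), u ∈ F (ι p) → v ∈ F (ι p) →
        nij (localCone (endHat I φ (ι p)) (formHat I α (ι p)) (fieldHat I Z (ι p)))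
          (extChartAt I (ι p) (ι p), t) (u, a) (v, b) = 0 := by
  rw [ContactPairs.isNormalAlmostContact_iff (hι.differentiableAt_formHat hα)
    (hι.differentiableAt_fieldHat hZ hZF) (hι.differentiableAt_endHat hφ hφF)]
  have key := fun (p : L) => nij_localCone_intertwine ((hι.contDiffAt_mapHat p).of_le
    (by norm_cast)) (hι.differentiableAt_endHat hφ hφF p)
    (hι.differentiableAt_formHat hα p) (hι.differentiableAt_fieldHat hZ hZF p)
    (φ := endHat I φ (ι p)) (α := formHat I α (ι p)) (Z := fieldHat I Z (ι p))
    (by rw [mapHat_self]; exact ContactPairs.differentiableAt_endHat hφ _)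
    (by rw [mapHat_self]; exact ContactPairs.differentiableAt_formHat hα _)
    (by rw [mapHat_self]; exact ContactPairs.differentiableAt_fieldHat hZ _)
    (hι.eventually_endHat hφF p) (hι.eventually_formHat α p) (hι.eventually_fieldHat hZF p)
  refine ⟨fun h p t a b u v hu hv => ?_, fun h p t U V => ?_⟩
  · obtain ⟨u', rfl⟩ := (hι.mem_iff_exists_fderiv p u).1 hu
    obtain ⟨v', rfl⟩ := (hι.mem_iff_exists_fderiv p v).1 hv
    have := key p t (u', a) (v', b)
    rw [h, mapHat_self] at this
    rw [← this]
    simp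
  -- The torsion on the leaf maps to zero, and the derivative of the immersion has a left inverse.
  · have h1 := key p t U V
    rw [mapHat_self, h p t _ _ _ _ ((hι.mem_iff_exists_fderiv p _).2 ⟨_, rfl⟩)
      ((hι.mem_iff_exists_fderiv p _).2 ⟨_, rfl⟩)] at h1
    obtain ⟨Λ, hΛ⟩ := hι.exists_leftInverse p
    have h2 := congrArg (fun w => Λ w.1) h1
    simp only [hΛ, Prod.fst_zero, map_zero] at h2
    have h3 := congrArg Prod.snd h1
    exact Prod.ext h2 h3

end IntegralManifold

/-! ### Smooth projectors and involutivity for ker α ∩ ker dα. -/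

section LocalFoliation
open Filter Topology Set Metric

variable {E : Type*} [NormedAddCommGroup E] [NormedSpace ℝ E]

theorem isBoundedLinearMap_flip :
    IsBoundedLinearMap ℝ (fun B : E →L[ℝ] E →L[ℝ] ℝ => B.flip) where
  map_add := fun _ _ => rfl
  map_smul := fun _ _ => rfl
  bound := ⟨1, one_pos, fun B => by rw [ContinuousLinearMap.opNorm_flip, one_mul]⟩

theorem contDiff_flip : ContDiff ℝ ∞ (fun B : E →L[ℝ] E →L[ℝ] ℝ => B.flip) :=
  isBoundedLinearMap_flip.contDiff

/-- The exterior derivative of a `1`-form, as a bilinear form. -/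
noncomputable def dbilin (α : E → E →L[ℝ] ℝ) (y : E) : E →L[ℝ] E →L[ℝ] ℝ :=
  fderiv ℝ α y - (fderiv ℝ α y).flip

theorem dbilin_apply (α : E → E →L[ℝ] ℝ) (y u v : E) : dbilin α y u v = dform α y u v := rfl

theorem contDiffOn_dbilin {α : E → E →L[ℝ] ℝ} {U : Set E} (hU : IsOpen U)
    (hα : ContDiffOn ℝ ∞ α U) : ContDiffOn ℝ ∞ (dbilin α) U := by
  have h1 : ContDiffOn ℝ ∞ (fderiv ℝ α) U := hα.fderiv_of_isOpen hU (by simp)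
  exact h1.sub (contDiff_flip.comp_contDiffOn h1)

/-- The bilinear form `dα + α ⊗ α`. -/
noncomputable def charBilin (α : E → E →L[ℝ] ℝ) (y : E) : E →L[ℝ] E →L[ℝ] ℝ :=
  dbilin α y + (α y).smulRight (α y)

theorem charBilin_apply (α : E → E →L[ℝ] ℝ) (y u v : E) :
    charBilin α y u v = dform α y u v + α y u * α y v := rfl

theorem contDiffOn_charBilin {α : E → E →L[ℝ] ℝ} {U : Set E} (hU : IsOpen U)
    (hα : ContDiffOn ℝ ∞ α U) : ContDiffOn ℝ ∞ (charBilin α) U :=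
  (contDiffOn_dbilin hU hα).add (hα.smulRight hα)

theorem charBilin_eq_zero_left {α : E → E →L[ℝ] ℝ} {y u : E} (hu : u ∈ localChar α y) (v : E) :
    charBilin α y u v = 0 := by
  rw [charBilin_apply, hu.1, hu.2, zero_mul, add_zero]

theorem charBilin_eq_zero_right {α : E → E →L[ℝ] ℝ} {y v : E} (hv : v ∈ localChar α y) (u : E) :
    charBilin α y u v = 0 := by
  rw [charBilin_apply, hv.1, dform_swap, hv.2, mul_zero, neg_zero, add_zero]

theorem mem_localChar_of_charBilin {α : E → E →L[ℝ] ℝ} {y u : E}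
    (h : ∀ v, charBilin α y u v = 0) : u ∈ localChar α y := by
  have h1 : α y u = 0 := by
    have h2 := h u
    have h3 : dform α y u u = 0 := by simp [dform]
    rw [charBilin_apply, h3, zero_add] at h2
    exact mul_self_eq_zero.1 h2
  refine ⟨h1, fun w => ?_⟩
  have := h w
  rwa [charBilin_apply, h1, zero_mul, add_zero] at this

/-- If `ker α₁ ∩ ker dα₁` and `ker α₂ ∩ ker dα₂` are complementary, the projector onto the first
subspace along the second one depends smoothly on the point. -/
theorem exists_contDiffOn_projector [FiniteDimensional ℝ E] {α₁ α₂ : E → E →L[ℝ] ℝ} {U : Set E}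
    (hU : IsOpen U) (hα₁ : ContDiffOn ℝ ∞ α₁ U) (hα₂ : ContDiffOn ℝ ∞ α₂ U)
    (hc : ∀ y ∈ U, IsCompl (localChar α₁ y) (localChar α₂ y)) :
    ∃ P : E → E →L[ℝ] E, ContDiffOn ℝ ∞ P U ∧ ∀ y ∈ U,
      (∀ u, P y u ∈ localChar α₁ y) ∧ ∀ u ∈ localChar α₁ y, P y u = u := by
  -- Write bᵢ = dαᵢ + αᵢ ⊗ αᵢ, whose kernel is the i-th subspace. The kernels being complementary, B
  -- = b₁ + b₂ is nondegenerate; as b₂(u₁ + u₂) = b₂(u₁) = B(u₁), the projector is B⁻¹ b₂, visibly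
  -- smooth.
  set B : E → E →L[ℝ] E →L[ℝ] ℝ := fun y => charBilin α₁ y + charBilin α₂ y with hB
  have hBs : ContDiffOn ℝ ∞ B U := (contDiffOn_charBilin hU hα₁).add (contDiffOn_charBilin hU hα₂)
  have hdec : ∀ y ∈ U, ∀ u, ∃ u₁ ∈ localChar α₁ y, ∃ u₂ ∈ localChar α₂ y, u₁ + u₂ = u :=
    fun y hy u => Submodule.mem_sup.1 ((hc y hy).sup_eq_top ▸ Submodule.mem_top)
  have hBdec : ∀ y ∈ U, ∀ u₁ ∈ localChar α₁ y, ∀ u₂ ∈ localChar α₂ y, ∀ v,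
      B y (u₁ + u₂) v = charBilin α₁ y u₂ v + charBilin α₂ y u₁ v := by
    intro y hy u₁ h₁ u₂ h₂ v
    simp only [hB, add_apply, map_add, charBilin_eq_zero_left h₁, charBilin_eq_zero_left h₂]
    ring
  have hinj : ∀ y ∈ U, Function.Injective (B y) := by
    intro y hy
    refine (injective_iff_map_eq_zero _).2 fun u hu => ?_
    obtain ⟨u₁, h₁, u₂, h₂, rfl⟩ := hdec y hy u
    have h0 : ∀ v, charBilin α₁ y u₂ v + charBilin α₂ y u₁ v = 0 := fun v => by
      rw [← hBdec y hy u₁ h₁ u₂ h₂, hu]; rfl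
    have k₁ : u₁ ∈ localChar α₂ y := mem_localChar_of_charBilin fun v => by
      obtain ⟨v₁, hv₁, v₂, hv₂, rfl⟩ := hdec y hy v
      have := h0 v₁
      rw [charBilin_eq_zero_right hv₁, zero_add] at this
      rw [map_add, this, charBilin_eq_zero_right hv₂, add_zero]
    have k₂ : u₂ ∈ localChar α₁ y := mem_localChar_of_charBilin fun v => by
      obtain ⟨v₁, hv₁, v₂, hv₂, rfl⟩ := hdec y hy v
      have := h0 v₂
      rw [charBilin_eq_zero_right hv₂, add_zero] at this
      rw [map_add, this, charBilin_eq_zero_right hv₁, add_zero]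
    rw [Submodule.disjoint_def.1 (hc y hy).disjoint u₁ h₁ k₁,
      Submodule.disjoint_def.1 (hc y hy).disjoint u₂ k₂ h₂, add_zero]
  have hrank : Module.finrank ℝ E = Module.finrank ℝ (E →L[ℝ] ℝ) :=
    (Subspace.dual_finrank_eq (K := ℝ) (V := E)).symm.trans
      (LinearMap.toContinuousLinearMap (𝕜 := ℝ) (E := E) (F' := ℝ)).finrank_eq
  have hequiv : ∀ y ∈ U, ∃ e : E ≃L[ℝ] (E →L[ℝ] ℝ), (e : E →L[ℝ] E →L[ℝ] ℝ) = B y := by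
    intro y hy
    refine ⟨(LinearEquiv.ofInjectiveOfFinrankEq (B y).toLinearMap (hinj y hy)
      hrank).toContinuousLinearEquiv, ContinuousLinearMap.ext fun u => rfl⟩
  refine ⟨fun y => (B y).inverse ∘L charBilin α₂ y, ?_, fun y hy => ?_⟩
  · intro y hy
    obtain ⟨e, he⟩ := hequiv y hy
    have h1 : ContDiffAt ℝ ∞ ContinuousLinearMap.inverse (B y) := he ▸ contDiffAt_map_inverse e
    have h2 := hU.mem_nhds hy
    exact ((h1.comp y (hBs.contDiffAt h2)).clm_comp
      ((contDiffOn_charBilin hU hα₂).contDiffAt h2)).contDiffWithinAt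
  · obtain ⟨e, he⟩ := hequiv y hy
    have hP : ∀ u₁ ∈ localChar α₁ y, ∀ u₂ ∈ localChar α₂ y,
        ((B y).inverse ∘L charBilin α₂ y) (u₁ + u₂) = u₁ := by
      intro u₁ h₁ u₂ h₂
      have h3 : charBilin α₂ y (u₁ + u₂) = B y u₁ := ContinuousLinearMap.ext fun v => by
        have h4 := hBdec y hy u₁ h₁ 0 (zero_mem _) v
        rw [add_zero, map_zero, zero_apply, zero_add] at h4
        rw [h4, map_add, add_apply, charBilin_eq_zero_left h₂, add_zero]
      rw [ContinuousLinearMap.comp_apply, h3, ← he, ContinuousLinearMap.inverse_equiv]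
      exact e.symm_apply_apply u₁
    refine ⟨fun u => ?_, fun u hu => ?_⟩
    · obtain ⟨u₁, h₁, u₂, h₂, rfl⟩ := hdec y hy u
      exact (hP u₁ h₁ u₂ h₂).symm ▸ h₁
    · simpa using hP u hu 0 (zero_mem _)

/-- The distribution `ker α ∩ ker dα` is involutive. -/
theorem bracket_mem_localChar {α : E → E →L[ℝ] ℝ} {X Y : E → E} {y : E}
    (hα : ContDiffAt ℝ 2 α y) (hX : DifferentiableAt ℝ X y) (hY : DifferentiableAt ℝ Y y)
    (hXF : ∀ᶠ z in 𝓝 y, X z ∈ localChar α z) (hYF : ∀ᶠ z in 𝓝 y, Y z ∈ localChar α z) :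
    fderiv ℝ X y (Y y) - fderiv ℝ Y y (X y) ∈ localChar α y := by
  have hα1 : DifferentiableAt ℝ α y := hα.differentiableAt (by simp)
  have hα2 : DifferentiableAt ℝ (fderiv ℝ α) y :=
    (hα.fderiv_right (m := 1) (by norm_num)).differentiableAt (by simp)
  have hsymm : ∀ a b, fderiv ℝ (fderiv ℝ α) y a b = fderiv ℝ (fderiv ℝ α) y b a := fun a b =>
    (hα.isSymmSndFDerivAt (by simp)) a b
  have hflip : DifferentiableAt ℝ (fun z => (fderiv ℝ α z).flip) y :=
    DifferentiableAt.comp (g := fun B : E →L[ℝ] E →L[ℝ] ℝ => B.flip) y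
      (contDiff_flip.differentiable (by simp) _) hα2
  have hβ : DifferentiableAt ℝ (dbilin α) y :=
    DifferentiableAt.sub (𝕜 := ℝ) (E := E) (F := E →L[ℝ] E →L[ℝ] ℝ) hα2 hflip
  have hDβ : ∀ w a b, fderiv ℝ (dbilin α) y w a b
      = fderiv ℝ (fderiv ℝ α) y w a b - fderiv ℝ (fderiv ℝ α) y w b a := by
    intro w a b
    have h1 : ∀ a b, DifferentiableAt ℝ (fun z => fderiv ℝ α z a b) y := fun a b =>
      (hα2.clm_apply (differentiableAt_const a)).clm_apply (differentiableAt_const b)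
    have h2 : ∀ a b, fderiv ℝ (fun z => fderiv ℝ α z a b) y w = fderiv ℝ (fderiv ℝ α) y w a b :=
      fun a b => by
        rw [fderiv_apply_eq hα2, fderiv_apply_eq (hα2.clm_apply (differentiableAt_const a))]
    rw [fderiv_apply_eq hβ, fderiv_apply_eq (hβ.clm_apply (differentiableAt_const a)), ← h2, ← h2]
    have h3 : (fun z => dbilin α z a b) = (fun z => fderiv ℝ α z a b) - fun z => fderiv ℝ α z b a :=
      rfl
    rw [h3, fderiv_sub (h1 a b) (h1 b a)]
    rfl
  have hform : ∀ {X : E → E}, DifferentiableAt ℝ X y → (∀ᶠ z in 𝓝 y, X z ∈ localChar α z) → ∀ w,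
      fderiv ℝ α y w (X y) + α y (fderiv ℝ X y w) = 0 := fun hX h w => by
    simpa using fderiv_clm_apply_eq_of_eventuallyEq (g := fun _ => (0 : ℝ)) hα1 hX
      (h.mono fun z hz => hz.1) w
  have hdf : ∀ {X : E → E}, DifferentiableAt ℝ X y → (∀ᶠ z in 𝓝 y, X z ∈ localChar α z) → ∀ w v,
      fderiv ℝ (dbilin α) y w (X y) v + dform α y (fderiv ℝ X y w) v = 0 := fun hX h w v => by
    have := fderiv_clm_apply_eq_of_eventuallyEq (g := fun _ => (0 : E →L[ℝ] ℝ)) hβ hX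
      (h.mono fun z hz => ContinuousLinearMap.ext fun v => hz.2 v) w
    have := congrArg (fun A => A v) this
    simpa [dbilin_apply] using this
  have hXy := hXF.self_of_nhds
  have hYy := hYF.self_of_nhds
  refine ⟨?_, fun w => ?_⟩
  · have h1 := hform hX hXF (Y y)
    have h2 := hform hY hYF (X y)
    have h3 := hXy.2 (Y y)
    rw [dform] at h3
    rw [map_sub]
    linarith
  · have h1 := hdf hX hXF (Y y) w
    have h2 := hdf hY hYF (X y) w
    have h3 := hdf hX hXF w (Y y)
    have h4 : dform α y (fderiv ℝ X y w) (Y y) = 0 := by rw [dform_swap, hYy.2, neg_zero]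
    rw [sub_eq_add_neg, dform_add_left, ← neg_one_smul ℝ, dform_smul_left]
    rw [hDβ] at h1 h2 h3
    -- These three symmetries of the second derivative of α express d(dα)(X, Y, w) = 0.
    have e1 := congrArg (fun A => A (X y)) (hsymm w (Y y))
    have e2 := congrArg (fun A => A (Y y)) (hsymm w (X y))
    have e3 := congrArg (fun A => A w) (hsymm (X y) (Y y))
    linarith

end LocalFoliation

/-! ### Commuting frames and local integral manifolds. -/

section Frames
open Filter Topology Set Metric

variable {E : Type*} [NormedAddCommGroup E] [NormedSpace ℝ E]

/-- Near each point, the distribution `ker α ∩ ker dα` of constant rank is spanned by commuting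
vector fields. -/
theorem exists_commuting_frame [FiniteDimensional ℝ E] {α : E → E →L[ℝ] ℝ} {P : E → E →L[ℝ] E}
    {U : Set E} (hU : IsOpen U) (hα : ContDiffOn ℝ ∞ α U) (hP : ContDiffOn ℝ ∞ P U)
    (hPF : ∀ y ∈ U, (∀ u, P y u ∈ localChar α y) ∧ ∀ u ∈ localChar α y, P y u = u) {d : ℕ}
    (hd : ∀ y ∈ U, Module.finrank ℝ (localChar α y) = d) {y₀ : E} (hy₀ : y₀ ∈ U) :
    ∃ (V : Set E) (σ : E → EuclideanSpace ℝ (Fin d) →L[ℝ] E)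
      (q : E →L[ℝ] EuclideanSpace ℝ (Fin d)), IsOpen V ∧ y₀ ∈ V ∧ V ⊆ U ∧ ContDiffOn ℝ ∞ σ V ∧
      ∀ y ∈ V, (∀ a, q (σ y a) = a) ∧ (∀ v, v ∈ localChar α y ↔ ∃ a, σ y a = v) ∧
        ∀ a b, fderiv ℝ σ y (σ y a) b = fderiv ℝ σ y (σ y b) a := by
  set G := EuclideanSpace ℝ (Fin d)
  have hGd : Module.finrank ℝ G = d := finrank_euclideanSpace_fin
  let e : G ≃L[ℝ] localChar α y₀ := ContinuousLinearEquiv.ofFinrankEq (by rw [hd y₀ hy₀, hGd])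
  let j : G →L[ℝ] E := (localChar α y₀).subtypeL ∘L (e : G →L[ℝ] localChar α y₀)
  let q : E →L[ℝ] G := (e.symm : localChar α y₀ →L[ℝ] G) ∘L
    (P y₀).codRestrict (localChar α y₀) (hPF y₀ hy₀).1
  have hqj : ∀ a, q (P y₀ (j a)) = a := fun a => by
    have h1 : P y₀ (j a) = e a := (hPF y₀ hy₀).2 _ (e a).2
    have h2 : (P y₀).codRestrict (localChar α y₀) (hPF y₀ hy₀).1 (e a) = e a :=
      Subtype.ext ((hPF y₀ hy₀).2 _ (e a).2)
    rw [h1, ContinuousLinearMap.comp_apply, h2]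
    exact e.symm_apply_apply a
  let A : E → G →L[ℝ] G := fun y => q ∘L P y ∘L j
  have hA : ContDiffOn ℝ ∞ A U := contDiffOn_const.clm_comp (hP.clm_comp contDiffOn_const)
  let V : Set E := U ∩ A ⁻¹' range ((↑) : (G ≃L[ℝ] G) → G →L[ℝ] G)
  have hVo : IsOpen V := hA.continuousOn.isOpen_inter_preimage hU ContinuousLinearEquiv.isOpen
  have hVy : y₀ ∈ V := ⟨hy₀, ContinuousLinearEquiv.refl ℝ G, ContinuousLinearMap.ext fun a =>
    (hqj a).symm⟩
  -- q restricts to an isomorphism from the distribution at y to the fixed space G, for y near y₀.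
  -- The frame σ y is its inverse, normalized by q ∘ σ y = id.
  let σ : E → G →L[ℝ] E := fun y => P y ∘L j ∘L (A y).inverse
  have hσ : ContDiffOn ℝ ∞ σ V := by
    intro y hy
    obtain ⟨f, hf⟩ := hy.2
    have h1 : ContDiffAt ℝ ∞ ContinuousLinearMap.inverse (A y) := hf ▸ contDiffAt_map_inverse f
    have h2 := hU.mem_nhds hy.1
    exact ((hP.contDiffAt h2).clm_comp (contDiffAt_const.clm_comp
      (h1.comp y (hA.contDiffAt h2)))).contDiffWithinAt
  have hqσ : ∀ y ∈ V, ∀ a, q (σ y a) = a := by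
    intro y hy a
    obtain ⟨f, hf⟩ := hy.2
    have h1 : q (σ y a) = A y ((A y).inverse a) := rfl
    rw [h1, ← hf, ContinuousLinearMap.inverse_equiv]
    exact f.apply_symm_apply a
  have hσF : ∀ y ∈ V, ∀ a, σ y a ∈ localChar α y := fun y hy a => (hPF y hy.1).1 _
  have hrange : ∀ y ∈ V, LinearMap.range (σ y).toLinearMap = localChar α y := by
    intro y hy
    refine Submodule.eq_of_le_of_finrank_eq ?_ ?_
    · rintro _ ⟨a, rfl⟩
      exact hσF y hy a
    · rw [LinearMap.finrank_range_of_inj (f := (σ y).toLinearMap)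
        (Function.LeftInverse.injective (g := q) (hqσ y hy)), hGd, hd y hy.1]
  refine ⟨V, σ, q, hVo, hVy, inter_subset_left, hσ, fun y hy => ⟨hqσ y hy, fun v => ?_,
    fun a b => ?_⟩⟩
  · rw [← hrange y hy]
    rfl
  · have hVn := hVo.mem_nhds hy
    have hσd : DifferentiableAt ℝ σ y := (hσ.contDiffAt hVn).differentiableAt (by simp)
    have hbr := bracket_mem_localChar (α := α) (X := fun z => σ z b) (Y := fun z => σ z a) (y := y)
      ((hα.contDiffAt (hU.mem_nhds hy.1)).of_le (by norm_cast))
      (hσd.clm_apply (differentiableAt_const b)) (hσd.clm_apply (differentiableAt_const a))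
      (by filter_upwards [hVn] with z hz using hσF z hz b)
      (by filter_upwards [hVn] with z hz using hσF z hz a)
    rw [← fderiv_apply_eq hσd, ← fderiv_apply_eq hσd, ← hrange y hy] at hbr
    obtain ⟨c, hc⟩ := hbr
    have hqd : ∀ w a, q (fderiv ℝ σ y w a) = 0 := by
      intro w a
      have h := fderiv_clm_apply_eq_of_eventuallyEq (Φ := fun _ => q) (f := fun z => σ z a)
        (g := fun _ => a) (differentiableAt_const q) (hσd.clm_apply (differentiableAt_const a))
        (by filter_upwards [hVn] with z hz using hqσ z hz a) w
      rw [← fderiv_apply_eq hσd] at h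
      simpa using h
    -- By involutivity the bracket of two frame fields is σ y c for some c. Since q ∘ σ is constant,
    -- q kills the bracket, so c = 0: normalizing the frame by q makes it commute.
    have hc0 : c = 0 := by
      rw [← hqσ y hy c]
      have hc' : σ y c = _ := hc
      rw [hc', map_sub, hqd, hqd, sub_zero]
    rw [hc0, map_zero] at hc
    exact (sub_eq_zero.1 hc.symm)

/-- Solutions of the equation `Df = σ ∘ f` with `σ` smooth are smooth. -/
theorem contDiffOn_of_hasFDerivAt_comp {A : Type*} [NormedAddCommGroup A] [NormedSpace ℝ A]
    {σ : E → A →L[ℝ] E} {V : Set E} (hσ : ContDiffOn ℝ ∞ σ V) {f : A → E} {W : Set A}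
    (hW : IsOpen W) (hf : ∀ a ∈ W, f a ∈ V ∧ HasFDerivAt f (σ (f a)) a) : ContDiffOn ℝ ∞ f W := by
  have hd : DifferentiableOn ℝ f W := fun a ha =>
    (hf a ha).2.differentiableAt.differentiableWithinAt
  refine contDiffOn_infty.2 fun n => ?_
  induction n with
  | zero => exact contDiffOn_zero.2 hd.continuousOn
  | succ n ih =>
    refine (contDiffOn_succ_iff_fderiv_of_isOpen (n := (n : ℕ∞ω)) hW).2
      ⟨hd, fun h => absurd h (WithTop.natCast_ne_top n), ?_⟩
    exact ((hσ.of_le (by norm_cast; exact le_top)).comp ih fun a ha => (hf a ha).1).congr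
      fun a ha => (hf a ha).2.fderiv

/-- Through each point passes a parametrized integral manifold of `ker α ∩ ker dα`. -/
theorem exists_local_integral_manifold [FiniteDimensional ℝ E] {α : E → E →L[ℝ] ℝ}
    {P : E → E →L[ℝ] E} {U : Set E} (hU : IsOpen U) (hα : ContDiffOn ℝ ∞ α U)
    (hP : ContDiffOn ℝ ∞ P U)
    (hPF : ∀ y ∈ U, (∀ u, P y u ∈ localChar α y) ∧ ∀ u ∈ localChar α y, P y u = u) {d : ℕ}
    (hd : ∀ y ∈ U, Module.finrank ℝ (localChar α y) = d) {y₀ : E} (hy₀ : y₀ ∈ U) :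
    ∃ r > 0, ∃ f : EuclideanSpace ℝ (Fin d) → E, f 0 = y₀ ∧ ContDiffOn ℝ ∞ f (ball 0 r) ∧
      InjOn f (ball 0 r) ∧ ∀ a ∈ ball (0 : EuclideanSpace ℝ (Fin d)) r, f a ∈ U ∧
        Function.Injective (fderiv ℝ f a) ∧
        ∀ v, v ∈ localChar α (f a) ↔ ∃ b, fderiv ℝ f a b = v := by
  obtain ⟨V, σ, q, hVo, hVy, hVU, hσ, hV⟩ := exists_commuting_frame hU hα hP hPF hd hy₀
  obtain ⟨r, hr, f, hf0, hf⟩ := exists_map_hasFDerivAt_of_commute hVo hVy hσ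
    fun y hy => (hV y hy).2.2
  refine ⟨r, hr, f, hf0, contDiffOn_of_hasFDerivAt_comp hσ isOpen_ball hf, ?_, fun a ha => ?_⟩
  -- Because q ∘ σ = id, the map q ∘ f is a translation on the ball, so f is injective there.
  · have hder : ∀ a ∈ ball (0 : EuclideanSpace ℝ (Fin d)) r,
        HasFDerivAt (fun a => q (f a) - a) (0 : EuclideanSpace ℝ (Fin d) →L[ℝ] _) a := by
      intro a ha
      have h1 := (q.hasFDerivAt.comp a (hf a ha).2).sub (hasFDerivAt_id a)
      have h2 : q ∘L σ (f a) - ContinuousLinearMap.id ℝ (EuclideanSpace ℝ (Fin d)) = 0 := by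
        ext1 b
        simp [(hV _ (hf a ha).1).1]
      rw [h2] at h1
      exact h1
    intro a ha b hb hab
    have hconst := (convex_ball (0 : EuclideanSpace ℝ (Fin d)) r).is_const_of_fderivWithin_eq_zero
      (𝕜 := ℝ) (f := fun a => q (f a) - a)
      (fun c hc => (hder c hc).differentiableAt.differentiableWithinAt)
      (fun c hc => by rw [fderivWithin_of_isOpen isOpen_ball hc, (hder c hc).fderiv]) ha hb
    simp only [hab] at hconst
    exact sub_right_injective hconst
  · rw [(hf a ha).2.fderiv]
    exact ⟨hVU (hf a ha).1, Function.LeftInverse.injective (g := q) (hV _ (hf a ha).1).1,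
      (hV _ (hf a ha).1).2.1⟩

end Frames

/-! ### Connected integral manifolds through every point. -/

section IntegralManifolds
open Filter Topology Set Metric

section
variable {E : Type*} [NormedAddCommGroup E] [NormedSpace ℝ E]
  {H : Type*} [TopologicalSpace H] {I : ModelWithCorners ℝ E H} [I.Boundaryless]
  {M : Type*} [TopologicalSpace M] [ChartedSpace H M] [IsManifold I ∞ M] {x₀ : M} {y : E}
  {α β : Π x : M, TangentSpace I x →L[ℝ] ℝ}

/-- In the preferred chart at `x₀`, the distributions `ker α ∩ ker dα` correspond to each other
under an isomorphism that does not depend on `α`. -/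
theorem exists_localChar_formHat_eq_comap (hy : y ∈ (extChartAt I x₀).target) :
    ∃ e : E ≃ₗ[ℝ] E, ∀ {α : Π x : M, TangentSpace I x →L[ℝ] ℝ}, IsSmoothOneForm I α →
      localChar (formHat I α x₀) y = (show Submodule ℝ E from
        charDistribution I α ((extChartAt I x₀).symm y)).comap e.toLinearMap := by
  have : IsManifold I 1 M := .of_le (n := ∞) (by norm_num)
  exact ⟨LinearEquiv.ofLinearMap (chartD I x₀ y).toLinearMap (chartD I x₀ y).inverse.toLinearMap
    (LinearMap.ext (chartD_comp_inverse hy)) (LinearMap.ext (inverse_comp_chartD hy)),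
    fun hα => Submodule.ext fun u => localChar_formHat_iff hα hy u⟩

theorem isCompl_localChar_formHat (hα : IsSmoothOneForm I α) (hβ : IsSmoothOneForm I β)
    (hy : y ∈ (extChartAt I x₀).target)
    (hc : IsCompl (charDistribution I α ((extChartAt I x₀).symm y))
      (charDistribution I β ((extChartAt I x₀).symm y))) :
    IsCompl (localChar (formHat I α x₀) y) (localChar (formHat I β x₀) y) := by
  obtain ⟨e, he⟩ := exists_localChar_formHat_eq_comap hy
  rw [he hα, he hβ]
  exact (Submodule.orderIsoMapComap e).symm.isCompl hc

theorem finrank_localChar_formHat (hα : IsSmoothOneForm I α)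
    (hy : y ∈ (extChartAt I x₀).target) :
    Module.finrank ℝ (localChar (formHat I α x₀) y)
      = Module.finrank ℝ (charDistribution I α ((extChartAt I x₀).symm y)) := by
  obtain ⟨e, he⟩ := exists_localChar_formHat_eq_comap hy
  rw [he hα, Submodule.comap_equiv_eq_map_symm]
  exact e.symm.finrank_map_eq _

end

variable {n : ℕ} {M : Type u} [TopologicalSpace M]
  [ChartedSpace (EuclideanSpace ℝ (Fin n)) M] [IsManifold (𝓡 n) ∞ M]

/-- The underlying map of a ball, considered in an arbitrary universe, to the model space. -/
def ballEmbedding (d : ℕ) (r : ℝ) (p : ULift.{u} (ball (0 : EuclideanSpace ℝ (Fin d)) r)) :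
    EuclideanSpace ℝ (Fin d) := p.down

theorem isOpenEmbedding_ballEmbedding (d : ℕ) (r : ℝ) :
    IsOpenEmbedding (ballEmbedding.{u} d r) :=
  isOpen_ball.isOpenEmbedding_subtypeVal.comp Homeomorph.ulift.isOpenEmbedding

/-- The distribution `ker α ∩ ker dα`, if it has constant rank and a complement of the same kind,
has a connected integral manifold through each point. -/
theorem exists_isIntegralManifold {α β : Π x : M, TangentSpace (𝓡 n) x →L[ℝ] ℝ}
    (hα : IsSmoothOneForm (𝓡 n) α) (hβ : IsSmoothOneForm (𝓡 n) β)
    (hc : ∀ x, IsCompl (charDistribution (𝓡 n) α x) (charDistribution (𝓡 n) β x)) {d : ℕ}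
    (hd : ∀ x, Module.finrank ℝ (charDistribution (𝓡 n) α x) = d) (x₀ : M) :
    ∃ (L : Type u) (_ : TopologicalSpace L) (_ : T2Space L) (_ : SecondCountableTopology L)
      (_ : ConnectedSpace L) (_ : ChartedSpace (EuclideanSpace ℝ (Fin d)) L)
      (_ : IsManifold (𝓡 d) ∞ L) (ι : L → M)
      (_ : IsIntegralManifold (𝓡 n) (𝓡 d) (charDistribution (𝓡 n) α) ι), ∃ p, ι p = x₀ := by
  have : IsManifold (𝓡 n) 1 M := .of_le (n := ∞) (by norm_num)
  set E := EuclideanSpace ℝ (Fin n)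
  set c := extChartAt (𝓡 n) x₀
  have hU : IsOpen c.target := isOpen_extChartAt_target x₀
  have hcl : ∀ y ∈ c.target, IsCompl (localChar (formHat (𝓡 n) α x₀) y)
      (localChar (formHat (𝓡 n) β x₀) y) := fun y hy =>
    isCompl_localChar_formHat hα hβ hy (hc (c.symm y))
  have hdl : ∀ y ∈ c.target, Module.finrank ℝ (localChar (formHat (𝓡 n) α x₀) y) = d :=
    fun y hy => (finrank_localChar_formHat hα hy).trans (hd _)
  -- The form β is used only here, to have a smooth projector onto ker α ∩ ker dα.
  obtain ⟨P, hP, hPF⟩ := exists_contDiffOn_projector hU (contDiffOn_formHat x₀ hα)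
    (contDiffOn_formHat x₀ hβ) hcl
  obtain ⟨r, hr, f, hf0, hfs, hfi, hf⟩ := exists_local_integral_manifold hU
    (contDiffOn_formHat x₀ hα) hP hPF hdl (mem_extChartAt_target x₀)
  let e := ballEmbedding.{u} d r
  have he : IsOpenEmbedding e := isOpenEmbedding_ballEmbedding d r
  have heb : ∀ p, e p ∈ ball (0 : EuclideanSpace ℝ (Fin d)) r := fun p => p.down.2
  -- The lift places the ball in the universe of M, over which `InducedStructuresNormal` quantifies.
  let L := ULift.{u} (ball (0 : EuclideanSpace ℝ (Fin d)) r)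
  have hball : ConnectedSpace (ball (0 : EuclideanSpace ℝ (Fin d)) r) :=
    Subtype.connectedSpace ((convex_ball _ _).isConnected ⟨0, mem_ball_self hr⟩)
  have hconn : ConnectedSpace L := (Homeomorph.ulift.symm.surjective).connectedSpace
    Homeomorph.ulift.symm.continuous
  have hsc : SecondCountableTopology L := he.isEmbedding.secondCountableTopology
  have hT2 : T2Space L := he.isEmbedding.t2Space
  let _ : ChartedSpace (EuclideanSpace ℝ (Fin d)) L := he.singletonChartedSpace
  have hman : IsManifold (𝓡 d) ∞ L := he.isManifold_singleton
  have hman1 : IsManifold (𝓡 d) 1 L := he.isManifold_singleton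
  have hes : ContMDiff (𝓡 d) (𝓡 d) ∞ e := contMDiff_isOpenEmbedding he
  let ι : L → M := fun p => c.symm (f (e p))
  have hιs : ContMDiff (𝓡 d) (𝓡 n) ∞ ι := fun p => by
    have h1 := (contMDiffOn_extChartAt_symm (I := 𝓡 n) (n := ∞) x₀).contMDiffAt
      (hU.mem_nhds (hf (e p) (heb p)).1)
    have h2 := (hfs.contDiffAt (isOpen_ball.mem_nhds (heb p))).contMDiffAt
    exact h1.comp p (h2.comp p hes.contMDiffAt)
  have hιd : ∀ p, modelDeriv (𝓡 n) (𝓡 d) ι p = chartD (𝓡 n) x₀ (f (e p)) ∘L fderiv ℝ f (e p) := by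
    intro p
    have h1 := hasMFDerivAt_extChartAt_symm (I := 𝓡 n) (hf (e p) (heb p)).1
    have h2 := ((hfs.contDiffAt (isOpen_ball.mem_nhds (heb p))).differentiableAt
      (by simp)).hasFDerivAt.hasMFDerivAt
    have h3 := (hes.mdifferentiableAt (x := p) (by simp)).hasMFDerivAt
    -- The only chart of L is e itself.
    have h4 : mfderiv (𝓡 d) (𝓡 d) e p = ContinuousLinearMap.id ℝ _ := by
      have h5 := mfderiv_extChartAt_self (I := 𝓡 d) (x := p)
      exact h5
    rw [h4] at h3
    exact (h1.comp p (h2.comp p h3)).mfderiv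
  have hinj : ∀ p, Function.Injective (modelDeriv (𝓡 n) (𝓡 d) ι p) := by
    intro p
    rw [hιd]
    exact (Function.LeftInverse.injective (inverse_comp_chartD (hf _ (heb p)).1)).comp
      (hf _ (heb p)).2.1
  refine ⟨L, inferInstance, hT2, hsc, hconn, inferInstance, hman, ι, ⟨hιs, ?_, ?_, ?_⟩,
    ⟨⟨0, mem_ball_self hr⟩⟩, ?_⟩
  · intro p p' hpp
    have h1 : f (e p) = f (e p') := c.symm.injOn (hf _ (heb p)).1 (hf _ (heb p')).1 hpp
    exact he.injective (hfi (heb p) (heb p') h1)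
  · intro p
    obtain ⟨Λ, hΛ⟩ := LinearMap.exists_leftInverse_of_injective
      (modelDeriv (𝓡 n) (𝓡 d) ι p).toLinearMap (LinearMap.ker_eq_bot.2 (hinj p))
    let Λ' : E →L[ℝ] EuclideanSpace ℝ (Fin d) :=
      LinearMap.toContinuousLinearMap (show E →ₗ[ℝ] EuclideanSpace ℝ (Fin d) from Λ)
    have hΛ' : ∀ u, Λ' (modelDeriv (𝓡 n) (𝓡 d) ι p u) = u := fun u => LinearMap.congr_fun hΛ u
    exact ⟨Λ', hΛ'⟩
  · intro p
    refine Submodule.ext fun (v : E) => ?_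
    have h1 : v ∈ LinearMap.range (mfderiv (𝓡 d) (𝓡 n) ι p).toLinearMap
        ↔ ∃ b, modelDeriv (𝓡 n) (𝓡 d) ι p b = v := Iff.rfl
    have hy := (hf _ (heb p)).1
    have h2 := localChar_formHat_iff hα hy ((chartD (𝓡 n) x₀ (f (e p))).inverse v)
    rw [chartD_comp_inverse hy, (hf _ (heb p)).2.2] at h2
    rw [hιd] at h1
    refine h1.trans (Iff.trans ?_ h2)
    refine exists_congr fun b => ⟨fun h => ?_, fun h => ?_⟩
    · rw [← h, ContinuousLinearMap.comp_apply, inverse_comp_chartD hy]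
    · rw [ContinuousLinearMap.comp_apply, h, chartD_comp_inverse hy]
  · change c.symm (f 0) = x₀
    rw [hf0]
    exact extChartAt_to_inv x₀

end IntegralManifolds

/-! ### Decomposable pairs on a manifold and their chart expressions. -/

section Pairs
open Filter Topology Set

variable {n : ℕ} {M : Type u} [TopologicalSpace M]
  [ChartedSpace (EuclideanSpace ℝ (Fin n)) M] [IsManifold (𝓡 n) ∞ M]

/-- Two `1`-forms with Reeb fields and a compatible endomorphism field `φ` that preserves the
distributions `ker αᵢ ∩ ker dαᵢ`, these distributions being complementary and of constant rank. -/
structure IsDecomposablePair (α₁ α₂ : Π x : M, TangentSpace (𝓡 n) x →L[ℝ] ℝ)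
    (φ : Π x : M, TangentSpace (𝓡 n) x →L[ℝ] TangentSpace (𝓡 n) x)
    (Z₁ Z₂ : Π x : M, TangentSpace (𝓡 n) x) (d₁ d₂ : ℕ) : Prop where
  smooth_α₁ : IsSmoothOneForm (𝓡 n) α₁
  smooth_α₂ : IsSmoothOneForm (𝓡 n) α₂
  smooth_φ : IsSmoothEndomorphism (𝓡 n) φ
  reeb : IsReebPair α₁ α₂ Z₁ Z₂
  φ_sq : ∀ x v, φ x (φ x v) = -v + α₁ x v • Z₁ x + α₂ x v • Z₂ x
  φ_Z₁ : ∀ x, φ x (Z₁ x) = 0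
  φ_Z₂ : ∀ x, φ x (Z₂ x) = 0
  φ_mem₁ : ∀ x, ∀ v ∈ charDistribution (𝓡 n) α₁ x, φ x v ∈ charDistribution (𝓡 n) α₁ x
  φ_mem₂ : ∀ x, ∀ v ∈ charDistribution (𝓡 n) α₂ x, φ x v ∈ charDistribution (𝓡 n) α₂ x
  isCompl : ∀ x, IsCompl (charDistribution (𝓡 n) α₁ x) (charDistribution (𝓡 n) α₂ x)
  finrank₁ : ∀ x, Module.finrank ℝ (charDistribution (𝓡 n) α₁ x) = d₁
  finrank₂ : ∀ x, Module.finrank ℝ (charDistribution (𝓡 n) α₂ x) = d₂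

/-- The pair is normal: in every chart, `[φ, φ] + dα₁ ⊗ Z₁ + dα₂ ⊗ Z₂ = 0` at the center. -/
def IsNormalPair (α₁ α₂ : Π x : M, TangentSpace (𝓡 n) x →L[ℝ] ℝ)
    (φ : Π x : M, TangentSpace (𝓡 n) x →L[ℝ] TangentSpace (𝓡 n) x)
    (Z₁ Z₂ : Π x : M, TangentSpace (𝓡 n) x) : Prop :=
  ∀ x₀, IsNormalAt (endHat (𝓡 n) φ x₀) (formHat (𝓡 n) α₁ x₀) (formHat (𝓡 n) α₂ x₀)
    (fieldHat (𝓡 n) Z₁ x₀) (fieldHat (𝓡 n) Z₂ x₀) (extChartAt (𝓡 n) x₀ x₀)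

omit [IsManifold (𝓡 n) ∞ M] in
theorem IsNormalPair.swap {α₁ α₂ : Π x : M, TangentSpace (𝓡 n) x →L[ℝ] ℝ}
    {φ : Π x : M, TangentSpace (𝓡 n) x →L[ℝ] TangentSpace (𝓡 n) x}
    {Z₁ Z₂ : Π x : M, TangentSpace (𝓡 n) x} (h : IsNormalPair α₁ α₂ φ Z₁ Z₂) :
    IsNormalPair α₂ α₁ φ Z₂ Z₁ := fun x₀ => (h x₀).swap

theorem IsReebPair.swap {α₁ α₂ : Π x : M, TangentSpace (𝓡 n) x →L[ℝ] ℝ}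
    {Z₁ Z₂ : Π x : M, TangentSpace (𝓡 n) x} (R : IsReebPair α₁ α₂ Z₁ Z₂) :
    IsReebPair α₂ α₁ Z₂ Z₁ where
  smooth₁ := R.smooth₂
  smooth₂ := R.smooth₁
  form₁₁ := R.form₂₂
  form₂₂ := R.form₁₁
  form₁₂ := R.form₂₁
  form₂₁ := R.form₁₂
  contract₁₁ := R.contract₂₂
  contract₂₁ := R.contract₁₂
  contract₁₂ := R.contract₂₁
  contract₂₂ := R.contract₁₁

/-- A `2`-form contracted with a vector of its kernel vanishes in every chart. -/
theorem dform_formHat_eq_zero {α : Π x : M, TangentSpace (𝓡 n) x →L[ℝ] ℝ}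
    (hα : IsSmoothOneForm (𝓡 n) α) {Z : Π x : M, TangentSpace (𝓡 n) x} {x₀ : M}
    (h : (extDer (𝓡 n) α x₀).curryLeft (Z x₀) = 0) (u : EuclideanSpace ℝ (Fin n)) :
    dform (formHat (𝓡 n) α x₀) (extChartAt (𝓡 n) x₀ x₀)
      (fieldHat (𝓡 n) Z x₀ (extChartAt (𝓡 n) x₀ x₀)) u = 0 := by
  have : IsManifold (𝓡 n) 1 M := .of_le (n := ∞) (by norm_num)
  rw [fieldHat_self, ← extDer_eq_dform α (differentiableAt_formHat hα x₀)]
  exact (mem_ker_curryLeft_iff _ _).1 (LinearMap.mem_ker.2 h) u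

namespace IsDecomposablePair

variable {α₁ α₂ : Π x : M, TangentSpace (𝓡 n) x →L[ℝ] ℝ}
  {φ : Π x : M, TangentSpace (𝓡 n) x →L[ℝ] TangentSpace (𝓡 n) x}
  {Z₁ Z₂ : Π x : M, TangentSpace (𝓡 n) x} {d₁ d₂ : ℕ}

theorem swap (D : IsDecomposablePair α₁ α₂ φ Z₁ Z₂ d₁ d₂) :
    IsDecomposablePair α₂ α₁ φ Z₂ Z₁ d₂ d₁ where
  smooth_α₁ := D.smooth_α₂
  smooth_α₂ := D.smooth_α₁
  smooth_φ := D.smooth_φ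
  reeb := D.reeb.swap
  φ_sq := fun x v => by rw [D.φ_sq, add_right_comm]
  φ_Z₁ := D.φ_Z₂
  φ_Z₂ := D.φ_Z₁
  φ_mem₁ := D.φ_mem₂
  φ_mem₂ := D.φ_mem₁
  isCompl := fun x => (D.isCompl x).symm
  finrank₁ := D.finrank₂
  finrank₂ := D.finrank₁

variable (D : IsDecomposablePair α₁ α₂ φ Z₁ Z₂ d₁ d₂)
include D

theorem localPair (x₀ : M) : LocalPair (endHat (𝓡 n) φ x₀) (formHat (𝓡 n) α₁ x₀)
    (formHat (𝓡 n) α₂ x₀) (fieldHat (𝓡 n) Z₁ x₀) (fieldHat (𝓡 n) Z₂ x₀)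
    (extChartAt (𝓡 n) x₀ x₀) := by
  have : IsManifold (𝓡 n) 1 M := .of_le (n := ∞) (by norm_num)
  have ht : ∀ᶠ y in 𝓝 (extChartAt (𝓡 n) x₀ x₀), y ∈ (extChartAt (𝓡 n) x₀).target :=
    extChartAt_target_mem_nhds x₀
  have hφZ : ∀ {Z : Π x : M, TangentSpace (𝓡 n) x}, (∀ x, φ x (Z x) = 0) →
      ∀ᶠ y in 𝓝 (extChartAt (𝓡 n) x₀ x₀), endHat (𝓡 n) φ x₀ y (fieldHat (𝓡 n) Z x₀ y) = 0 := by
    intro Z hZ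
    filter_upwards [ht] with y hy
    rw [← fieldHat_apply_end φ Z hy, fieldHat]
    exact (congrArg _ (hZ _)).trans (map_zero _)
  refine ⟨differentiableAt_endHat D.smooth_φ x₀, differentiableAt_formHat D.smooth_α₁ x₀,
    differentiableAt_formHat D.smooth_α₂ x₀, differentiableAt_fieldHat D.reeb.smooth₁ x₀,
    differentiableAt_fieldHat D.reeb.smooth₂ x₀, ?_, hφZ D.φ_Z₁, hφZ D.φ_Z₂, ?_, ?_, ?_, ?_,
    dform_formHat_eq_zero D.smooth_α₁ (D.reeb.contract₁₁ x₀),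
    dform_formHat_eq_zero D.smooth_α₁ (D.reeb.contract₁₂ x₀),
    dform_formHat_eq_zero D.smooth_α₂ (D.reeb.contract₂₁ x₀),
    dform_formHat_eq_zero D.smooth_α₂ (D.reeb.contract₂₂ x₀)⟩
  · filter_upwards [ht] with y hy u
    have h1 : ∀ v, modelEnd φ ((extChartAt (𝓡 n) x₀).symm y)
        (modelEnd φ ((extChartAt (𝓡 n) x₀).symm y) v) = -v
          + modelForm α₁ ((extChartAt (𝓡 n) x₀).symm y) v
            • modelField Z₁ ((extChartAt (𝓡 n) x₀).symm y)
          + modelForm α₂ ((extChartAt (𝓡 n) x₀).symm y) v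
            • modelField Z₂ ((extChartAt (𝓡 n) x₀).symm y) := D.φ_sq _
    simp only [endHat, formHat, fieldHat, ContinuousLinearMap.comp_apply, chartD_comp_inverse hy,
      h1, map_add, map_neg, map_smul, inverse_comp_chartD hy]
  · filter_upwards [ht] with y hy
    rw [formHat_fieldHat α₁ Z₁ hy]
    exact D.reeb.form₁₁ _
  · filter_upwards [ht] with y hy
    rw [formHat_fieldHat α₁ Z₂ hy]
    exact D.reeb.form₁₂ _
  · filter_upwards [ht] with y hy
    rw [formHat_fieldHat α₂ Z₁ hy]
    exact D.reeb.form₂₁ _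
  · filter_upwards [ht] with y hy
    rw [formHat_fieldHat α₂ Z₂ hy]
    exact D.reeb.form₂₂ _

theorem exists_localChar_add (x₀ : M) (u : EuclideanSpace ℝ (Fin n)) :
    ∃ u₁ ∈ localChar (formHat (𝓡 n) α₁ x₀) (extChartAt (𝓡 n) x₀ x₀),
      ∃ u₂ ∈ localChar (formHat (𝓡 n) α₂ x₀) (extChartAt (𝓡 n) x₀ x₀), u = u₁ + u₂ := by
  have h := isCompl_localChar_formHat D.smooth_α₁ D.smooth_α₂ (mem_extChartAt_target x₀)
    (D.isCompl _)
  obtain ⟨a, ha, b, hb, hab⟩ := Submodule.mem_sup.1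
    ((h.sup_eq_top ▸ Submodule.mem_top : u ∈ _ ⊔ _))
  exact ⟨a, ha, b, hb, hab.symm⟩

theorem endHat_mem_localChar₁ (x₀ : M) (u : EuclideanSpace ℝ (Fin n))
    (hu : u ∈ localChar (formHat (𝓡 n) α₁ x₀) (extChartAt (𝓡 n) x₀ x₀)) :
    endHat (𝓡 n) φ x₀ (extChartAt (𝓡 n) x₀ x₀) u
      ∈ localChar (formHat (𝓡 n) α₁ x₀) (extChartAt (𝓡 n) x₀ x₀) := by
  have : IsManifold (𝓡 n) 1 M := .of_le (n := ∞) (by norm_num)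
  have h := differentiableAt_formHat D.smooth_α₁ x₀
  rw [endHat_self]
  exact (mem_charDistribution_iff α₁ h _).1 (D.φ_mem₁ x₀ u ((mem_charDistribution_iff α₁ h u).2 hu))

/-- The almost complex structure `φ - α₂ ⊗ Z₁ + α₁ ⊗ Z₂` is integrable if and only if the torsion
of its expression in charts vanishes. -/
theorem isIntegrable_iff_nij_localJ [T2Space M] :
    IsIntegrable (𝓡 n) (fun x => φ x - (α₂ x).smulRight (Z₁ x) + (α₁ x).smulRight (Z₂ x)) ↔
      ∀ x₀ u v, nij (localJ (endHat (𝓡 n) φ x₀) (formHat (𝓡 n) α₁ x₀) (formHat (𝓡 n) α₂ x₀)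
        (fieldHat (𝓡 n) Z₁ x₀) (fieldHat (𝓡 n) Z₂ x₀)) (extChartAt (𝓡 n) x₀ x₀) u v = 0 := by
  have : IsManifold (𝓡 n) 1 M := .of_le (n := ∞) (by norm_num)
  have h : ∀ x₀ : M, endHat (𝓡 n)
      (fun x => φ x - (α₂ x).smulRight (Z₁ x) + (α₁ x).smulRight (Z₂ x)) x₀
      =ᶠ[𝓝 (extChartAt (𝓡 n) x₀ x₀)] localJ (endHat (𝓡 n) φ x₀) (formHat (𝓡 n) α₁ x₀)
        (formHat (𝓡 n) α₂ x₀) (fieldHat (𝓡 n) Z₁ x₀) (fieldHat (𝓡 n) Z₂ x₀) := by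
    intro x₀
    filter_upwards with y
    refine ContinuousLinearMap.ext fun u => ?_
    have h1 : ∀ x v, modelEnd
        (fun x => φ x - (α₂ x).smulRight (Z₁ x) + (α₁ x).smulRight (Z₂ x)) x v
        = modelEnd φ x v - modelForm α₂ x v • modelField Z₁ x
          + modelForm α₁ x v • modelField Z₂ x := fun x v => rfl
    simp only [endHat, ContinuousLinearMap.comp_apply, h1, map_add, map_sub, map_smul]
    rfl
  rw [isIntegrable_iff fun x₀ =>
    (h x₀).differentiableAt_iff.2 (D.localPair x₀).differentiableAt_localJ]
  exact forall_congr' fun x₀ => forall_congr' fun u => forall_congr' fun v =>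
    Iff.of_eq (congrArg (· = 0) (nij_congr (h x₀) u v))

end IsDecomposablePair
end Pairs

/-! ### The equivalences on the manifold and the main theorem. -/

section Equivalences
open Filter Topology Set

variable {n : ℕ} {M : Type u} [TopologicalSpace M]
  [ChartedSpace (EuclideanSpace ℝ (Fin n)) M] [IsManifold (𝓡 n) ∞ M]

namespace IsDecomposablePair

variable {α₁ α₂ : Π x : M, TangentSpace (𝓡 n) x →L[ℝ] ℝ}
  {φ : Π x : M, TangentSpace (𝓡 n) x →L[ℝ] TangentSpace (𝓡 n) x}
  {Z₁ Z₂ : Π x : M, TangentSpace (𝓡 n) x} {d₁ d₂ : ℕ}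
  (D : IsDecomposablePair α₁ α₂ φ Z₁ Z₂ d₁ d₂)
include D

theorem Z₁_mem (x : M) : Z₁ x ∈ charDistribution (𝓡 n) α₂ x :=
  ⟨D.reeb.form₂₁ x, D.reeb.contract₂₁ x⟩

theorem nijenhuis_eq_zero_of_isNormalPair (hN : IsNormalPair α₁ α₂ φ Z₁ Z₂)
    {X Y : Π x : M, TangentSpace (𝓡 n) x} (hX : IsSmoothVectorField (𝓡 n) X)
    (hY : IsSmoothVectorField (𝓡 n) Y) (hXF : ∀ x, X x ∈ charDistribution (𝓡 n) α₁ x)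
    (hYF : ∀ x, Y x ∈ charDistribution (𝓡 n) α₂ x) (x : M) : nijenhuis (𝓡 n) φ X Y x = 0 := by
  have : IsManifold (𝓡 n) 1 M := .of_le (n := ∞) (by norm_num)
  refine (nijenhuis_eq_nij φ X Y (differentiableAt_endHat D.smooth_φ x)
    (differentiableAt_fieldHat hX x) (differentiableAt_fieldHat hY x)).trans ?_
  have h1 := (mem_charDistribution_iff α₁ (differentiableAt_formHat D.smooth_α₁ x)
    (modelField X x)).1 (hXF x)
  have h2 := (mem_charDistribution_iff α₂ (differentiableAt_formHat D.smooth_α₂ x)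
    (modelField Y x)).1 (hYF x)
  have h := hN x (modelField X x) (modelField Y x)
  rw [h1.2, dform_swap (formHat (𝓡 n) α₂ x), h2.2, neg_zero, zero_smul, zero_smul, add_zero,
    add_zero] at h
  exact h

/-- Project the constant field u onto the distribution by the smooth projector. The mixed torsion
condition, stated for sections, can then be tested on arbitrary vectors. -/
theorem exists_section₁ (x₀ : M) (u : EuclideanSpace ℝ (Fin n))
    (hu : u ∈ localChar (formHat (𝓡 n) α₁ x₀) (extChartAt (𝓡 n) x₀ x₀)) :
    ∃ s : EuclideanSpace ℝ (Fin n) → EuclideanSpace ℝ (Fin n),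
      ContDiffOn ℝ ∞ s (extChartAt (𝓡 n) x₀).target ∧ s (extChartAt (𝓡 n) x₀ x₀) = u ∧
      ∀ y ∈ (extChartAt (𝓡 n) x₀).target, chartD (𝓡 n) x₀ y (s y)
        ∈ charDistribution (𝓡 n) α₁ ((extChartAt (𝓡 n) x₀).symm y) := by
  obtain ⟨P, hP, hPF⟩ := exists_contDiffOn_projector (isOpen_extChartAt_target x₀)
    (contDiffOn_formHat x₀ D.smooth_α₁) (contDiffOn_formHat x₀ D.smooth_α₂)
    fun y hy => isCompl_localChar_formHat D.smooth_α₁ D.smooth_α₂ hy (D.isCompl _)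
  exact ⟨fun y => P y u, hP.clm_apply contDiffOn_const,
    (hPF _ (mem_extChartAt_target x₀)).2 u hu,
    fun y hy => (localChar_formHat_iff D.smooth_α₁ hy _).1 ((hPF y hy).1 u)⟩

theorem inducedStructuresNormal_of_isNormalPair (hN : IsNormalPair α₁ α₂ φ Z₁ Z₂) :
    InducedStructuresNormal (charDistribution (𝓡 n) α₂) α₁ Z₁ φ := by
  have : IsManifold (𝓡 n) 1 M := .of_le (n := ∞) (by norm_num)
  intro d L _ _ _ _ _ _ ι hι
  rw [hι.isNormalAlmostContact_iff D.smooth_α₁ D.reeb.smooth₁ D.smooth_φ D.Z₁_mem D.φ_mem₂]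
  intro p t a b u v hu _
  exact (D.localPair (ι p)).nij_localCone_eq_zero_of_isNormalAt (hN (ι p)) t
    ((mem_charDistribution_iff α₂ (differentiableAt_formHat D.smooth_α₂ _) u).1 hu) (v, b)

/-- Normality of leaves says something at x₀ only because an integral manifold passes through it;
this is where Frobenius' theorem enters. -/
theorem nij_localCone_of_inducedStructuresNormal
    (h : InducedStructuresNormal (charDistribution (𝓡 n) α₂) α₁ Z₁ φ) (x₀ : M)
    (u : EuclideanSpace ℝ (Fin n))
    (hu : u ∈ localChar (formHat (𝓡 n) α₂ x₀) (extChartAt (𝓡 n) x₀ x₀))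
    (v : EuclideanSpace ℝ (Fin n))
    (hv : v ∈ localChar (formHat (𝓡 n) α₂ x₀) (extChartAt (𝓡 n) x₀ x₀)) :
    nij (localCone (endHat (𝓡 n) φ x₀) (formHat (𝓡 n) α₁ x₀) (fieldHat (𝓡 n) Z₁ x₀))
      (extChartAt (𝓡 n) x₀ x₀, 0) (u, 0) (v, 0) = 0 := by
  have : IsManifold (𝓡 n) 1 M := .of_le (n := ∞) (by norm_num)
  obtain ⟨L, _, _, _, _, _, _, ι, hι, p, rfl⟩ := exists_isIntegralManifold D.smooth_α₂ D.smooth_α₁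
    (fun x => (D.isCompl x).symm) D.finrank₂ x₀
  have h1 := h d₂ L ι hι
  rw [hι.isNormalAlmostContact_iff D.smooth_α₁ D.reeb.smooth₁ D.smooth_φ D.Z₁_mem D.φ_mem₂] at h1
  have hd := differentiableAt_formHat D.smooth_α₂ (ι p)
  exact h1 p 0 0 0 u v ((mem_charDistribution_iff α₂ hd u).2 hu)
    ((mem_charDistribution_iff α₂ hd v).2 hv)

variable [T2Space M]

theorem lieDerivativeVanishes₂_of_isIntegrable
    (hJ : IsIntegrable (𝓡 n) (fun x => φ x - (α₂ x).smulRight (Z₁ x) + (α₁ x).smulRight (Z₂ x)))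
    (hL : LieDerivativeVanishes (𝓡 n) Z₁ φ) : LieDerivativeVanishes (𝓡 n) Z₂ φ := by
  rw [lieDerivativeVanishes_iff D.smooth_φ] at hL ⊢
  exact fun x₀ => (D.localPair x₀).lieEnd_Z₂_eq_zero (D.isIntegrable_iff_nij_localJ.1 hJ x₀) (hL x₀)

theorem lieDerivativeVanishes₁_of_isIntegrable
    (hJ : IsIntegrable (𝓡 n) (fun x => φ x - (α₂ x).smulRight (Z₁ x) + (α₁ x).smulRight (Z₂ x)))
    (hL : LieDerivativeVanishes (𝓡 n) Z₂ φ) : LieDerivativeVanishes (𝓡 n) Z₁ φ := by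
  rw [lieDerivativeVanishes_iff D.smooth_φ] at hL ⊢
  exact fun x₀ => (D.localPair x₀).lieEnd_Z₁_eq_zero (D.isIntegrable_iff_nij_localJ.1 hJ x₀) (hL x₀)

theorem isNormalPair_of_isIntegrable
    (hJ : IsIntegrable (𝓡 n) (fun x => φ x - (α₂ x).smulRight (Z₁ x) + (α₁ x).smulRight (Z₂ x)))
    (hL₁ : LieDerivativeVanishes (𝓡 n) Z₁ φ) (hL₂ : LieDerivativeVanishes (𝓡 n) Z₂ φ) :
    IsNormalPair α₁ α₂ φ Z₁ Z₂ := by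
  rw [lieDerivativeVanishes_iff D.smooth_φ] at hL₁ hL₂
  exact fun x₀ => (D.localPair x₀).isNormalAt_of_nij_localJ
    (D.isIntegrable_iff_nij_localJ.1 hJ x₀) (hL₁ x₀) (hL₂ x₀) (D.exists_localChar_add x₀)
    (D.endHat_mem_localChar₁ x₀) (D.swap.endHat_mem_localChar₁ x₀)

theorem isIntegrable_of_isNormalPair (hN : IsNormalPair α₁ α₂ φ Z₁ Z₂) :
    IsIntegrable (𝓡 n) (fun x => φ x - (α₂ x).smulRight (Z₁ x) + (α₁ x).smulRight (Z₂ x)) :=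
  D.isIntegrable_iff_nij_localJ.2 fun x₀ =>
    (D.localPair x₀).nij_localJ_eq_zero_of_isNormalAt (hN x₀)

theorem nij_eq_zero_of_mixed
    (h : ∀ X Y : Π x : M, TangentSpace (𝓡 n) x, IsSmoothVectorField (𝓡 n) X →
      IsSmoothVectorField (𝓡 n) Y → (∀ x, X x ∈ charDistribution (𝓡 n) α₁ x) →
      (∀ x, Y x ∈ charDistribution (𝓡 n) α₂ x) → ∀ x, nijenhuis (𝓡 n) φ X Y x = 0) (x₀ : M)
    (u : EuclideanSpace ℝ (Fin n))
    (hu : u ∈ localChar (formHat (𝓡 n) α₁ x₀) (extChartAt (𝓡 n) x₀ x₀))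
    (v : EuclideanSpace ℝ (Fin n))
    (hv : v ∈ localChar (formHat (𝓡 n) α₂ x₀) (extChartAt (𝓡 n) x₀ x₀)) :
    nij (endHat (𝓡 n) φ x₀) (extChartAt (𝓡 n) x₀ x₀) u v = 0 := by
  obtain ⟨s, hs, rfl, hsF⟩ := D.exists_section₁ x₀ u hu
  obtain ⟨t, ht, rfl, htF⟩ := D.swap.exists_section₁ x₀ v hv
  exact nij_eq_zero_of_nijenhuis (differentiableAt_endHat D.smooth_φ x₀) h
    (isOpen_extChartAt_target x₀) (mem_extChartAt_target x₀) hs ht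
    (fun y hy _ => hsF y hy) (fun y hy _ => htF y hy)

/-- Normality of the pair means that the structures induced on the leaves are normal and that the
torsion of `φ` vanishes on pairs of sections of the two distributions. -/
theorem isNormalPair_iff : IsNormalPair α₁ α₂ φ Z₁ Z₂ ↔
    (InducedStructuresNormal (charDistribution (𝓡 n) α₂) α₁ Z₁ φ ∧
      InducedStructuresNormal (charDistribution (𝓡 n) α₁) α₂ Z₂ φ) ∧
    ∀ X Y : Π x : M, TangentSpace (𝓡 n) x, IsSmoothVectorField (𝓡 n) X →
      IsSmoothVectorField (𝓡 n) Y → (∀ x, X x ∈ charDistribution (𝓡 n) α₁ x) →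
      (∀ x, Y x ∈ charDistribution (𝓡 n) α₂ x) → ∀ x, nijenhuis (𝓡 n) φ X Y x = 0 := by
  refine ⟨fun hN => ⟨⟨D.inducedStructuresNormal_of_isNormalPair hN,
    D.swap.inducedStructuresNormal_of_isNormalPair hN.swap⟩,
    fun X Y hX hY hXF hYF => D.nijenhuis_eq_zero_of_isNormalPair hN hX hY hXF hYF⟩,
    fun ⟨⟨h₁, h₂⟩, h⟩ x₀ => ?_⟩
  exact (D.localPair x₀).isNormalAt_of_nij_localCone (D.exists_localChar_add x₀)
    (D.nij_localCone_of_inducedStructuresNormal h₁ x₀)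
    (D.swap.nij_localCone_of_inducedStructuresNormal h₂ x₀) (D.nij_eq_zero_of_mixed h x₀)

/-- Under the hypothesis that one, hence by integrability each, Reeb field preserves `φ`,
integrability of the almost complex structure is normality of the pair. -/
theorem isIntegrable_iff_isNormalPair
    (hL : LieDerivativeVanishes (𝓡 n) Z₁ φ ∨ LieDerivativeVanishes (𝓡 n) Z₂ φ) :
    IsIntegrable (𝓡 n) (fun x => φ x - (α₂ x).smulRight (Z₁ x) + (α₁ x).smulRight (Z₂ x)) ↔
      IsNormalPair α₁ α₂ φ Z₁ Z₂ := by
  refine ⟨fun hJ => ?_, D.isIntegrable_of_isNormalPair⟩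
  rcases hL with h | h
  · exact D.isNormalPair_of_isIntegrable hJ h (D.lieDerivativeVanishes₂_of_isIntegrable hJ h)
  · exact D.isNormalPair_of_isIntegrable hJ (D.lieDerivativeVanishes₁_of_isIntegrable hJ h) h

end IsDecomposablePair

namespace ContactPairStructure

variable {h k : ℕ} {M : Type u} [TopologicalSpace M]
  [ChartedSpace (EuclideanSpace ℝ (Fin (2 * h + 2 * k + 2))) M]
  [IsManifold (𝓡 (2 * h + 2 * k + 2)) ∞ M] {S : ContactPairStructure h k M}

/-- The volume and rank conditions matter only through this linear algebra in each tangent space. -/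
theorem IsDecomposable.isDecomposablePair (hS : S.IsDecomposable) :
    IsDecomposablePair S.α₁ S.α₂ S.φ S.Z₁ S.Z₂ (2 * k + 1) (2 * h + 1) := by
  have key := fun x => isCompl_of_wedge_ne_zero
    (V := EuclideanSpace ℝ (Fin (2 * h + 2 * k + 2))) finrank_euclideanSpace_fin
    (S.contactPair.volume x) (S.contactPair.pow₁ x) (S.contactPair.pow₂ x)
  exact ⟨S.contactPair.smooth₁, S.contactPair.smooth₂, S.smooth_φ, S.reeb, S.φ_sq, S.φ_Z₁, S.φ_Z₂,
    fun x => (hS x).1, fun x => (hS x).2, fun x => (key x).1, fun x => (key x).2.1,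
    fun x => (key x).2.2⟩

variable [T2Space M]

theorem tfae_of_lieDerivativeVanishes (hS : S.IsDecomposable)
    (hL : LieDerivativeVanishes (𝓡 (2 * h + 2 * k + 2)) S.Z₁ S.φ ∨
      LieDerivativeVanishes (𝓡 (2 * h + 2 * k + 2)) S.Z₂ S.φ) :
    [S.JIntegrable, S.TIntegrable, S.LeavesNormal ∧ S.MixedTorsionVanishes].TFAE := by
  have D := hS.isDecomposablePair
  have hJ : S.JIntegrable ↔ IsNormalPair S.α₁ S.α₂ S.φ S.Z₁ S.Z₂ :=
    D.isIntegrable_iff_isNormalPair hL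
  -- T is the J of the pair with indices exchanged.
  have eT : S.T = fun x => S.φ x - (S.α₁ x).smulRight (S.Z₂ x) + (S.α₂ x).smulRight (S.Z₁ x) :=
    funext fun x => add_sub_right_comm _ _ _
  have hT : S.TIntegrable ↔ IsNormalPair S.α₁ S.α₂ S.φ S.Z₁ S.Z₂ := by
    rw [TIntegrable, eT]
    exact (D.swap.isIntegrable_iff_isNormalPair hL.symm).trans
      ⟨IsNormalPair.swap, IsNormalPair.swap⟩
  have hN : S.LeavesNormal ∧ S.MixedTorsionVanishes ↔ IsNormalPair S.α₁ S.α₂ S.φ S.Z₁ S.Z₂ :=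
    D.isNormalPair_iff.symm
  tfae_have 1 ↔ 2 := hJ.trans hT.symm
  tfae_have 1 ↔ 3 := hJ.trans hN.symm
  tfae_finish

end ContactPairStructure

end Equivalences
end ContactPairs

theorem mainTheorem4 (h k : ℕ) (M : Type u) [TopologicalSpace M] [T2Space M]
    [SecondCountableTopology M]
    [ChartedSpace (EuclideanSpace ℝ (Fin (2 * h + 2 * k + 2))) M]
    [IsManifold (𝓡 (2 * h + 2 * k + 2)) ∞ M]
    (S : ContactPairs.ContactPairStructure h k M) (hS : S.IsDecomposable) :
    (ContactPairs.LieDerivativeVanishes (𝓡 (2 * h + 2 * k + 2)) S.Z₁ S.φ →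
      [S.JIntegrable, S.TIntegrable, S.LeavesNormal ∧ S.MixedTorsionVanishes].TFAE ∧
      (S.JIntegrable → ContactPairs.LieDerivativeVanishes (𝓡 (2 * h + 2 * k + 2)) S.Z₂ S.φ)) ∧
    (ContactPairs.LieDerivativeVanishes (𝓡 (2 * h + 2 * k + 2)) S.Z₂ S.φ →
      [S.JIntegrable, S.TIntegrable, S.LeavesNormal ∧ S.MixedTorsionVanishes].TFAE ∧
      (S.JIntegrable → ContactPairs.LieDerivativeVanishes (𝓡 (2 * h + 2 * k + 2)) S.Z₁ S.φ)) :=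
  ⟨fun hL => ⟨ContactPairs.ContactPairStructure.tfae_of_lieDerivativeVanishes hS (.inl hL),
    fun hJ => hS.isDecomposablePair.lieDerivativeVanishes₂_of_isIntegrable hJ hL⟩,
  fun hL => ⟨ContactPairs.ContactPairStructure.tfae_of_lieDerivativeVanishes hS (.inr hL),
    fun hJ => hS.isDecomposablePair.lieDerivativeVanishes₁_of_isIntegrable hJ hL⟩⟩
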